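/- Let $X$ be a Polish space with a Borel probability measure $\mu$, and let $G$ be a graphing on $(X,\mu)$: a (simple, undirected) graph with vertex set $X$ whose edge set $E(G)\subseteq X^2$ is Borel and which preserves $\mu$, i.e. $\int_A |N(x)\cap B|\,d\mu(x)=\int_B |N(x)\cap A|\,d\mu(x)$ for all Borel $A,B\subseteq X$, where $N(x)$ is the set of neighbours of $x$. Assume that - $G$ is locally finite: $N(x)$ is finite for every $x\in X$; - $G$ is one-ended: for almost every $x$, the connected component of $x$ has, after the removal of any finite set of its vertices, exactly one infinite connected component; - $G$ is hyperfinite: there are Borel equivalence relations $F_0\subseteq F_1\subseteq\cdots$ on $X$ with finite classes such that for almost every $x$ the connected component of $x$ is $\bigcup_n [x]_{F_n}$. For $f:X\to\mathbb{Z}$, an $f$-flow is a function $\phi:E(G)\to\mathbb{R}$ with $\phi(x,y)=-\phi(y,x)$ for every $(x,y)\in E(G)$ and $\sum_{y\in N(x)}\phi(x,y)=f(x)$ for every $x\in X$; it is bounded if $\sup_{E(G)}|\phi|<\infty$. Let $f:X\to\mathbb{Z}$ be bounded and $\mu$-measurable. If $G$ admits a (not necessarily measurable) bounded real-valued $f$-flow,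 then $G$ admits a bounded integer-valued measurable $f$-flow $\psi$. Here measurable means measurable up to null sets: there is a Borel function $\psi':X^2\to\mathbb{Z}$ such that for almost every $x$, $\psi(x,y)=\psi'(x,y)$ for all $y\in N(x)$. -/

import Mathlib

open MeasureTheory
open scoped ENNReal

namespace GraphingFlow

/-- Every vertex has finitely many neighbours. -/
def IsLocallyFinite {X : Type*} (G : SimpleGraph X) : Prop :=
  ∀ x, (G.neighborSet x).Finite

/-- `G` is a graphing on the probability space `(X, μ)`: the edge set is a Borel subset of `X × X`,
and `G` preserves `μ`, that is, for all Borel sets `A`, `B`, counting the edges from `A` to `B`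
from either side gives the same value: `∫_A deg_B dμ = ∫_B deg_A dμ`. -/
structure IsGraphing {X : Type*} [MeasurableSpace X] (G : SimpleGraph X) (μ : Measure X) :
    Prop where
  measurableSet_adj : MeasurableSet {p : X × X | G.Adj p.1 p.2}
  lintegral_deg_comm : ∀ A B : Set X, MeasurableSet A → MeasurableSet B →
    ∫⁻ x in A, ((G.neighborSet x ∩ B).encard : ℝ≥0∞) ∂μ =
      ∫⁻ x in B, ((G.neighborSet x ∩ A).encard : ℝ≥0∞) ∂μ

/-- A (connected, locally finite) graph is one-ended if the removal of any finite set of vertices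
leaves exactly one infinite connected component. -/
def IsOneEnded {V : Type*} (H : SimpleGraph V) : Prop :=
  H.Connected ∧ ∀ K : Set V, K.Finite → ∃! C : H.ComponentCompl K, C.supp.Infinite

/-- A graphing is one-ended if the connected component of almost every vertex is one-ended. -/
def IsOneEndedAE {X : Type*} [MeasurableSpace X] (G : SimpleGraph X) (μ : Measure X) : Prop :=
  ∀ᵐ x ∂μ, IsOneEnded (G.connectedComponentMk x).toSimpleGraph

/-- A graphing is hyperfinite if, up to a null set, its connectedness relation is the union of an
increasing sequence of Borel equivalence relations with finite classes. -/
def IsHyperfinite {X : Type*} [MeasurableSpace X] (G : SimpleGraph X) (μ : Measure X) : Prop :=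
  ∃ F : ℕ → Setoid X, Monotone F ∧
    (∀ n, MeasurableSet {p : X × X | (F n) p.1 p.2}) ∧
    (∀ n x, {y | (F n) x y}.Finite) ∧
    ∀ᵐ x ∂μ, ∀ y, G.Reachable x y ↔ ∃ n, (F n) x y

/-- `φ` is an `f`-flow on the locally finite graph `G`: it is antisymmetric on edges, and the total
flow out of each vertex `x` equals `f x`. Only the values of `φ` on edges of `G` matter. -/
def IsFlow {X : Type*} (G : SimpleGraph X) (f : X → ℤ) (φ : X → X → ℝ) : Prop :=
  (∀ x y, G.Adj x y → φ x y = -φ y x) ∧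
    ∀ x, ∑ᶠ y ∈ G.neighborSet x, φ x y = (f x : ℝ)

/-- The function `φ` on the edges of `G` is bounded. -/
def IsBoundedOnEdges {X : Type*} (G : SimpleGraph X) (φ : X → X → ℝ) : Prop :=
  ∃ C : ℝ, ∀ x y, G.Adj x y → |φ x y| ≤ C

/-- The integer-valued function `ψ` on the edges of `G` is measurable with respect to (the
completion of) the edge measure `S ↦ ∫ #{y | (x, y) ∈ S ∩ E(G)} dμ(x)`: it agrees with a Borel
function at almost every edge, i.e. at all edges starting at almost every vertex. -/
def IsMeasurableOnEdges {X : Type*} [MeasurableSpace X] (G : SimpleGraph X) (μ : Measure X)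
    (ψ : X → X → ℤ) : Prop :=
  ∃ ψ' : X × X → ℤ, Measurable ψ' ∧ ∀ᵐ x ∂μ, ∀ y, G.Adj x y → ψ x y = ψ' (x, y)

end GraphingFlow

/-!
The proof first replaces the given flow by a measurable real one and then rounds it to integers
along a measurable decomposition of the graph into finite layers.

*Measurability.* Projections of Borel sets are measurable up to null sets, and by preservation of
`μ` the vertices with a neighbour in a null set form a null set. So a null union of components can be
discarded such that on the rest the components are enumerated by countably many Borel maps and the
graph is an increasing union of Borel graphs with finite components (`IsGraphing.exists_isTame`).
From then on whatever is defined from Borel data by quantifiers and sums over a component is Borel,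
the mass transport principle holds (`IsTame.mass_transport`), and choices inside finite components
can be made in a Borel way (`IsEnum.exists_measurable_selection`).

*A measurable real flow.* By rounding on finite sets and compactness there is a bounded integer flow,
in general not measurable (`exists_integer_flow`). Its restrictions to the finite pieces of the
exhaustion, among which Borel ones can be selected, show that the bounded Borel functions that
satisfy the flow equations inside the pieces of stage `n` form a nonempty convex set in a Hilbert
space. These sets decrease with `n`. Almost shortest elements of them form a Cauchy sequence, whose
limit is a Borel flow (`IsTame.exists_measurable_flow`).

*Small connected sections.* A section is a Borel set that meets almost every component in a nonempty
connected set. There are sections of arbitrarily small measure (`exists_isSection_measure_lt`).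
To see this, choose a spanning forest of a section and remove leaves over and over again. At every
stage this leaves a section, and as forests with finite pieces have average degree at most two, what
remains in the end is a bi-infinite line in a component or nothing
(`IsSection.exists_isLineCore`). If all vertices are projected onto a line, the fibres are finite
almost everywhere, and one-endedness gives, over every vertex of the line, an edge of `G` between the
fibres of two far apart vertices on either side (`OneEndedAt.exists_crossing`). A disjoint family of
such edges jumps over about a fifth of the line, so that the section can be replaced by one of at
most about four fifths of its measure (`IsSection.exists_shortened`).

*Layers.* Small sections, enlarged by the boundaries of the finite pieces of the exhaustion, are
united to a decreasing sequence of sections with empty intersection, up to a null set, that cut the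
graph into finite components (`exists_isVanishing`). After passing to a subsequence, this numbers the
vertices by layers such that, for every `n`, the vertices of the layers up to `n` induce finite
components, and all edges from such a component to higher layers end in one connected
component of a single layer (`exists_isLayering`).

*Rounding.* The total flow out of a finite set of vertices is an integer. Hence the flow between a
component of a layer and the higher, or the lower, layers has an integer total, and a flow along a
tree inside this component makes the net flow at each of its vertices an integer. The flow on the
edges that end from below in layer `j`, corrected by such flows, thus has integer net flows, and it
is rounded inside the finite components of the layers up to `j`. Every vertex is affected by two
values of `j` at most, so that the corrections add up to a bounded flow that is integral on the edges
between different layers. What is left, the flow inside the finite components of the layers, is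
rounded once more (`IsTame.exists_measurable_integer_flow`).
-/


open Filter Topology

namespace GraphingFlow

/-! ### Analytic sets -/

/-- If a compact box `{x | ∀ i, x i ≤ N i}` of the Baire space lies in an open set, so does one of
the larger sets in which only finitely many coordinates are bounded. -/
theorem exists_initial_box_subset (N : ℕ → ℕ) (V : Set (ℕ → ℕ)) (hV : IsOpen V)
    (hNV : {x : ℕ → ℕ | ∀ i, x i ≤ N i} ⊆ V) : ∃ k, {x : ℕ → ℕ | ∀ i < k, x i ≤ N i} ⊆ V := by
  by_contra! hcon
  have h1 : ∀ k, ∃ x : ℕ → ℕ, (∀ i < k, x i ≤ N i) ∧ x ∉ V := fun k => by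
    obtain ⟨x, hx, hxV⟩ := Set.not_subset.1 (hcon k)
    exact ⟨x, hx, hxV⟩
  choose x hx hxV using h1
  have hcomp : IsCompact {x : ℕ → ℕ | ∀ i, x i ≤ N i} := by
    have := isCompact_univ_pi (s := fun i => Set.Iic (N i)) fun i => (Set.finite_Iic (N i)).isCompact
    convert this using 1
    ext x; simp [Pi.le_def]
  obtain ⟨y, hy, φ, hφ, hlim⟩ := hcomp.tendsto_subseq (x := fun k i => min (x k i) (N i))
    (fun k i => min_le_right _ _)
  have hlim2 : Tendsto (fun k => x (φ k)) atTop (𝓝 y) := by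
    rw [tendsto_pi_nhds] at hlim ⊢
    intro i
    refine (hlim i).congr' ?_
    filter_upwards [eventually_gt_atTop i] with k hk
    exact min_eq_left (hx _ _ (hk.trans_le (hφ.id_le k)))
  obtain ⟨k, hk⟩ := (hlim2.eventually (hV.mem_nhds (hNV hy))).exists
  exact hxV _ hk

/-- An analytic set contains compact sets of measure arbitrarily close to its outer measure. -/
theorem exists_isCompact_subset_of_lt_measure {X : Type*} [TopologicalSpace X] [PolishSpace X]
    [MeasurableSpace X] [BorelSpace X] (μ : Measure X) [IsFiniteMeasure μ] {A : Set X}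
    (hA : AnalyticSet A) {c : ℝ≥0∞} (hc : c < μ A) : ∃ K ⊆ A, IsCompact K ∧ c ≤ μ K := by
  rw [AnalyticSet] at hA
  rcases hA with rfl | ⟨f, hf, rfl⟩
  · simp at hc
  let P : ℕ → (ℕ → ℕ) → Prop := fun k g => c < μ (f '' {x | ∀ i < k, x i ≤ g i})
  -- the coordinates are bounded one after the other, at the cost of little outer measure
  have step : ∀ k g, P k g → ∃ m, P (k + 1) (Function.update g k m) := by
    intro k g hg
    have hmono : Monotone fun m => f '' {x | ∀ i < k + 1, x i ≤ Function.update g k m i} := by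
      intro m m' hm
      refine Set.image_mono fun x hx i hi => (hx i hi).trans ?_
      by_cases hik : i = k
      · subst hik; simpa using hm
      · simp [hik]
    have hU : f '' {x | ∀ i < k, x i ≤ g i} ⊆
        ⋃ m, f '' {x | ∀ i < k + 1, x i ≤ Function.update g k m i} := by
      rintro _ ⟨x, hx, rfl⟩
      refine Set.mem_iUnion.2 ⟨x k, x, fun i hi => ?_, rfl⟩
      by_cases hik : i = k
      · subst hik; simp
      · simpa [hik] using hx i (by omega)
    have h2 := lt_of_lt_of_le hg (measure_mono hU)
    rw [hmono.measure_iUnion] at h2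
    exact lt_iSup_iff.1 h2
  choose! m hm using step
  let g : ℕ → ℕ → ℕ := fun k => Nat.rec (fun _ => 0) (fun k g => Function.update g k (m k g)) k
  have hg : ∀ k, P k (g k) := by
    intro k
    induction k with
    | zero => simpa [P] using hc
    | succ k ih => exact hm k _ ih
  have hstab : ∀ i d, g (i + 1 + d) i = g (i + 1) i := by
    intro i d
    induction d with
    | zero => rfl
    | succ d ih =>
      rw [← ih]
      exact Function.update_of_ne (show i ≠ i + 1 + d by omega) _ _
  let N : ℕ → ℕ := fun i => g (i + 1) i
  have hgN : ∀ k i, i < k → g k i = N i := by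
    intro k i hik
    obtain ⟨d, rfl⟩ : ∃ d, k = i + 1 + d := ⟨k - (i + 1), by omega⟩
    exact hstab i d
  have hcomp : IsCompact {x : ℕ → ℕ | ∀ i, x i ≤ N i} := by
    have := isCompact_univ_pi (s := fun i => Set.Iic (N i)) fun i => (Set.finite_Iic (N i)).isCompact
    convert this using 1
    ext x; simp [Pi.le_def]
  refine ⟨f '' {x | ∀ i, x i ≤ N i}, Set.image_subset_range _ _, hcomp.image hf, ?_⟩
  rw [Set.measure_eq_iInf_isOpen]
  refine le_iInf₂ fun U hU => le_iInf fun hUo => ?_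
  obtain ⟨k, hk⟩ := exists_initial_box_subset N (f ⁻¹' U) (hUo.preimage hf)
    (fun x hx => hU ⟨x, hx, rfl⟩)
  refine (hg k).le.trans (measure_mono ?_)
  rintro _ ⟨x, hx, rfl⟩
  exact hk fun i hi => (hx i hi).trans (hgN k i hi).le

/-- Analytic sets are universally measurable. -/
theorem nullMeasurableSet_of_analyticSet {X : Type*} [TopologicalSpace X] [PolishSpace X]
    [MeasurableSpace X] [BorelSpace X] (μ : Measure X) [IsFiniteMeasure μ] {A : Set X}
    (hA : AnalyticSet A) : NullMeasurableSet A μ := by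
  by_cases h0 : μ A = 0
  · exact NullMeasurableSet.of_null h0
  obtain ⟨c, -, hcl, hc⟩ := exists_seq_strictMono_tendsto' (pos_iff_ne_zero.2 h0)
  have h1 : ∀ n, ∃ K ⊆ A, IsCompact K ∧ c n ≤ μ K := fun n =>
    exists_isCompact_subset_of_lt_measure μ hA (hcl n).2
  choose K hKA hKc hKm using h1
  have hB : MeasurableSet (⋃ n, K n) := MeasurableSet.iUnion fun n => (hKc n).measurableSet
  have hBA : (⋃ n, K n) ⊆ A := Set.iUnion_subset hKA
  have hle : μ A ≤ μ (⋃ n, K n) := le_of_tendsto' hc fun n =>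
    (hKm n).trans (measure_mono (Set.subset_iUnion K n))
  have h2 : μ (toMeasurable μ A \ ⋃ n, K n) = 0 := by
    rw [measure_sdiff (hBA.trans (subset_toMeasurable μ A)) hB.nullMeasurableSet
      (measure_ne_top _ _), measure_toMeasurable]
    exact tsub_eq_zero_of_le hle
  have h3 : A =ᵐ[μ] (⋃ n, K n : Set X) := by
    refine EventuallyLE.antisymm ?_ (LE.le.eventuallyLE hBA)
    rw [ae_le_set]
    exact measure_mono_null (Set.sdiff_subset_sdiff_left (subset_toMeasurable μ A)) h2
  exact hB.nullMeasurableSet.congr h3.symm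

/-- The projection of a Borel set is measurable up to a null set. -/
theorem nullMeasurableSet_exists {X : Type*} [TopologicalSpace X] [PolishSpace X]
    [MeasurableSpace X] [BorelSpace X] (μ : Measure X) [IsFiniteMeasure μ] {S : Set (X × X)}
    (hS : MeasurableSet S) : NullMeasurableSet {x | ∃ y, (x, y) ∈ S} μ := by
  have h : {x | ∃ y, (x, y) ∈ S} = Prod.fst '' S := by
    ext x; simp
  rw [h]
  exact nullMeasurableSet_of_analyticSet μ (hS.analyticSet.image_of_continuous continuous_fst)

/-! ### Borel enumerations of components -/

section Enumeration

variable {X : Type*} [MeasurableSpace X]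

/-- Borel maps `e 0, e 1, …` enumerating the connected component of every vertex. They turn
quantifiers and sums over a component into countable ones, so that whatever is defined from Borel
data by such quantifiers and sums is Borel. -/
structure IsEnum (G : SimpleGraph X) (e : ℕ → X → X) : Prop where
  measurable_enum : ∀ i, Measurable (e i)
  reachable_iff : ∀ x y, G.Reachable x y ↔ ∃ i, e i x = y

open Classical in
/-- The indicator of a proposition, with values in `ℝ≥0∞`. -/
noncomputable def ind (p : Prop) : ℝ≥0∞ := if p then 1 else 0

theorem ind_pos {p : Prop} (h : p) : ind p = 1 := if_pos h

theorem ind_neg {p : Prop} (h : ¬p) : ind p = 0 := if_neg h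

theorem ind_ne_zero {p : Prop} : ind p ≠ 0 ↔ p := by
  by_cases h : p <;> simp [ind, h]

theorem ind_le_one (p : Prop) : ind p ≤ 1 := by
  by_cases h : p <;> simp [ind, h]

theorem ind_mono {p q : Prop} (h : p → q) : ind p ≤ ind q := by
  by_cases hp : p
  · rw [ind_pos hp, ind_pos (h hp)]
  · rw [ind_neg hp]; exact zero_le

theorem ind_and (p q : Prop) : ind (p ∧ q) = ind p * ind q := by
  by_cases hp : p <;> by_cases hq : q <;> simp [ind, hp, hq]

theorem measurable_ind {α : Type*} [MeasurableSpace α] {P : α → Prop} (hP : Measurable P) :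
    Measurable fun a => ind (P a) := by
  unfold ind
  exact Measurable.ite (measurableSet_setOfPred.2 hP) measurable_const measurable_const

theorem tsum_ind_eq_encard {α : Type*} (P : α → Prop) :
    ∑' y, ind (P y) = ({y | P y}.encard : ℝ≥0∞) := by
  have h : (fun y => ind (P y)) = {y | P y}.indicator fun _ => 1 := by
    ext y
    by_cases hy : P y <;> simp [ind, hy]
  rw [h, ← tsum_subtype, ENNReal.tsum_set_one]

theorem tsum_ind_ne_top {α : Type*} (P : α → Prop) :
    ∑' y, ind (P y) ≠ ⊤ ↔ {y | P y}.Finite := by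
  rw [tsum_ind_eq_encard]
  simp

theorem tsum_ind_eq_ncard {α : Type*} (P : α → Prop) (h : {y | P y}.Finite) :
    ∑' y, ind (P y) = ({y | P y}.ncard : ℝ≥0∞) := by
  rw [tsum_ind_eq_encard, ← h.cast_ncard_eq]
  simp

variable {G : SimpleGraph X} {e : ℕ → X → X} {α : Type*} [MeasurableSpace α]

/-- Quantification over a component preserves measurability. -/
theorem IsEnum.measurable_exists (he : IsEnum G e) {π : α → X} (hπ : Measurable π)
    {P : α → X → Prop} (hP : Measurable fun p : α × X => P p.1 p.2)
    (hsupp : ∀ a y, P a y → G.Reachable (π a) y) : Measurable fun a => ∃ y, P a y := by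
  have h : (fun a => ∃ y, P a y) = fun a => ∃ i, P a (e i (π a)) := by
    ext a
    constructor
    · rintro ⟨y, hy⟩
      obtain ⟨i, rfl⟩ := (he.reachable_iff _ _).1 (hsupp a y hy)
      exact ⟨i, hy⟩
    · rintro ⟨i, hi⟩
      exact ⟨_, hi⟩
  rw [h]
  exact Measurable.exists fun i =>
    hP.comp (measurable_id.prodMk ((he.measurable_enum i).comp hπ))

theorem IsEnum.measurable_forall (he : IsEnum G e) {π : α → X} (hπ : Measurable π)
    {P : α → X → Prop} (hP : Measurable fun p : α × X => P p.1 p.2)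
    (hsupp : ∀ a y, ¬P a y → G.Reachable (π a) y) : Measurable fun a => ∀ y, P a y := by
  have h := (he.measurable_exists hπ (P := fun a y => ¬P a y) hP.not hsupp).not
  simpa using h

theorem IsEnum.tsum_eq (he : IsEnum G e) (x : X) {f : X → ℝ≥0∞}
    (hsupp : ∀ y, f y ≠ 0 → G.Reachable x y) :
    ∑' y, f y = ∑' i, ind (∀ j < i, e j x ≠ e i x) * f (e i x) := by
  -- every `y` in the component is counted once, at its first occurrence in the enumeration
  have h1 : ∀ y, f y = ∑' i, ind (e i x = y ∧ ∀ j < i, e j x ≠ y) * f y := by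
    intro y
    by_cases hy : f y = 0
    · simp [hy]
    have hex := (he.reachable_iff _ _).1 (hsupp y hy)
    classical
    rw [tsum_eq_single (Nat.find hex)]
    · rw [ind_pos, one_mul]
      exact ⟨Nat.find_spec hex, fun j hj => Nat.find_min hex hj⟩
    · intro i hi
      rw [ind_neg, zero_mul]
      rintro ⟨h2, h3⟩
      exact hi ((Nat.find_eq_iff hex).2 ⟨h2, h3⟩).symm
  rw [tsum_congr h1, ENNReal.tsum_comm]
  refine tsum_congr fun i => ?_
  rw [tsum_eq_single (e i x)]
  · simp
  · intro y hy
    rw [ind_neg, zero_mul]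
    exact fun h => hy h.1.symm

variable [StandardBorelSpace X]

theorem measurable_eq_of_measurable {f g : α → X} (hf : Measurable f) (hg : Measurable g) :
    Measurable fun a => f a = g a :=
  measurableSet_setOfPred.1 (measurableSet_eq_fun hf hg)

theorem IsEnum.measurable_reachable (he : IsEnum G e) :
    Measurable fun p : X × X => G.Reachable p.1 p.2 := by
  simp only [he.reachable_iff]
  exact Measurable.exists fun i =>
    measurable_eq_of_measurable ((he.measurable_enum i).comp measurable_fst) measurable_snd

theorem IsEnum.measurable_isFirst (he : IsEnum G e) (i : ℕ) :
    Measurable fun x => ∀ j < i, e j x ≠ e i x :=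
  Measurable.forall fun j => Measurable.forall fun _ =>
    (measurable_eq_of_measurable (he.measurable_enum j) (he.measurable_enum i)).not

theorem IsEnum.measurable_tsum (he : IsEnum G e) {π : α → X} (hπ : Measurable π)
    {f : α → X → ℝ≥0∞} (hf : Measurable fun p : α × X => f p.1 p.2)
    (hsupp : ∀ a y, f a y ≠ 0 → G.Reachable (π a) y) : Measurable fun a => ∑' y, f a y := by
  simp only [fun a => he.tsum_eq (π a) (hsupp a)]
  exact Measurable.tsum fun i => (measurable_ind ((he.measurable_isFirst i).comp hπ)).mul
    (hf.comp (measurable_id.prodMk ((he.measurable_enum i).comp hπ)))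

theorem IsEnum.measurable_finite (he : IsEnum G e) {π : α → X} (hπ : Measurable π)
    {P : α → X → Prop} (hP : Measurable fun p : α × X => P p.1 p.2)
    (hsupp : ∀ a y, P a y → G.Reachable (π a) y) : Measurable fun a => {y | P a y}.Finite := by
  simp only [← tsum_ind_ne_top]
  exact measurableSet_setOfPred.1 ((he.measurable_tsum hπ (measurable_ind hP)
    (fun a y h => hsupp a y (ind_ne_zero.1 h))) (measurableSet_singleton ⊤).compl)

/-- Finite real sums in terms of sums in `ℝ≥0∞`, to which countable enumerations apply. -/
theorem finsum_eq_toReal_sub {β : Type*} {f : β → ℝ} (hf : (Function.support f).Finite) :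
    ∑ᶠ y, f y = (∑' y, ENNReal.ofReal (f y)).toReal - (∑' y, ENNReal.ofReal (-f y)).toReal := by
  have h1 : ∀ g : ℝ → ℝ≥0∞, g 0 = 0 →
      ∑' y, g (f y) = ∑ y ∈ hf.toFinset, g (f y) := fun g hg =>
    tsum_eq_sum fun y hy => by
      have : f y = 0 := by simpa using hy
      rw [this, hg]
  rw [h1 ENNReal.ofReal (by simp), h1 (fun t => ENNReal.ofReal (-t)) (by simp),
    finsum_eq_sum_of_support_subset f (s := hf.toFinset) (by simp),
    ENNReal.toReal_sum (by simp), ENNReal.toReal_sum (by simp), ← Finset.sum_sub_distrib]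
  refine Finset.sum_congr rfl fun y _ => ?_
  rw [ENNReal.toReal_ofReal', ENNReal.toReal_ofReal', max_zero_sub_eq_self]

theorem IsEnum.measurable_finsum (he : IsEnum G e) {π : α → X} (hπ : Measurable π)
    {f : α → X → ℝ} (hf : Measurable fun p : α × X => f p.1 p.2)
    (hsupp : ∀ a y, f a y ≠ 0 → G.Reachable (π a) y) : Measurable fun a => ∑ᶠ y, f a y := by
  classical
  have h : (fun a => ∑ᶠ y, f a y) = fun a => if {y | f a y ≠ 0}.Finite then
      (∑' y, ENNReal.ofReal (f a y)).toReal - (∑' y, ENNReal.ofReal (-f a y)).toReal else 0 := by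
    ext a
    split_ifs with hfin
    · exact finsum_eq_toReal_sub hfin
    · exact finsum_of_infinite_support hfin
  rw [h]
  refine Measurable.ite (measurableSet_setOfPred.2 (he.measurable_finite hπ ?_ hsupp))
    (Measurable.sub (Measurable.ennreal_toReal (he.measurable_tsum hπ hf.ennreal_ofReal ?_))
      (Measurable.ennreal_toReal (he.measurable_tsum hπ hf.neg.ennreal_ofReal ?_)))
    measurable_const
  · exact measurableSet_setOfPred.1 (hf (measurableSet_singleton 0).compl)
  · intro a y h
    refine hsupp a y fun h0 => h ?_
    simp [h0]
  · intro a y h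
    refine hsupp a y fun h0 => h ?_
    simp [h0]

theorem exists_walk_length_succ {V : Type*} {H : SimpleGraph V} {n : ℕ} {x y : V} :
    (∃ p : H.Walk x y, p.length = n + 1) ↔ ∃ z, H.Adj x z ∧ ∃ p : H.Walk z y, p.length = n := by
  constructor
  · rintro ⟨p, hp⟩
    cases p with
    | nil => simp at hp
    | cons h p => exact ⟨_, h, p, by simpa using hp⟩
  · rintro ⟨z, h, p, hp⟩
    exact ⟨SimpleGraph.Walk.cons h p, by simp [hp]⟩

theorem IsEnum.measurable_walk (he : IsEnum G e) {H : α → SimpleGraph X} (hle : ∀ a, H a ≤ G)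
    (hH : Measurable fun p : α × X × X => (H p.1).Adj p.2.1 p.2.2) (n : ℕ) :
    Measurable fun p : α × X × X => ∃ w : (H p.1).Walk p.2.1 p.2.2, w.length = n := by
  induction n with
  | zero =>
    have h : (fun p : α × X × X => ∃ w : (H p.1).Walk p.2.1 p.2.2, w.length = 0) =
        fun p => p.2.1 = p.2.2 := by
      ext p
      constructor
      · rintro ⟨w, hw⟩
        exact SimpleGraph.Walk.eq_of_length_eq_zero hw
      · intro h
        rw [h]
        exact ⟨SimpleGraph.Walk.nil, rfl⟩
    rw [h]
    exact measurable_eq_of_measurable (by fun_prop) (by fun_prop)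
  | succ n ih =>
    simp only [exists_walk_length_succ]
    refine he.measurable_exists (π := fun p : α × X × X => p.2.1) (by fun_prop)
      (Measurable.and ?_ ?_) fun p z h => (hle _ h.1).reachable
    · exact hH.comp (g := fun p => (H p.1).Adj p.2.1 p.2.2)
        (f := fun p : (α × X × X) × X => (p.1.1, p.1.2.1, p.2)) (by fun_prop)
    · exact ih.comp (f := fun p : (α × X × X) × X => (p.1.1, p.2, p.1.2.2)) (by fun_prop)

/-- Connectedness in Borel subgraphs of `G` that depend on a parameter is Borel. -/
theorem IsEnum.measurable_reachable_param (he : IsEnum G e) {H : α → SimpleGraph X}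
    (hle : ∀ a, H a ≤ G) (hH : Measurable fun p : α × X × X => (H p.1).Adj p.2.1 p.2.2) :
    Measurable fun p : α × X × X => (H p.1).Reachable p.2.1 p.2.2 := by
  have h : (fun p : α × X × X => (H p.1).Reachable p.2.1 p.2.2) =
      fun p => ∃ n, ∃ w : (H p.1).Walk p.2.1 p.2.2, w.length = n := by
    ext p
    exact ⟨fun ⟨w⟩ => ⟨_, w, rfl⟩, fun ⟨_, w, _⟩ => ⟨w⟩⟩
  rw [h]
  exact Measurable.exists fun n => he.measurable_walk hle hH n

theorem IsEnum.measurable_reachable_of_le (he : IsEnum G e) {H : SimpleGraph X} (hle : H ≤ G)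
    (hH : Measurable fun p : X × X => H.Adj p.1 p.2) :
    Measurable fun p : X × X => H.Reachable p.1 p.2 := by
  have h := he.measurable_reachable_param (α := Unit) (H := fun _ => H) (fun _ => hle)
    (hH.comp (f := fun p : Unit × X × X => p.2) (by fun_prop))
  exact h.comp (f := fun p : X × X => ((), p)) (by fun_prop)

/-- A Borel function that numbers the vertices of every finite connected component of a Borel
subgraph without repetition: the number of vertices of the component that precede `x` in a fixed
Borel linear order. -/
theorem IsEnum.exists_rank (he : IsEnum G e) {H : SimpleGraph X} (hle : H ≤ G)
    (hH : Measurable fun p : X × X => H.Adj p.1 p.2) :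
    ∃ r : X → ℕ, Measurable r ∧
      ∀ x, {y | H.Reachable x y}.Finite → Set.InjOn r {y | H.Reachable x y} := by
  have hι := measurableEmbedding_embeddingReal X
  set ι := embeddingReal X
  have hR := he.measurable_reachable_of_le hle hH
  refine ⟨fun x => ⌊(∑' y, ind (H.Reachable x y ∧ ι y < ι x)).toReal⌋₊, ?_, ?_⟩
  · refine Nat.measurable_floor.comp (Measurable.ennreal_toReal ?_)
    refine he.measurable_tsum (π := id) measurable_id (measurable_ind (hR.and ?_)) ?_
    · exact measurableSet_setOfPred.1 (measurableSet_lt (hι.measurable.comp measurable_snd)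
        (hι.measurable.comp measurable_fst))
    · intro a y h
      exact (ind_ne_zero.1 h).1.mono hle
  · intro x hx
    have key : ∀ y, H.Reachable x y →
        ⌊(∑' z, ind (H.Reachable y z ∧ ι z < ι y)).toReal⌋₊ =
          {z | H.Reachable x z ∧ ι z < ι y}.ncard := by
      intro y hy
      have h1 : ∀ z, H.Reachable y z ↔ H.Reachable x z := fun z =>
        ⟨fun h => hy.trans h, fun h => hy.symm.trans h⟩
      simp only [h1]
      rw [tsum_ind_eq_ncard _ (hx.subset fun z hz => hz.1)]
      simp
    have mono : ∀ y z, H.Reachable x y → H.Reachable x z → ι y < ι z →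
        {u | H.Reachable x u ∧ ι u < ι y}.ncard < {u | H.Reachable x u ∧ ι u < ι z}.ncard := by
      intro y z hy hz hyz
      refine Set.ncard_lt_ncard ⟨fun u hu => ⟨hu.1, hu.2.trans hyz⟩, fun h => ?_⟩
        (hx.subset fun z hz => hz.1)
      exact lt_irrefl _ (h ⟨hy, hyz⟩).2
    intro y hy z hz hyz
    simp only at hyz
    rw [key y hy, key z hz] at hyz
    apply hι.injective
    by_contra hne
    rcases lt_or_gt_of_ne hne with h | h
    · exact (mono y z hy hz h).ne hyz
    · exact (mono z y hz hy h).ne' hyz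

/-- On a finite set whose points are numbered, functions of two vertices are encoded by the countably
many finitely supported functions of two numbers. -/
theorem exists_finsupp_eq_on {V : Type*} {r : V → ℕ} {C : Set V} (hC : C.Finite)
    (hr : Set.InjOn r C) (θ : V → V → ℤ) : ∃ c : ℕ × ℕ →₀ ℤ, ∀ y ∈ C, ∀ z ∈ C, c (r y, r z) = θ y z := by
  classical
  rcases C.eq_empty_or_nonempty with rfl | ⟨x₀, -⟩
  · exact ⟨0, by simp⟩
  have : Nonempty V := ⟨x₀⟩
  let f : ℕ × ℕ → ℤ := fun p => if p.1 ∈ r '' C ∧ p.2 ∈ r '' C then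
    θ (Function.invFunOn r C p.1) (Function.invFunOn r C p.2) else 0
  have hf : (Function.support f).Finite := by
    refine ((hC.image r).prod (hC.image r)).subset fun p hp => ?_
    by_contra h
    exact hp (if_neg fun h' => h h')
  refine ⟨Finsupp.ofSupportFinite f hf, fun y hy z hz => ?_⟩
  have h := hr.leftInvOn_invFunOn
  change f (r y, r z) = _
  simp only [f]
  rw [if_pos ⟨⟨y, hy, rfl⟩, ⟨z, hz, rfl⟩⟩, h hy, h hz]

theorem measurable_sInf_nat {β : Type*} [MeasurableSpace β] {P : ℕ → β → Prop} (hP : ∀ n, Measurable (P n)) :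
    Measurable fun x => sInf {n | P n x} := by
  refine measurable_to_countable' fun n => ?_
  have : (fun x => sInf {n | P n x}) ⁻¹' {n} = {x | (P n x ∧ ∀ m < n, ¬P m x) ∨
      (n = 0 ∧ ∀ m, ¬P m x)} := by
    ext x
    simp only [Set.mem_preimage, Set.mem_singleton_iff, Set.mem_ofPred_eq]
    constructor
    · rintro rfl
      by_cases h : ∃ m, P m x
      · exact Or.inl ⟨Nat.sInf_mem (s := {n | P n x}) h, fun m hm h' => Nat.notMem_of_lt_sInf hm h'⟩
      · push Not at h
        refine Or.inr ⟨?_, h⟩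
        have hempty : {n | P n x} = ∅ := Set.eq_empty_iff_forall_notMem.2 h
        rw [hempty, Nat.sInf_empty]
    · rintro (⟨h1, h2⟩ | ⟨rfl, h2⟩)
      · refine le_antisymm (Nat.sInf_le h1) ?_
        by_contra! hlt
        exact h2 _ hlt (Nat.sInf_mem (s := {n | P n x}) ⟨n, h1⟩)
      · have hempty : {n | P n x} = ∅ := Set.eq_empty_iff_forall_notMem.2 h2
        rw [hempty, Nat.sInf_empty]
  rw [this]
  exact measurableSet_setOfPred.2 (((hP n).and (Measurable.forall fun m =>
    measurable_const.imp (hP m).not)).or (measurable_const.and (Measurable.forall fun m =>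
      (hP m).not)))

/-- Measurable choice inside finite components: if a condition `Q x θ` depends only on the component
of `x` in the Borel graph `H` and on the restriction of `θ` to it, and is measurable in `x`
for each Borel `θ`, then a single Borel `θ` satisfies it wherever this is possible at all.
On a finite component there are countably many candidates, and the first one that works is
taken. -/
theorem IsEnum.exists_measurable_selection (he : IsEnum G e) {H : SimpleGraph X} (hle : H ≤ G)
    (hH : Measurable fun p : X × X => H.Adj p.1 p.2) (Q : X → (X → X → ℤ) → Prop)
    (hQm : ∀ θ : X → X → ℤ, (Measurable fun p : X × X => θ p.1 p.2) → Measurable fun x => Q x θ)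
    (hQl : ∀ x θ θ', (∀ y z, H.Reachable x y → H.Reachable x z → θ y z = θ' y z) →
      Q x θ → Q x θ')
    (hQi : ∀ x y θ, H.Reachable x y → Q x θ → Q y θ) :
    ∃ θ : X → X → ℤ, (Measurable fun p : X × X => θ p.1 p.2) ∧
      (∀ y z, ¬H.Reachable y z → θ y z = 0) ∧
      ∀ x, {y | H.Reachable x y}.Finite → (∃ θ', Q x θ') → Q x θ := by
  classical
  obtain ⟨r, hrm, hr⟩ := he.exists_rank hle hH
  obtain ⟨c, hc⟩ := exists_surjective_nat (ℕ × ℕ →₀ ℤ)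
  have hR := he.measurable_reachable_of_le hle hH
  let Θ : ℕ → X → X → ℤ := fun n y z => c n (r y, r z)
  have hΘm : ∀ n, Measurable fun p : X × X => Θ n p.1 p.2 := fun n =>
    (Measurable.of_discrete (f := c n)).comp
      ((hrm.comp measurable_fst).prodMk (hrm.comp measurable_snd))
  let s : X → ℕ := fun x => sInf {n | Q x (Θ n)}
  have hsm : Measurable s := measurable_sInf_nat fun n => hQm _ (hΘm n)
  refine ⟨fun y z => if H.Reachable y z then Θ (s y) y z else 0, ?_, fun y z h => if_neg h, ?_⟩
  · refine Measurable.ite (measurableSet_setOfPred.2 hR) ?_ measurable_const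
    exact (Measurable.of_discrete (f := fun q : ℕ × ℕ × ℕ => c q.1 q.2)).comp
      ((hsm.comp measurable_fst).prodMk
        ((hrm.comp measurable_fst).prodMk (hrm.comp measurable_snd)))
  · rintro x hfin ⟨θ', hθ'⟩
    obtain ⟨d, hd⟩ := exists_finsupp_eq_on hfin (hr x hfin) θ'
    obtain ⟨n, rfl⟩ := hc d
    have hn : Q x (Θ n) := hQl x θ' _ (fun y z hy hz => (hd y hy z hz).symm) hθ'
    have hs : Q x (Θ (s x)) := Nat.sInf_mem (s := {n | Q x (Θ n)}) ⟨n, hn⟩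
    refine hQl x _ _ (fun y z hy hz => ?_) hs
    have hsy : s y = s x := by
      simp only [s]
      congr 1
      ext m
      exact ⟨fun h => hQi _ _ _ hy.symm h, fun h => hQi _ _ _ hy h⟩
    rw [if_pos (hy.symm.trans hz), hsy]

end Enumeration

/-! ### Mass transport -/

section MassTransport

variable {X : Type*} [MeasurableSpace X]

/-- A locally finite Borel graph that preserves `μ`, together with a Borel enumeration of its
components. Preservation of `μ` is stated as mass transport along edges. -/
structure IsTame (G : SimpleGraph X) (μ : Measure X) (e : ℕ → X → X) : Prop
    extends IsEnum G e where
  measurable_adj : Measurable fun p : X × X => G.Adj p.1 p.2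
  finite_neighborSet : ∀ x, {y | G.Adj x y}.Finite
  edge_transport : ∀ h : X → X → ℝ≥0∞, (Measurable fun p : X × X => h p.1 p.2) →
    ∫⁻ x, ∑' y, ind (G.Adj x y) * h x y ∂μ = ∫⁻ x, ∑' y, ind (G.Adj x y) * h y x ∂μ

/-- The number of walks of length `n` from `x` to `y`. -/
noncomputable def walkCount {V : Type*} (G : SimpleGraph V) : ℕ → V → V → ℝ≥0∞
  | 0, x, y => ind (x = y)
  | n + 1, x, y => ∑' z, ind (G.Adj x z) * walkCount G n z y

theorem walkCount_succ {V : Type*} (G : SimpleGraph V) (n : ℕ) (x y : V) :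
    walkCount G (n + 1) x y = ∑' z, ind (G.Adj x z) * walkCount G n z y := rfl

theorem walkCount_succ' {V : Type*} (G : SimpleGraph V) (n : ℕ) (x y : V) :
    walkCount G (n + 1) x y = ∑' z, walkCount G n x z * ind (G.Adj z y) := by
  induction n generalizing x y with
  | zero =>
    simp only [walkCount]
    rw [tsum_eq_single y (fun z hz => by rw [ind_neg (p := z = y) hz, mul_zero]),
      tsum_eq_single x (fun z hz => by rw [ind_neg (p := x = z) hz.symm, zero_mul])]
    simp [ind]
  | succ n ih =>
    rw [walkCount_succ]
    simp only [ih]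
    simp_rw [← ENNReal.tsum_mul_left]
    rw [ENNReal.tsum_comm]
    refine tsum_congr fun z => ?_
    rw [← ih, walkCount_succ, ← ENNReal.tsum_mul_right]
    exact tsum_congr fun u => by ring

theorem walkCount_comm {V : Type*} (G : SimpleGraph V) (n : ℕ) (x y : V) :
    walkCount G n x y = walkCount G n y x := by
  induction n generalizing x y with
  | zero => simp only [walkCount, eq_comm]
  | succ n ih =>
    rw [walkCount_succ', walkCount_succ]
    refine tsum_congr fun z => ?_
    rw [ih, mul_comm, G.adj_comm]

theorem walkCount_ne_zero {V : Type*} (G : SimpleGraph V) (n : ℕ) (x y : V) :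
    walkCount G n x y ≠ 0 ↔ ∃ p : G.Walk x y, p.length = n := by
  induction n generalizing x y with
  | zero =>
    rw [walkCount, ind_ne_zero]
    constructor
    · rintro rfl
      exact ⟨SimpleGraph.Walk.nil, rfl⟩
    · rintro ⟨p, hp⟩
      exact SimpleGraph.Walk.eq_of_length_eq_zero hp
  | succ n ih =>
    rw [walkCount_succ, exists_walk_length_succ, Ne, ENNReal.tsum_eq_zero]
    push Not
    refine exists_congr fun z => ?_
    rw [← ih, mul_ne_zero_iff, ind_ne_zero]

variable {G : SimpleGraph X} {μ : Measure X} {e : ℕ → X → X}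

theorem IsTame.walkCount_ne_top (hG : IsTame G μ e) (n : ℕ) (x y : X) :
    walkCount G n x y ≠ ⊤ := by
  induction n generalizing x y with
  | zero => exact ne_top_of_le_ne_top ENNReal.one_ne_top (ind_le_one _)
  | succ n ih =>
    rw [walkCount_succ, tsum_eq_sum (s := (hG.finite_neighborSet x).toFinset)]
    · exact ENNReal.sum_ne_top.2 fun z _ =>
        ENNReal.mul_ne_top (ne_top_of_le_ne_top ENNReal.one_ne_top (ind_le_one _)) (ih _ _)
    · intro z hz
      rw [ind_neg, zero_mul]
      simpa using hz

variable [StandardBorelSpace X]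

theorem IsTame.measurable_walkCount (hG : IsTame G μ e) (n : ℕ) :
    Measurable fun p : X × X => walkCount G n p.1 p.2 := by
  induction n with
  | zero => exact measurable_ind (measurable_eq_of_measurable measurable_fst measurable_snd)
  | succ n ih =>
    simp only [walkCount]
    refine hG.measurable_tsum (π := fun p : X × X => p.1) measurable_fst ?_ ?_
    · refine Measurable.mul (measurable_ind ?_) ?_
      · exact hG.measurable_adj.comp (f := fun q : (X × X) × X => (q.1.1, q.2)) (by fun_prop)
      · exact ih.comp (f := fun q : (X × X) × X => (q.2, q.1.2)) (by fun_prop)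
    · intro a y h
      exact (ind_ne_zero.1 (left_ne_zero_of_mul h)).reachable

/-- Mass transport along walks of length `n`, counted with multiplicity. -/
theorem IsTame.walk_transport (hG : IsTame G μ e) (n : ℕ) (h : X → X → ℝ≥0∞)
    (hh : Measurable fun p : X × X => h p.1 p.2) :
    ∫⁻ x, ∑' y, walkCount G n x y * h x y ∂μ = ∫⁻ x, ∑' y, walkCount G n x y * h y x ∂μ := by
  induction n generalizing h with
  | zero =>
    refine lintegral_congr fun x => tsum_congr fun y => ?_
    by_cases hxy : x = y
    · rw [hxy]
    · simp [walkCount, ind_neg hxy]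
  | succ n ih =>
    have hA := hG.measurable_adj
    have hW := hG.measurable_walkCount n
    calc ∫⁻ x, ∑' y, walkCount G (n + 1) x y * h x y ∂μ
        = ∫⁻ x, ∑' z, ind (G.Adj x z) * ∑' y, walkCount G n z y * h x y ∂μ := by
          refine lintegral_congr fun x => ?_
          simp only [walkCount]
          simp_rw [← ENNReal.tsum_mul_right, ← ENNReal.tsum_mul_left]
          rw [ENNReal.tsum_comm]
          simp_rw [mul_assoc]
      _ = ∫⁻ x, ∑' z, ind (G.Adj x z) * ∑' y, walkCount G n x y * h z y ∂μ := by
          refine hG.edge_transport (fun x z => ∑' y, walkCount G n z y * h x y) ?_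
          refine hG.measurable_tsum (π := fun p : X × X => p.2) measurable_snd ?_ ?_
          · refine Measurable.mul ?_ ?_
            · exact hW.comp (f := fun q : (X × X) × X => (q.1.2, q.2)) (by fun_prop)
            · exact hh.comp (f := fun q : (X × X) × X => (q.1.1, q.2)) (by fun_prop)
          · intro a y h
            obtain ⟨p, -⟩ := (walkCount_ne_zero _ _ _ _).1 (left_ne_zero_of_mul h)
            exact ⟨p⟩
      _ = ∫⁻ x, ∑' y, walkCount G n x y * ∑' z, ind (G.Adj x z) * h z y ∂μ := by
          refine lintegral_congr fun x => ?_
          simp_rw [← ENNReal.tsum_mul_left]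
          rw [ENNReal.tsum_comm]
          refine tsum_congr fun y => tsum_congr fun z => by ring
      _ = ∫⁻ x, ∑' y, walkCount G n x y * ∑' z, ind (G.Adj y z) * h z x ∂μ := by
          refine ih (fun x y => ∑' z, ind (G.Adj x z) * h z y) ?_
          refine hG.measurable_tsum (π := fun p : X × X => p.1) measurable_fst ?_ ?_
          · refine Measurable.mul (measurable_ind ?_) ?_
            · exact hA.comp (f := fun q : (X × X) × X => (q.1.1, q.2)) (by fun_prop)
            · exact hh.comp (f := fun q : (X × X) × X => (q.2, q.1.2)) (by fun_prop)
          · intro a y h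
            exact (ind_ne_zero.1 (left_ne_zero_of_mul h)).reachable
      _ = ∫⁻ x, ∑' y, walkCount G (n + 1) x y * h y x ∂μ := by
          refine lintegral_congr fun x => ?_
          simp only [walkCount_succ']
          simp_rw [← ENNReal.tsum_mul_right, ← ENNReal.tsum_mul_left]
          rw [ENNReal.tsum_comm]
          simp_rw [mul_assoc]

/-- The mass transport principle for the connectedness relation of a measure preserving graph. -/
theorem IsTame.mass_transport (hG : IsTame G μ e) (h : X → X → ℝ≥0∞)
    (hh : Measurable fun p : X × X => h p.1 p.2)
    (hsupp : ∀ x y, h x y ≠ 0 → G.Reachable x y) :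
    ∫⁻ x, ∑' y, h x y ∂μ = ∫⁻ x, ∑' y, h y x ∂μ := by
  classical
  have hW := hG.measurable_walkCount
  -- `h` is split according to the distance `n` between the two vertices
  let P : ℕ → X → X → Prop := fun n x y => walkCount G n x y ≠ 0 ∧ ∀ m < n, walkCount G m x y = 0
  let hn : ℕ → X → X → ℝ≥0∞ := fun n x y =>
    if P n x y then (walkCount G n x y)⁻¹ * h x y else 0
  have hPm : ∀ n, Measurable fun p : X × X => P n p.1 p.2 := fun n =>
    Measurable.and (measurableSet_setOfPred.1 (hW n (measurableSet_singleton 0).compl))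
      (Measurable.forall fun m => Measurable.forall fun _ =>
        measurableSet_setOfPred.1 (hW m (measurableSet_singleton 0)))
  have hnm : ∀ n, Measurable fun p : X × X => hn n p.1 p.2 := fun n =>
    Measurable.ite (measurableSet_setOfPred.2 (hPm n)) ((hW n).inv.mul hh) measurable_const
  have hsum : ∀ x y, h x y = ∑' n, walkCount G n x y * hn n x y := by
    intro x y
    by_cases h0 : h x y = 0
    · simp [hn, h0]
    obtain ⟨w⟩ := hsupp x y h0
    have hex : ∃ n, walkCount G n x y ≠ 0 := ⟨_, (walkCount_ne_zero _ _ _ _).2 ⟨w, rfl⟩⟩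
    have hP : P (Nat.find hex) x y :=
      ⟨Nat.find_spec hex, fun m hm => not_not.1 (Nat.find_min hex hm)⟩
    rw [tsum_eq_single (Nat.find hex)]
    · simp only [hn]
      rw [if_pos hP, ← mul_assoc, ENNReal.mul_inv_cancel hP.1 (hG.walkCount_ne_top _ _ _),
        one_mul]
    · intro n hne
      simp only [hn]
      rw [if_neg, mul_zero]
      rintro ⟨h1, h2⟩
      exact hne ((Nat.find_eq_iff hex).2 ⟨h1, fun m hm => not_not.2 (h2 m hm)⟩).symm
  have key : ∀ k : X → X → ℝ≥0∞, ∀ kn : ℕ → X → X → ℝ≥0∞,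
      (∀ n, Measurable fun p : X × X => kn n p.1 p.2) →
      (∀ x y, k x y = ∑' n, walkCount G n x y * kn n x y) →
      ∫⁻ x, ∑' y, k x y ∂μ = ∑' n, ∫⁻ x, ∑' y, walkCount G n x y * kn n x y ∂μ := by
    intro k kn hkn hk
    rw [← lintegral_tsum]
    · refine lintegral_congr fun x => ?_
      simp_rw [hk]
      exact ENNReal.tsum_comm
    · intro n
      refine (hG.measurable_tsum (π := id) measurable_id ((hW n).mul (hkn n)) ?_).aemeasurable
      intro x y h0
      obtain ⟨p, -⟩ := (walkCount_ne_zero _ _ _ _).1 (left_ne_zero_of_mul h0)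
      exact ⟨p⟩
  rw [key h hn hnm hsum, key (fun x y => h y x) (fun n x y => hn n y x)
    (fun n => (hnm n).comp measurable_swap)
    (fun x y => by rw [hsum y x]; exact tsum_congr fun n => by rw [walkCount_comm])]
  exact tsum_congr fun n => hG.walk_transport n _ (hnm n)

/-- A property of almost every vertex holds on the whole component of almost every vertex. -/
theorem IsTame.ae_reachable (hG : IsTame G μ e) {p : X → Prop} (hp : ∀ᵐ x ∂μ, p x) :
    ∀ᵐ x ∂μ, ∀ y, G.Reachable x y → p y := by
  obtain ⟨N, hpN, hN, hN0⟩ := exists_measurable_superset_of_null (ae_iff.1 hp)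
  have hR := hG.measurable_reachable
  have h := hG.mass_transport (fun x y => ind (G.Reachable x y ∧ y ∈ N))
    (measurable_ind (hR.and (measurableSet_setOfPred.1 (measurable_snd hN))))
    (fun x y h => (ind_ne_zero.1 h).1)
  have h2 : ∫⁻ x, ∑' y, ind (G.Reachable y x ∧ x ∈ N) ∂μ = 0 := by
    rw [lintegral_eq_zero_iff' ]
    · filter_upwards [measure_eq_zero_iff_ae_notMem.1 hN0] with x hx
      simp [ind, hx]
    · refine (hG.measurable_tsum (π := id) measurable_id (measurable_ind ?_) ?_).aemeasurable
      · exact (hR.comp measurable_swap).and (measurableSet_setOfPred.1 (measurable_fst hN))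
      · intro x y h
        exact (ind_ne_zero.1 h).1.symm
  rw [h2, lintegral_eq_zero_iff] at h
  · filter_upwards [h] with x hx y hy
    by_contra hpy
    have := ENNReal.tsum_eq_zero.1 hx y
    rw [ind_pos ⟨hy, hpN hpy⟩] at this
    exact one_ne_zero this
  · refine hG.measurable_tsum (π := id) measurable_id (measurable_ind ?_) ?_
    · exact hR.and (measurableSet_setOfPred.1 (measurable_snd hN))
    · intro x y h
      exact (ind_ne_zero.1 h).1

/-- Averaging a function over the finite classes of a Borel subrelation preserves its integral. -/
theorem IsTame.lintegral_eq_lintegral_class_average (hG : IsTame G μ e) {H : SimpleGraph X}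
    (hle : H ≤ G) (hH : Measurable fun p : X × X => H.Adj p.1 p.2)
    (hfin : ∀ᵐ x ∂μ, {y | H.Reachable x y}.Finite) {g : X → ℝ≥0∞} (hg : Measurable g) :
    ∫⁻ x, g x ∂μ = ∫⁻ x, (∑' y, ind (H.Reachable x y))⁻¹ *
      ∑' y, ind (H.Reachable x y) * g y ∂μ := by
  have hR := hG.measurable_reachable_of_le hle hH
  have hc : Measurable fun x => ∑' y, ind (H.Reachable x y) :=
    hG.measurable_tsum (π := id) measurable_id (measurable_ind hR)
      (fun x y h => (ind_ne_zero.1 h).mono hle)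
  have h := hG.mass_transport
    (fun x y => ind (H.Reachable x y) * ((∑' z, ind (H.Reachable x z))⁻¹ * g x))
    ((measurable_ind hR).mul ((hc.inv.mul hg).comp measurable_fst))
    (fun x y h => (ind_ne_zero.1 (left_ne_zero_of_mul h)).mono hle)
  calc ∫⁻ x, g x ∂μ = ∫⁻ x, ∑' y, ind (H.Reachable x y) *
        ((∑' z, ind (H.Reachable x z))⁻¹ * g x) ∂μ := by
        refine lintegral_congr_ae ?_
        filter_upwards [hfin] with x hx
        rw [ENNReal.tsum_mul_right, ← mul_assoc, ENNReal.mul_inv_cancel, one_mul]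
        · intro h0
          have := ENNReal.tsum_eq_zero.1 h0 x
          rw [ind_pos (SimpleGraph.Reachable.refl x)] at this
          exact one_ne_zero this
        · exact (tsum_ind_ne_top _).2 hx
    _ = _ := h
    _ = _ := by
        refine lintegral_congr fun x => ?_
        rw [← ENNReal.tsum_mul_left]
        refine tsum_congr fun y => ?_
        by_cases hxy : H.Reachable x y
        · have : ∀ z, H.Reachable y z ↔ H.Reachable x z := fun z =>
            ⟨fun h => hxy.trans h, fun h => hxy.symm.trans h⟩
          simp only [this, ind_pos hxy, ind_pos (SimpleGraph.Reachable.refl x), one_mul]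
        · simp [ind_neg hxy, ind_neg fun h : H.Reachable y x => hxy h.symm]

/-- Integrals may be compared class by class, for the classes of a finite Borel subrelation. -/
theorem IsTame.lintegral_mono_of_class_sum_le (hG : IsTame G μ e) {H : SimpleGraph X}
    (hle : H ≤ G) (hH : Measurable fun p : X × X => H.Adj p.1 p.2)
    (hfin : ∀ᵐ x ∂μ, {y | H.Reachable x y}.Finite) {g₁ g₂ : X → ℝ≥0∞} (hg₁ : Measurable g₁)
    (hg₂ : Measurable g₂)
    (h12 : ∀ᵐ x ∂μ, ∑' y, ind (H.Reachable x y) * g₁ y ≤ ∑' y, ind (H.Reachable x y) * g₂ y) :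
    ∫⁻ x, g₁ x ∂μ ≤ ∫⁻ x, g₂ x ∂μ := by
  rw [hG.lintegral_eq_lintegral_class_average hle hH hfin hg₁,
    hG.lintegral_eq_lintegral_class_average hle hH hfin hg₂]
  refine lintegral_mono_ae ?_
  filter_upwards [h12] with x hx
  gcongr

/-- Borel maps moving every point inside its component change variables with the size of the
fibre as density. -/
theorem IsTame.lintegral_comp (hG : IsTame G μ e) {f : X → X} (hf : Measurable f)
    (hfr : ∀ x, G.Reachable x (f x)) {g : X → ℝ≥0∞} (hg : Measurable g) :
    ∫⁻ x, g (f x) ∂μ = ∫⁻ x, (∑' y, ind (f y = x)) * g x ∂μ := by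
  have h := hG.mass_transport (fun x y => ind (f x = y) * g y)
    ((measurable_ind (measurable_eq_of_measurable (hf.comp measurable_fst) measurable_snd)).mul
      (hg.comp measurable_snd))
    (fun x y h => by
      have := ind_ne_zero.1 (left_ne_zero_of_mul h)
      rw [← this]
      exact hfr x)
  rw [lintegral_congr fun x => ENNReal.tsum_mul_right (f := fun y => ind (f y = x)) (a := g x)] at h
  rw [← h]
  refine lintegral_congr fun x => ?_
  rw [tsum_eq_single (f x)]
  · simp [ind]
  · intro y hy
    rw [ind_neg hy.symm, zero_mul]

theorem IsTame.measurable_fiber_tsum (hG : IsTame G μ e) {f : X → X} (hf : Measurable f)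
    (hfr : ∀ x, G.Reachable x (f x)) : Measurable fun x => ∑' y, ind (f y = x) := by
  refine hG.measurable_tsum (π := id) measurable_id (measurable_ind
    (measurable_eq_of_measurable (hf.comp measurable_snd) measurable_fst)) ?_
  intro x y h
  rw [← ind_ne_zero.1 h]
  exact (hfr y).symm

/-- A finite measure leaves no room for infinite fibres, since every vertex moves within its component. -/
theorem IsTame.ae_finite_fiber [IsFiniteMeasure μ] (hG : IsTame G μ e) {f : X → X}
    (hf : Measurable f) (hfr : ∀ x, G.Reachable x (f x)) : ∀ᵐ x ∂μ, {y | f y = x}.Finite := by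
  have h := hG.lintegral_comp hf hfr (g := fun _ => 1) measurable_const
  simp only [mul_one, lintegral_const, one_mul] at h
  have h2 := ae_lt_top (hG.measurable_fiber_tsum hf hfr) (by rw [← h]; exact measure_ne_top _ _)
  filter_upwards [h2] with x hx
  exact (tsum_ind_ne_top _).1 hx.ne

/-- A Borel set meets almost every infinite component in the empty set or in an infinite set. -/
theorem IsTame.ae_infinite_of_nonempty [IsFiniteMeasure μ] (hG : IsTame G μ e) {Y : Set X}
    (hY : MeasurableSet Y) (hinf : ∀ᵐ x ∂μ, {y | G.Reachable x y}.Infinite) :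
    ∀ᵐ x ∂μ, (∃ y ∈ Y, G.Reachable x y) → {y | G.Reachable x y ∧ y ∈ Y}.Infinite := by
  have hR := hG.measurable_reachable
  have hYm : Measurable fun x => x ∈ Y := measurableSet_setOfPred.1 hY
  let c : X → ℝ≥0∞ := fun x => ∑' z, ind (G.Reachable x z ∧ z ∈ Y)
  have hRY : Measurable fun p : X × X => G.Reachable p.1 p.2 ∧ p.2 ∈ Y :=
    hR.and (hYm.comp measurable_snd)
  have hc : Measurable c := hG.measurable_tsum (π := id) measurable_id (measurable_ind hRY)
    (fun x y h => (ind_ne_zero.1 h).1)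
  -- every vertex distributes a unit mass among the points of `Y` in its component
  have hm : Measurable fun p : X × X => (c p.1)⁻¹ * ind (G.Reachable p.1 p.2 ∧ p.2 ∈ Y) :=
    (hc.inv.comp measurable_fst).mul (measurable_ind hRY)
  have hm' : Measurable fun p : X × X => (c p.2)⁻¹ * ind (G.Reachable p.2 p.1 ∧ p.1 ∈ Y) :=
    ((hc.comp measurable_snd).inv).mul (measurable_ind (hRY.comp measurable_swap))
  have h := hG.mass_transport (fun x y => (c x)⁻¹ * ind (G.Reachable x y ∧ y ∈ Y)) hm
    (fun x y h => (ind_ne_zero.1 (right_ne_zero_of_mul h)).1)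
  have hlt : ∫⁻ x, ∑' y, (c x)⁻¹ * ind (G.Reachable x y ∧ y ∈ Y) ∂μ ≠ ⊤ := by
    refine ne_top_of_le_ne_top (measure_ne_top μ Set.univ) ?_
    rw [← lintegral_one]
    refine lintegral_mono fun x => ?_
    rw [ENNReal.tsum_mul_left, mul_comm]
    exact ENNReal.mul_inv_le_one (c x)
  rw [h] at hlt
  have hfin := ae_lt_top ?_ hlt
  · filter_upwards [hG.ae_reachable hfin, hinf] with x hx hxi
    rintro ⟨y, hyY, hxy⟩ hcfin
    have hcx : c x ≠ ⊤ := (tsum_ind_ne_top _).2 hcfin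
    have h1 := hx y hxy
    have h2 : ∀ z, (c z)⁻¹ * ind (G.Reachable z y ∧ y ∈ Y) = (c x)⁻¹ * ind (G.Reachable x z) := by
      intro z
      by_cases hz : G.Reachable x z
      · have : c z = c x := by
          refine tsum_congr fun w => ?_
          have : G.Reachable z w ↔ G.Reachable x w :=
            ⟨fun h => hz.trans h, fun h => hz.symm.trans h⟩
          rw [this]
        rw [this, ind_pos hz, ind_pos ⟨hz.symm.trans hxy, hyY⟩]
      · rw [ind_neg hz, ind_neg fun h => hz (hxy.trans h.1.symm)]
        simp
    simp only [h2, ENNReal.tsum_mul_left] at h1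
    have h3 : ∑' z, ind (G.Reachable x z) = ⊤ := by
      by_contra hne
      exact hxi ((tsum_ind_ne_top _).1 hne)
    rw [h3, ENNReal.mul_top (ENNReal.inv_ne_zero.2 hcx)] at h1
    exact lt_irrefl _ h1
  · refine hG.measurable_tsum (f := fun x y => (c y)⁻¹ * ind (G.Reachable y x ∧ x ∈ Y))
      (π := id) measurable_id hm' ?_
    intro x y hxy
    have := right_ne_zero_of_mul (a := (c y)⁻¹) (b := ind (G.Reachable y x ∧ x ∈ Y)) hxy
    exact (ind_ne_zero.1 this).1.symm

end MassTransport

/-! ### Exhaustions and spanning forests -/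

section Graphs

variable {V : Type*}

/-- The edges of `G` with both ends in `S`, as a graph on all vertices. -/
def within (G : SimpleGraph V) (S : Set V) : SimpleGraph V where
  Adj a b := G.Adj a b ∧ a ∈ S ∧ b ∈ S
  symm := ⟨fun _ _ h => ⟨h.1.symm, h.2.2, h.2.1⟩⟩
  loopless := ⟨fun _ h => h.1.ne rfl⟩

theorem within_le (G : SimpleGraph V) (S : Set V) : within G S ≤ G := fun _ _ h => h.1

theorem within_mono {G H : SimpleGraph V} {S T : Set V} (h : G ≤ H) (hST : S ⊆ T) :
    within G S ≤ within H T := fun _ _ hab => ⟨h hab.1, hST hab.2.1, hST hab.2.2⟩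

theorem reachable_induction {H : SimpleGraph V} {a b : V} {P : V → Prop} (h0 : P a)
    (hs : ∀ u v, H.Reachable a u → P u → H.Adj u v → P v) (hab : H.Reachable a b) : P b := by
  rw [SimpleGraph.reachable_iff_reflTransGen] at hab
  induction hab with
  | refl => exact h0
  | tail hau huv ih => exact hs _ _ ((SimpleGraph.reachable_iff_reflTransGen _ _).2 hau) ih huv

theorem reachable_of_adj_imp {H H' : SimpleGraph V} {a b : V}
    (h : ∀ u v, H.Reachable a u → H.Adj u v → H'.Adj u v) (hab : H.Reachable a b) :
    H'.Reachable a b :=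
  reachable_induction (P := fun b => H'.Reachable a b) (SimpleGraph.Reachable.refl a)
    (fun u v hau hu huv => hu.trans (h u v hau huv).reachable) hab

theorem mem_of_within_reachable {G : SimpleGraph V} {S : Set V} {a b : V}
    (h : (within G S).Reachable a b) (ha : a ∈ S) : b ∈ S :=
  reachable_induction (P := fun b => b ∈ S) ha (fun _ _ _ _ (huv : (within G S).Adj _ _) => huv.2.2) h

theorem within_reachable_of_support {G : SimpleGraph V} {S : Set V} {a b : V} (p : G.Walk a b)
    (hp : ∀ v ∈ p.support, v ∈ S) : (within G S).Reachable a b := by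
  induction p with
  | nil => exact SimpleGraph.Reachable.refl _
  | cons h p ih =>
    have h1 : (within G S).Adj _ _ := ⟨h, hp _ (by simp), hp _ (by simp)⟩
    exact h1.reachable.trans (ih fun v hv => hp v (by simp [hv]))

/-- The union of an increasing sequence of graphs. -/
def unionGraph (T : ℕ → SimpleGraph V) : SimpleGraph V where
  Adj a b := ∃ n, (T n).Adj a b
  symm := ⟨fun _ _ ⟨n, h⟩ => ⟨n, h.symm⟩⟩
  loopless := ⟨fun _ ⟨_, h⟩ => h.ne rfl⟩

theorem le_unionGraph (T : ℕ → SimpleGraph V) (n : ℕ) : T n ≤ unionGraph T :=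
  fun _ _ h => ⟨n, h⟩

theorem exists_reachable_of_unionGraph {T : ℕ → SimpleGraph V} (hT : Monotone T) {a b : V}
    (h : (unionGraph T).Reachable a b) : ∃ n, (T n).Reachable a b := by
  refine reachable_induction (P := fun b => ∃ n, (T n).Reachable a b)
    ⟨0, SimpleGraph.Reachable.refl a⟩ ?_ h
  rintro u v - ⟨n, hn⟩ ⟨m, hm⟩
  exact ⟨max n m, (hn.mono (hT (le_max_left n m))).trans
    (SimpleGraph.Adj.reachable (hT (le_max_right n m) hm))⟩

theorem isAcyclic_unionGraph {T : ℕ → SimpleGraph V} (hT : Monotone T)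
    (hac : ∀ n, (T n).IsAcyclic) : (unionGraph T).IsAcyclic := by
  have h := SimpleGraph.isAcyclic_sSup_of_isAcyclic_directedOn (Set.range T)
    (by rintro _ ⟨n, rfl⟩; exact hac n) (directedOn_range.2 hT.directed_le)
  refine h.anti ?_
  rintro a b ⟨n, hn⟩
  simp only [SimpleGraph.sSup_adj, Set.mem_range]
  exact ⟨T n, ⟨n, rfl⟩, hn⟩

/-- The component of `x` in `G` is one-ended: it is infinite, and any two of its vertices that
lie in infinite components after the removal of a finite set remain connected. -/
structure OneEndedAt (G : SimpleGraph V) (x : V) : Prop where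
  infinite : {y | G.Reachable x y}.Infinite
  reachable : ∀ K : Set V, K.Finite → ∀ u v, G.Reachable x u → G.Reachable x v →
    {w | (within G Kᶜ).Reachable u w}.Infinite → {w | (within G Kᶜ).Reachable v w}.Infinite →
    (within G Kᶜ).Reachable u v

end Graphs

section Trees

variable {X : Type*} [MeasurableSpace X]

/-- An increasing sequence of Borel subgraphs with finite components and union `G`. -/
structure IsExhaustion (G : SimpleGraph X) (H : ℕ → SimpleGraph X) : Prop where
  mono : Monotone H
  le : ∀ n, H n ≤ G
  measurable_adj : ∀ n, Measurable fun p : X × X => (H n).Adj p.1 p.2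
  finite : ∀ n x, {y | (H n).Reachable x y}.Finite
  exists_adj : ∀ x y, G.Adj x y → ∃ n, (H n).Adj x y

theorem measurable_within {α : Type*} [MeasurableSpace α] {H : α → SimpleGraph X}
    {S : α → Set X}
    (hH : Measurable fun p : α × X × X => (H p.1).Adj p.2.1 p.2.2)
    (hS : Measurable fun p : α × X => p.2 ∈ S p.1) :
    Measurable fun p : α × X × X => (within (H p.1) (S p.1)).Adj p.2.1 p.2.2 :=
  hH.and ((hS.comp (f := fun p : α × X × X => (p.1, p.2.1)) (by fun_prop)).and
    (hS.comp (f := fun p : α × X × X => (p.1, p.2.2)) (by fun_prop)))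

theorem measurable_within_const {H : SimpleGraph X} {S : Set X}
    (hH : Measurable fun p : X × X => H.Adj p.1 p.2) (hS : MeasurableSet S) :
    Measurable fun p : X × X => (within H S).Adj p.1 p.2 :=
  hH.and ((measurableSet_setOfPred.1 (measurable_fst hS)).and
    (measurableSet_setOfPred.1 (measurable_snd hS)))

theorem IsExhaustion.exists_reachable {G : SimpleGraph X} {H : ℕ → SimpleGraph X}
    (hH : IsExhaustion G H) {Y : Set X} {x y : X} (h : (within G Y).Reachable x y) :
    ∃ n, (within (H n) Y).Reachable x y := by
  refine exists_reachable_of_unionGraph (T := fun n => within (H n) Y)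
    (fun n m hnm => within_mono (hH.mono hnm) subset_rfl) ?_
  refine h.mono fun a b hab => ?_
  obtain ⟨n, hn⟩ := hH.exists_adj a b hab.1
  exact ⟨n, hn, hab.2⟩

variable [StandardBorelSpace X] {G : SimpleGraph X} {e : ℕ → X → X}

theorem IsEnum.measurable_isAcyclic (he : IsEnum G e) {α : Type*} [MeasurableSpace α]
    {H : α → SimpleGraph X} {π : α → X} (hπ : Measurable π) (hle : ∀ a, H a ≤ G)
    (hH : Measurable fun p : α × X × X => (H p.1).Adj p.2.1 p.2.2)
    (hsupp : ∀ a v w, (H a).Adj v w → G.Reachable (π a) v) :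
    Measurable fun a => (H a).IsAcyclic := by
  have h1 : (fun a => (H a).IsAcyclic) = fun a => ∀ v w, (H a).Adj v w →
      ¬((H a).deleteEdges {s(v, w)}).Reachable v w := by
    ext a
    rw [SimpleGraph.isAcyclic_iff_forall_adj_isBridge]
    refine forall₂_congr fun v w => forall_congr' fun h => ?_
    rw [SimpleGraph.isBridge_iff]
  rw [h1]
  have h2 : Measurable fun p : (α × X) × X => (H p.1.1).Adj p.1.2 p.2 →
      ¬((H p.1.1).deleteEdges {s(p.1.2, p.2)}).Reachable p.1.2 p.2 := by
    refine Measurable.imp (hH.comp (f := fun p : (α × X) × X => (p.1.1, p.1.2, p.2))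
      (by fun_prop)) (Measurable.not ?_)
    have h3 := he.measurable_reachable_param (α := (α × X) × X)
      (H := fun p => (H p.1.1).deleteEdges {s(p.1.2, p.2)})
      (fun p => (SimpleGraph.deleteEdges_le _).trans (hle p.1.1)) ?_
    · exact h3.comp (f := fun p : (α × X) × X => (p, p.1.2, p.2)) (by fun_prop)
    · simp only [SimpleGraph.deleteEdges_adj, Set.mem_singleton_iff, Sym2.eq_iff]
      refine Measurable.and (hH.comp (f := fun p : ((α × X) × X) × X × X =>
        (p.1.1.1, p.2.1, p.2.2)) (by fun_prop)) (Measurable.not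
        (Measurable.or (Measurable.and ?_ ?_) (Measurable.and ?_ ?_))) <;>
      exact measurable_eq_of_measurable (by fun_prop) (by fun_prop)
  refine he.measurable_forall hπ (he.measurable_forall (π := fun p : α × X => π p.1)
    (hπ.comp measurable_fst) h2 ?_) ?_
  · intro p w h
    push Not at h
    exact (hsupp _ _ _ h.1).trans ((hle _ h.1).reachable)
  · intro a v h
    push Not at h
    obtain ⟨w, h⟩ := h
    exact hsupp _ _ _ h.1

/-- A Borel forest inside a Borel graph `K` with finite components extends to a Borel spanning
forest of `K`. -/
theorem IsEnum.exists_spanning_forest (he : IsEnum G e) {T K : SimpleGraph X} (hTK : T ≤ K)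
    (hKG : K ≤ G) (hT : Measurable fun p : X × X => T.Adj p.1 p.2)
    (hK : Measurable fun p : X × X => K.Adj p.1 p.2) (hac : T.IsAcyclic)
    (hfin : ∀ x, {y | K.Reachable x y}.Finite) :
    ∃ T' : SimpleGraph X, T ≤ T' ∧ T' ≤ K ∧ T'.IsAcyclic ∧ T'.Reachable = K.Reachable ∧
      Measurable fun p : X × X => T'.Adj p.1 p.2 := by
  classical
  have hR := he.measurable_reachable_of_le hKG hK
  -- the graph that `θ` encodes on the component of `x`
  let Γ : X → (X → X → ℤ) → SimpleGraph X := fun x θ =>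
    { Adj := fun y z => K.Adj y z ∧ K.Reachable x y ∧ θ y z ≠ 0 ∧ θ z y ≠ 0
      symm := ⟨fun y z h => ⟨h.1.symm, h.2.1.trans h.1.reachable, h.2.2.2, h.2.2.1⟩⟩
      loopless := ⟨fun y h => h.1.ne rfl⟩ }
  -- this graph contains `T` and is a spanning tree of the component
  let Q : X → (X → X → ℤ) → Prop := fun x θ =>
    (∀ y, ∀ z, K.Reachable x y → T.Adj y z → (Γ x θ).Adj y z) ∧
    (∀ y, K.Reachable x y → (Γ x θ).Reachable x y) ∧ (Γ x θ).IsAcyclic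
  have hΓi : ∀ x y θ, K.Reachable x y → Γ x θ = Γ y θ := by
    intro x y θ hxy
    ext a b
    simp only [Γ]
    have : K.Reachable x a ↔ K.Reachable y a :=
      ⟨fun h => hxy.symm.trans h, fun h => hxy.trans h⟩
    rw [this]
  have hΓK : ∀ x θ, Γ x θ ≤ K := fun x θ a b h => h.1
  have hQm : ∀ θ : X → X → ℤ, (Measurable fun p : X × X => θ p.1 p.2) →
      Measurable fun x => Q x θ := by
    intro θ hθ
    have hΓm : Measurable fun p : X × X × X => (Γ p.1 θ).Adj p.2.1 p.2.2 := by
      refine Measurable.and (hK.comp measurable_snd) (Measurable.and ?_ (Measurable.and ?_ ?_))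
      · exact hR.comp (f := fun p : X × X × X => (p.1, p.2.1)) (by fun_prop)
      · exact measurableSet_setOfPred.1 ((hθ.comp measurable_snd) (measurableSet_singleton 0).compl)
      · exact measurableSet_setOfPred.1 ((hθ.comp (measurable_swap.comp measurable_snd))
          (measurableSet_singleton 0).compl)
    have hΓG : ∀ x, Γ x θ ≤ G := fun x => (hΓK x θ).trans hKG
    refine Measurable.and ?_ (Measurable.and ?_ ?_)
    · refine he.measurable_forall (π := id) measurable_id (he.measurable_forall
        (π := fun p : X × X => p.1) measurable_fst (Measurable.imp ?_ (Measurable.imp ?_ ?_))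
        ?_) ?_
      · exact hR.comp measurable_fst
      · exact hT.comp (f := fun p : (X × X) × X => (p.1.2, p.2)) (by fun_prop)
      · exact hΓm.comp (f := fun p : (X × X) × X => (p.1.1, p.1.2, p.2)) (by fun_prop)
      · intro p z h
        push Not at h
        exact (h.1.mono hKG).trans (hTK.trans hKG h.2.1).reachable
      · intro x y h
        push Not at h
        obtain ⟨z, h⟩ := h
        exact h.1.mono hKG
    · refine he.measurable_forall (π := id) measurable_id (Measurable.imp hR ?_) ?_
      · exact (he.measurable_reachable_param hΓG hΓm).comp
          (f := fun p : X × X => (p.1, p.1, p.2)) (by fun_prop)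
      · intro x y h
        push Not at h
        exact h.1.mono hKG
    · exact he.measurable_isAcyclic (π := id) measurable_id hΓG hΓm
        fun a v w h => h.2.1.mono hKG
  have hQl : ∀ x θ θ', (∀ y z, K.Reachable x y → K.Reachable x z → θ y z = θ' y z) →
      Q x θ → Q x θ' := by
    intro x θ θ' hθθ' h
    have : Γ x θ = Γ x θ' := by
      ext a b
      simp only [Γ]
      constructor <;> rintro ⟨h1, h2, h3, h4⟩ <;>
      · have h5 := hθθ' a b h2 (h2.trans h1.reachable)
        have h6 := hθθ' b a (h2.trans h1.reachable) h2
        exact ⟨h1, h2, by simpa [h5] using h3, by simpa [h6] using h4⟩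
    simpa only [Q, this] using h
  have hQi : ∀ x y θ, K.Reachable x y → Q x θ → Q y θ := by
    rintro x y θ hxy ⟨h1, h2, h3⟩
    rw [hΓi x y θ hxy] at h1 h2 h3
    refine ⟨fun a b hya hab => h1 a b (hxy.trans hya) hab, fun a hya => ?_, h3⟩
    exact (h2 y hxy).symm.trans (h2 a (hxy.trans hya))
  obtain ⟨θ, hθm, -, hθ⟩ := he.exists_measurable_selection hKG hK Q hQm hQl hQi
  let T' : SimpleGraph X :=
    { Adj := fun y z => K.Adj y z ∧ θ y z ≠ 0 ∧ θ z y ≠ 0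
      symm := ⟨fun y z h => ⟨h.1.symm, h.2.2, h.2.1⟩⟩
      loopless := ⟨fun y h => h.1.ne rfl⟩ }
  have hT'K : T' ≤ K := fun a b h => h.1
  obtain ⟨F, hTF, hFK, hFac, hFR⟩ :=
    SimpleGraph.exists_isAcyclic_reachable_eq_le_of_le_of_isAcyclic hTK hac
  have hQ : ∀ x, Q x θ := by
    intro x
    refine hθ x (hfin x) ⟨fun y z => if F.Adj y z then 1 else 0, ?_, ?_, ?_⟩
    · intro y z hxy hyz
      exact ⟨hTK hyz, hxy, by simp [hTF hyz], by simp [(hTF hyz).symm]⟩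
    · intro y hxy
      rw [← hFR] at hxy
      refine reachable_of_adj_imp (fun u v hu huv => ?_) hxy
      exact ⟨hFK huv, hu.mono hFK, by simp [huv], by simp [huv.symm]⟩
    · refine hFac.anti fun a b hab => ?_
      by_contra hne
      exact hab.2.2.1 (if_neg hne)
  refine ⟨T', ?_, hT'K, ?_, ?_, ?_⟩
  · intro a b hab
    have := (hQ a).1 a b (SimpleGraph.Reachable.refl a) hab
    exact ⟨this.1, this.2.2⟩
  · rw [SimpleGraph.isAcyclic_iff_forall_adj_isBridge]
    intro v w hvw
    have h1 := (hQ v).2.2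
    rw [SimpleGraph.isAcyclic_iff_forall_adj_isBridge] at h1
    have h2 := h1 (v := v) (w := w) ⟨hvw.1, SimpleGraph.Reachable.refl v, hvw.2⟩
    rw [SimpleGraph.isBridge_iff] at h2 ⊢
    intro h3
    refine h2 (reachable_of_adj_imp (fun a b hva hab => ?_) h3)
    rw [SimpleGraph.deleteEdges_adj] at hab ⊢
    exact ⟨⟨hab.1.1, hva.mono ((SimpleGraph.deleteEdges_le _).trans hT'K), hab.1.2⟩, hab.2⟩
  · ext x y
    refine ⟨fun h => h.mono hT'K, fun h => ?_⟩
    exact ((hQ x).2.1 y h).mono fun a b (hab : (Γ x θ).Adj a b) => ⟨hab.1, hab.2.2⟩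
  · refine hK.and (Measurable.and ?_ ?_)
    · exact measurableSet_setOfPred.1 (hθm (measurableSet_singleton 0).compl)
    · exact measurableSet_setOfPred.1
        ((hθm.comp measurable_swap) (measurableSet_singleton 0).compl)

/-- For a Borel set `Y`, the graph induced on `Y` is spanned by an increasing union of Borel
forests that span the components of an exhaustion. -/
theorem IsEnum.exists_spanning_forests (he : IsEnum G e) {H : ℕ → SimpleGraph X}
    (hH : IsExhaustion G H) {Y : Set X} (hY : MeasurableSet Y) :
    ∃ T : ℕ → SimpleGraph X, Monotone T ∧ (∀ n, T n ≤ within (H n) Y) ∧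
      (∀ n, (T n).IsAcyclic) ∧ (∀ n, (T n).Reachable = (within (H n) Y).Reachable) ∧
      ∀ n, Measurable fun p : X × X => (T n).Adj p.1 p.2 := by
  let K : ℕ → SimpleGraph X := fun n => within (H n) Y
  have hKG : ∀ n, K n ≤ G := fun n => (within_le _ _).trans (hH.le n)
  have hKm : ∀ n, Measurable fun p : X × X => (K n).Adj p.1 p.2 := fun n =>
    measurable_within_const (hH.measurable_adj n) hY
  have hKfin : ∀ n x, {y | (K n).Reachable x y}.Finite := fun n x =>
    (hH.finite n x).subset fun y hy => hy.mono (within_le _ _)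
  have hKmono : ∀ n, K n ≤ K (n + 1) := fun n => within_mono (hH.mono n.le_succ) subset_rfl
  let P : ℕ → SimpleGraph X → Prop := fun n T => T ≤ K n ∧ T.IsAcyclic ∧
    T.Reachable = (K n).Reachable ∧ Measurable fun p : X × X => T.Adj p.1 p.2
  have h0 : ∃ T, P 0 T := by
    obtain ⟨T, -, h⟩ := he.exists_spanning_forest (T := ⊥) (K := K 0) bot_le (hKG 0)
      (by simp) (hKm 0) SimpleGraph.isAcyclic_bot (hKfin 0)
    exact ⟨T, h⟩
  have hs : ∀ n T, P n T → ∃ T', T ≤ T' ∧ P (n + 1) T' := fun n T hT => by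
    obtain ⟨T', h1, h⟩ := he.exists_spanning_forest (T := T) (K := K (n + 1))
      (hT.1.trans (hKmono n)) (hKG _) hT.2.2.2 (hKm _) hT.2.1 (hKfin _)
    exact ⟨T', h1, h⟩
  obtain ⟨T₀, hT₀⟩ := h0
  choose! F hF1 hF2 using hs
  let T : ℕ → SimpleGraph X := fun n => Nat.rec T₀ (fun n T => F n T) n
  have hT : ∀ n, P n (T n) := by
    intro n
    induction n with
    | zero => exact hT₀
    | succ n ih => exact hF2 n _ ih
  exact ⟨T, monotone_nat_of_le_succ fun n => hF1 n _ (hT n), fun n => (hT n).1,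
    fun n => (hT n).2.1, fun n => (hT n).2.2.1, fun n => (hT n).2.2.2⟩

end Trees

/-! ### Pruning forests to lines -/

section Forests

variable {V : Type*}

/-- The average degree of a finite tree is at most two. -/
theorem tsum_degree_le {K : SimpleGraph V} (hK : K.IsAcyclic) (x : V)
    (hfin : {y | K.Reachable x y}.Finite) :
    ∑' y, ind (K.Reachable x y) * ∑' z, ind (K.Adj y z) ≤
      2 * ∑' y, ind (K.Reachable x y) := by
  classical
  set c := K.connectedComponentMk x
  have hc : ∀ y, y ∈ c.supp ↔ K.Reachable x y := fun y => by
    rw [SimpleGraph.ConnectedComponent.mem_supp_iff, SimpleGraph.ConnectedComponent.eq]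
    exact SimpleGraph.reachable_comm
  have hcfin : c.supp.Finite := hfin.subset fun y hy => (hc y).1 hy
  have : Fintype c := hcfin.fintype
  have hcard := (hK.isTree_connectedComponent c).card_edgeFinset
  have hsum := c.toSimpleGraph.sum_degrees_eq_twice_card_edges
  have hdeg : ∀ y : c, ∑' z, ind (K.Adj y z) = (c.toSimpleGraph.degree y : ℝ≥0∞) := by
    intro y
    have : {z | K.Adj y z} = Subtype.val '' (c.toSimpleGraph.neighborSet y) := by
      ext z
      constructor
      · intro hz
        exact ⟨⟨z, (hc z).2 (((hc y).1 y.2).trans (SimpleGraph.Adj.reachable hz))⟩, hz, rfl⟩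
      · rintro ⟨w, hw, rfl⟩
        exact hw
    have h2 : (c.toSimpleGraph.neighborSet y).encard = (c.toSimpleGraph.degree y : ℕ∞) := by
      rw [← SimpleGraph.card_neighborFinset_eq_degree, ← Set.encard_coe_eq_coe_finsetCard,
        SimpleGraph.coe_neighborFinset]
    rw [tsum_ind_eq_encard, this, Subtype.val_injective.encard_image, h2]
    simp
  have hsub : ∀ f : V → ℝ≥0∞, ∑' y, ind (K.Reachable x y) * f y = ∑ y : c, f y := by
    intro f
    rw [← tsum_fintype (L := .unconditional _), ← tsum_subtype_eq_of_support_subset (s := c.supp)]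
    · refine tsum_congr fun y => ?_
      rw [ind_pos ((hc y).1 y.2), one_mul]
    · intro y hy
      exact (hc y).2 (ind_ne_zero.1 (left_ne_zero_of_mul hy))
  have h1 := hsub fun _ => 1
  simp only [mul_one] at h1
  rw [hsub, h1]
  simp only [hdeg]
  rw [← Nat.cast_sum, hsum]
  simp only [Finset.sum_const, Finset.card_univ, nsmul_eq_mul, mul_one]
  rw [← hcard]
  push_cast
  gcongr
  exact le_self_add

/-- Repeated removal of the vertices of degree at most one from the forest `T` on `Y`. -/
def prune (T : SimpleGraph V) (Y : Set V) : ℕ → Set V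
  | 0 => Y
  | n + 1 => {x | x ∈ prune T Y n ∧
      ∃ a ∈ prune T Y n, ∃ b ∈ prune T Y n, a ≠ b ∧ T.Adj x a ∧ T.Adj x b}

theorem prune_succ_subset (T : SimpleGraph V) (Y : Set V) (n : ℕ) :
    prune T Y (n + 1) ⊆ prune T Y n := fun _ hx => hx.1

theorem prune_antitone (T : SimpleGraph V) (Y : Set V) : Antitone (prune T Y) :=
  antitone_nat_of_succ_le (prune_succ_subset T Y)

/-- Pruning preserves the paths between vertices that survive. -/
theorem support_subset_prune {T : SimpleGraph V} {Y : Set V} (hTY : ∀ a b, T.Adj a b → a ∈ Y)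
    (n : ℕ) {x y : V} (hx : x ∈ prune T Y n) (hy : y ∈ prune T Y n) {p : T.Walk x y}
    (hp : p.IsPath) : ∀ v ∈ p.support, v ∈ prune T Y n := by
  induction n with
  | zero =>
    intro v hv
    rw [SimpleGraph.Walk.mem_support_iff_exists_getVert] at hv
    obtain ⟨i, rfl, hi⟩ := hv
    rcases hi.eq_or_lt with rfl | hi
    · simpa using hy
    · exact hTY _ _ (p.adj_getVert_succ hi)
  | succ n ih =>
    have ih' := ih hx.1 hy.1
    intro v hv
    rw [SimpleGraph.Walk.mem_support_iff_exists_getVert] at hv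
    obtain ⟨i, rfl, hi⟩ := hv
    rcases Nat.eq_zero_or_pos i with rfl | hi0
    · simpa using hx
    rcases hi.eq_or_lt with rfl | hi
    · simpa using hy
    obtain ⟨j, rfl⟩ : ∃ j, i = j + 1 := ⟨i - 1, by omega⟩
    refine ⟨ih' _ (p.getVert_mem_support _), p.getVert j, ih' _ (p.getVert_mem_support _),
      p.getVert (j + 1 + 1), ih' _ (p.getVert_mem_support _), ?_,
      (p.adj_getVert_succ (by omega)).symm, p.adj_getVert_succ hi⟩
    intro h
    have := hp.getVert_injOn (by simp; omega) (by simp; omega) h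
    omega

theorem within_prune_reachable {T : SimpleGraph V} {Y : Set V}
    (hTY : ∀ a b, T.Adj a b → a ∈ Y) (n : ℕ) {x y : V} (hx : x ∈ prune T Y n)
    (hy : y ∈ prune T Y n) (h : T.Reachable x y) : (within T (prune T Y n)).Reachable x y := by
  obtain ⟨p, hp⟩ := h.exists_isPath
  exact within_reachable_of_support p (support_subset_prune hTY n hx hy hp)

theorem within_iInter_prune_reachable {T : SimpleGraph V} {Y : Set V}
    (hTY : ∀ a b, T.Adj a b → a ∈ Y) {x y : V} (hx : x ∈ ⋂ n, prune T Y n)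
    (hy : y ∈ ⋂ n, prune T Y n) (h : T.Reachable x y) :
    (within T (⋂ n, prune T Y n)).Reachable x y := by
  obtain ⟨p, hp⟩ := h.exists_isPath
  rw [Set.mem_iInter] at hx hy
  refine within_reachable_of_support p fun v hv => Set.mem_iInter.2 fun n => ?_
  exact support_subset_prune hTY n (hx n) (hy n) hp v hv

/-- A vertex that survives all pruning steps has two neighbours that survive. -/
theorem exists_two_adj_iInter_prune {T : SimpleGraph V} {Y : Set V} {x : V}
    (hfin : {y | T.Adj x y}.Finite) (hx : x ∈ ⋂ n, prune T Y n) :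
    ∃ a ∈ ⋂ n, prune T Y n, ∃ b ∈ ⋂ n, prune T Y n, a ≠ b ∧ T.Adj x a ∧ T.Adj x b := by
  rw [Set.mem_iInter] at hx
  have h1 : ∀ y, ∃ n, y ∉ ⋂ n, prune T Y n → y ∉ prune T Y n := fun y => by
    by_cases hy : y ∈ ⋂ n, prune T Y n
    · exact ⟨0, fun h => absurd hy h⟩
    · rw [Set.mem_iInter] at hy
      push Not at hy
      obtain ⟨n, hn⟩ := hy
      exact ⟨n, fun _ => hn⟩
  choose f hf using h1
  obtain ⟨N, hN⟩ := (hfin.image f).bddAbove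
  have h2 : ∀ y, T.Adj x y → y ∈ prune T Y N → y ∈ ⋂ n, prune T Y n := fun y hxy hy => by
    by_contra hne
    exact hf y hne (prune_antitone T Y (hN ⟨y, hxy, rfl⟩) hy)
  obtain ⟨-, a, ha, b, hb, hab, hxa, hxb⟩ := hx (N + 1)
  exact ⟨a, h2 a hxa ha, b, h2 b hxb hb, hab, hxa, hxb⟩

/-- Pruning an infinite tree never exhausts it. -/
theorem prune_succ_nonempty {T : SimpleGraph V} {Y : Set V} (hTY : ∀ a b, T.Adj a b → a ∈ Y)
    (n : ℕ) {x : V} (hinf : {y | T.Reachable x y ∧ y ∈ prune T Y n}.Infinite) :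
    ∃ y ∈ prune T Y (n + 1), T.Reachable x y := by
  by_contra! hcon
  have hle : ∀ u y z, T.Reachable x u → (within T (prune T Y n)).Adj u y →
      (within T (prune T Y n)).Adj u z → y = z := by
    intro u y z hu hy hz
    by_contra hne
    exact hcon u ⟨hy.2.1, y, hy.2.2, z, hz.2.2, hne, hy.1, hz.1⟩ hu
  obtain ⟨a, ha⟩ := hinf.nonempty
  have hsub : {y | T.Reachable x y ∧ y ∈ prune T Y n} ⊆
      {a} ∪ {y | (within T (prune T Y n)).Adj a y} := by
    intro b hb
    have hr := within_prune_reachable hTY n ha.2 hb.2 (ha.1.symm.trans hb.1)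
    have : b = a ∨ (within T (prune T Y n)).Adj a b := by
      refine reachable_induction
        (P := fun b => b = a ∨ (within T (prune T Y n)).Adj a b) (Or.inl rfl) ?_ hr
      rintro u v hu (rfl | hau) huv
      · exact Or.inr huv
      · exact Or.inl (hle u v a (ha.1.trans (hu.mono (within_le _ _))) huv hau.symm)
    simpa using this
  refine hinf (Set.Finite.subset ((Set.finite_singleton a).union ?_) hsub)
  refine Set.Subsingleton.finite fun y hy z hz => hle a y z ha.1 hy hz

end Forests

section Lines

variable {V : Type*}

/-- The walk along a sequence of vertices that never turns back repeats no edge immediately. -/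
theorem exists_walk_of_nonbacktracking {L : SimpleGraph V} {γ : ℤ → V}
    (hadj : ∀ i, L.Adj (γ i) (γ (i + 1))) (hne : ∀ i, γ i ≠ γ (i + 1 + 1)) (n : ℕ) (i : ℤ) :
    ∃ w : L.Walk (γ i) (γ (i + n)), w.length = n ∧ w.edges.IsChain (· ≠ ·) ∧
      ∀ e ∈ w.edges.head?, e = s(γ i, γ (i + 1)) := by
  induction n generalizing i with
  | zero =>
    exact ⟨(SimpleGraph.Walk.nil : L.Walk (γ i) (γ i)).copy rfl (by simp), by simp, by simp,
      by simp⟩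
  | succ n ih =>
    obtain ⟨w, hw, hc, hh⟩ := ih (i + 1)
    refine ⟨(SimpleGraph.Walk.cons (hadj i) w).copy rfl (by push_cast; ring_nf), by simp [hw],
      ?_, by simp⟩
    rw [SimpleGraph.Walk.edges_copy, SimpleGraph.Walk.edges_cons, List.isChain_cons]
    refine ⟨fun e he => ?_, hc⟩
    rw [hh e he]
    intro heq
    rw [Sym2.eq_iff] at heq
    rcases heq with ⟨h1, -⟩ | ⟨h1, -⟩
    · exact (hadj i).ne h1
    · exact hne i h1

/-- A component of a forest all of whose vertices have degree two is a bi-infinite path. -/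
theorem exists_line_parametrization {L : SimpleGraph V} (hL : L.IsAcyclic) (x₀ : V)
    (h2 : ∀ y, L.Reachable x₀ y → ∃ a b, a ≠ b ∧ ∀ z, L.Adj y z ↔ z = a ∨ z = b) :
    ∃ γ : ℤ → V, Function.Injective γ ∧ (∀ i z, L.Adj (γ i) z ↔ z = γ (i + 1) ∨ z = γ (i - 1)) ∧
      ∀ y, L.Reachable x₀ y ↔ ∃ i, γ i = y := by
  classical
  -- darts of the component; `σ` moves a dart one step along the line
  let D := {d : V × V // L.Reachable x₀ d.1 ∧ L.Adj d.1 d.2}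
  have h3 : ∀ d : D, ∃ c, c ≠ d.1.1 ∧ ∀ z, L.Adj d.1.2 z ↔ z = d.1.1 ∨ z = c := by
    rintro ⟨⟨u, v⟩, hu, huv⟩
    obtain ⟨a, b, hab, h⟩ := h2 v (hu.trans huv.reachable)
    rcases (h u).1 huv.symm with rfl | rfl
    · exact ⟨b, hab.symm, h⟩
    · exact ⟨a, hab, fun z => by rw [h z, or_comm]⟩
  choose c hc1 hc2 using h3
  let rev : D → D := fun d => ⟨(d.1.2, d.1.1), d.2.1.trans d.2.2.reachable, d.2.2.symm⟩
  let σf : D → D := fun d => ⟨(d.1.2, c d), d.2.1.trans d.2.2.reachable,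
    (hc2 d _).2 (Or.inr rfl)⟩
  have hinv : ∀ d, rev (σf (rev (σf d))) = d := by
    intro d
    have h4 : c (rev (σf d)) = d.1.1 := by
      have h5 := (hc2 (rev (σf d)) d.1.1).1 d.2.2.symm
      rcases h5 with h5 | h5
      · exact absurd h5.symm (hc1 d)
      · exact h5.symm
    apply Subtype.ext
    exact Prod.ext h4 rfl
  let σ : Equiv.Perm D :=
    { toFun := σf
      invFun := fun d => rev (σf (rev d))
      left_inv := hinv
      right_inv := fun d => by
        have h := hinv (rev d)
        have h' := congrArg rev h
        exact h' }
  obtain ⟨a₀, b₀, -, hab₀⟩ := h2 x₀ (SimpleGraph.Reachable.refl x₀)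
  let d₀ : D := ⟨(x₀, a₀), SimpleGraph.Reachable.refl x₀, (hab₀ a₀).2 (Or.inl rfl)⟩
  let γ : ℤ → V := fun i => ((σ ^ i) d₀).1.1
  have hstep : ∀ i : ℤ, (σ ^ (i + 1)) d₀ = σf ((σ ^ i) d₀) := fun i => by
    rw [add_comm, zpow_add, zpow_one]; rfl
  have hsnd : ∀ i, ((σ ^ i) d₀).1.2 = γ (i + 1) := fun i => by
    change _ = ((σ ^ (i + 1)) d₀).1.1
    rw [hstep]
  have hadj : ∀ i, L.Adj (γ i) (γ (i + 1)) := fun i => by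
    rw [← hsnd]; exact ((σ ^ i) d₀).2.2
  have hne : ∀ i, γ i ≠ γ (i + 1 + 1) := fun i => by
    rw [← hsnd, hstep]
    exact (hc1 ((σ ^ i) d₀)).symm
  have hinj : Function.Injective γ := by
    have key : ∀ (i : ℤ) (n : ℕ), γ i = γ (i + n) → n = 0 := by
      intro i n h
      obtain ⟨w, hw, hch, -⟩ := exists_walk_of_nonbacktracking hadj hne n i
      have hp := (hL.isPath_iff_isChain w).2 hch
      have hp' : (w.copy rfl h.symm).IsPath := by rwa [SimpleGraph.Walk.isPath_copy]
      rw [SimpleGraph.Walk.isPath_iff_nil, ← SimpleGraph.Walk.length_eq_zero_iff,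
        SimpleGraph.Walk.length_copy, hw] at hp'
      exact hp'
    intro i j h
    rcases le_total i j with hij | hij
    · obtain ⟨n, rfl⟩ := Int.le.dest hij
      rw [key i n h]; simp
    · obtain ⟨n, rfl⟩ := Int.le.dest hij
      rw [key j n h.symm]; simp
  have hnb : ∀ i z, L.Adj (γ i) z ↔ z = γ (i + 1) ∨ z = γ (i - 1) := by
    intro i z
    have h := hc2 ((σ ^ (i - 1)) d₀) z
    have e1 : ((σ ^ (i - 1)) d₀).1.2 = γ i := by rw [hsnd, sub_add_cancel]
    have e2 : c ((σ ^ (i - 1)) d₀) = γ (i + 1) := by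
      rw [← hsnd]
      have := hstep (i - 1)
      rw [sub_add_cancel] at this
      rw [this]
    rw [e1, e2] at h
    rw [h, or_comm]
  refine ⟨γ, hinj, hnb, fun y => ⟨fun h => ?_, ?_⟩⟩
  · refine reachable_induction (P := fun y => ∃ i, γ i = y) ⟨0, rfl⟩ ?_ h
    rintro u v - ⟨i, rfl⟩ huv
    rcases (hnb i v).1 huv with rfl | rfl
    · exact ⟨_, rfl⟩
    · exact ⟨_, rfl⟩
  · rintro ⟨i, rfl⟩
    exact ((σ ^ i) d₀).2.1

end Lines

section Attach

variable {X : Type*} [MeasurableSpace X] [StandardBorelSpace X] {G : SimpleGraph X}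
  {e : ℕ → X → X}

/-- Borel parents directed at a Borel set `Y`: every vertex outside `Y` whose `Γ`-component meets
`Y` is sent to a neighbour closer to `Y`. The map `π` gives the point of `Y` that is reached
in the end. -/
theorem IsEnum.exists_parent (he : IsEnum G e) {Γ : SimpleGraph X} (hΓ : Γ ≤ G)
    (hΓm : Measurable fun p : X × X => Γ.Adj p.1 p.2) {Y : Set X} (hY : MeasurableSet Y) :
    ∃ p π : X → X, Measurable p ∧ Measurable π ∧ (∀ x ∈ Y, p x = x) ∧
      (∀ x, p x = x ∨ Γ.Adj x (p x)) ∧ (∀ x, ∃ k, p^[k] x = π x) ∧ (∀ x, π (p x) = π x) ∧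
      ∀ x, (∃ y ∈ Y, Γ.Reachable x y) → π x ∈ Y := by
  classical
  let P : ℕ → X → Prop := fun n x => ∃ y, y ∈ Y ∧ ∃ w : Γ.Walk x y, w.length = n
  have hPm : ∀ n, Measurable (P n) := by
    intro n
    refine he.measurable_exists (π := id) measurable_id
      ((measurableSet_setOfPred.1 (measurable_snd hY)).and ?_) ?_
    · exact (he.measurable_walk (α := Unit) (H := fun _ => Γ) (fun _ => hΓ)
        (hΓm.comp (f := fun p : Unit × X × X => p.2) (by fun_prop)) n).comp
        (f := fun p : X × X => ((), p)) (by fun_prop)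
    · rintro x y ⟨-, w, -⟩
      exact (SimpleGraph.Walk.reachable w).mono hΓ
  -- `A n`: vertices at distance `n` from `Y`
  let A : ℕ → X → Prop := fun n x => P n x ∧ ∀ m < n, ¬P m x
  have hAm : ∀ n, Measurable (A n) := fun n =>
    (hPm n).and (Measurable.forall fun m => Measurable.forall fun _ => (hPm m).not)
  have hAu : ∀ n m x, A n x → A m x → n = m := by
    intro n m x hn hm
    rcases lt_trichotomy n m with h | h | h
    · exact absurd hn.1 (hm.2 n h)
    · exact h
    · exact absurd hm.1 (hn.2 m h)
  have hAex : ∀ n x, P n x → ∃ m ≤ n, A m x := fun n x hx => by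
    have h : ∃ m, P m x := ⟨n, hx⟩
    exact ⟨Nat.find h, Nat.find_min' h hx, Nat.find_spec h, fun m hm => Nat.find_min h hm⟩
  have hA0 : ∀ x, A 0 x ↔ x ∈ Y := by
    intro x
    constructor
    · rintro ⟨⟨y, hy, w, hw⟩, -⟩
      rw [SimpleGraph.Walk.eq_of_length_eq_zero hw]
      exact hy
    · intro hx
      exact ⟨⟨x, hx, SimpleGraph.Walk.nil, rfl⟩, fun m hm => absurd hm (by omega)⟩
  -- `e i x` is a neighbour of `x` closer to `Y`
  let B : ℕ → X → Prop := fun i x => Γ.Adj x (e i x) ∧ ∃ n, A (n + 1) x ∧ A n (e i x)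
  have hBm : ∀ i, Measurable (B i) := fun i =>
    (hΓm.comp (measurable_id.prodMk (he.measurable_enum i))).and
      (Measurable.exists fun n => (hAm (n + 1)).and ((hAm n).comp (he.measurable_enum i)))
  have hBex : ∀ n x, A (n + 1) x → ∃ i, B i x := by
    intro n x hx
    obtain ⟨⟨y, hy, hw⟩, hmin⟩ := id hx
    obtain ⟨z, hxz, hw'⟩ := exists_walk_length_succ.1 hw
    obtain ⟨i, rfl⟩ := (he.reachable_iff _ _).1 (hΓ hxz).reachable
    obtain ⟨m, hmn, hm⟩ := hAex n (e i x) ⟨y, hy, hw'⟩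
    have : m = n := by
      by_contra hne
      obtain ⟨⟨y', hy', hw''⟩, -⟩ := hm
      exact hmin (m + 1) (by omega) ⟨y', hy', exists_walk_length_succ.2 ⟨_, hxz, hw''⟩⟩
    exact ⟨i, hxz, n, hx, this ▸ hm⟩
  let C : ℕ → X → Prop := fun i x => B i x ∧ ∀ j < i, ¬B j x
  have hCm : ∀ i, Measurable (C i) := fun i =>
    (hBm i).and (Measurable.forall fun j => Measurable.forall fun _ => (hBm j).not)
  let p : X → X := fun x => if h : ∃ i, B i x then e (Nat.find h) x else x
  have hpC : ∀ i x, C i x → p x = e i x := by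
    intro i x hx
    have h : ∃ i, B i x := ⟨i, hx.1⟩
    have : Nat.find h = i := (Nat.find_eq_iff h).2 hx
    simp only [p]
    rw [dif_pos h, this]
  have hpN : ∀ x, (¬∃ i, B i x) → p x = x := fun x hx => dif_neg hx
  have hpm : Measurable p := by
    intro S hS
    have : p ⁻¹' S = {x | (∃ i, C i x ∧ e i x ∈ S) ∨ ((∀ i, ¬B i x) ∧ x ∈ S)} := by
      ext x
      by_cases h : ∃ i, B i x
      · have hC : C (Nat.find h) x := ⟨Nat.find_spec h, fun j hj => Nat.find_min h hj⟩
        constructor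
        · intro hx
          exact Or.inl ⟨_, hC, by rw [← hpC _ x hC]; exact hx⟩
        · rintro (⟨i, hi, his⟩ | ⟨h', -⟩)
          · change p x ∈ S
            rwa [hpC i x hi]
          · exact absurd h (by push Not; exact h')
      · have hx : p x = x := hpN x h
        push Not at h
        simp only [Set.mem_preimage, hx, Set.mem_ofPred_eq]
        refine ⟨fun hxS => Or.inr ⟨h, hxS⟩, ?_⟩
        rintro (⟨i, hi, -⟩ | ⟨-, hxS⟩)
        · exact absurd hi.1 (h i)
        · exact hxS
    rw [this]
    refine measurableSet_setOfPred.2 (Measurable.or (Measurable.exists fun i => (hCm i).and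
      (measurableSet_setOfPred.1 (he.measurable_enum i hS))) (Measurable.and
      (Measurable.forall fun i => (hBm i).not) (measurableSet_setOfPred.1 hS)))
  have hpA : ∀ n x, A (n + 1) x → A n (p x) ∧ Γ.Adj x (p x) := by
    intro n x hx
    have h := hBex n x hx
    have hC : C (Nat.find h) x := ⟨Nat.find_spec h, fun j hj => Nat.find_min h hj⟩
    rw [hpC _ x hC]
    obtain ⟨h1, m, hm, hm'⟩ := hC.1
    obtain rfl : n = m := by have := hAu _ _ x hx hm; omega
    exact ⟨hm', h1⟩
  have hpY : ∀ x ∈ Y, p x = x := by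
    intro x hx
    refine hpN x ?_
    rintro ⟨i, -, n, hn, -⟩
    exact absurd (hAu _ _ x hn ((hA0 x).2 hx)) (by omega)
  have hpadj : ∀ x, p x = x ∨ Γ.Adj x (p x) := by
    intro x
    by_cases h : ∃ i, B i x
    · obtain ⟨i, -, n, hn, -⟩ := h
      exact Or.inr (hpA n x hn).2
    · exact Or.inl (hpN x h)
  have hiter : ∀ n x, A n x → p^[n] x ∈ Y := by
    intro n
    induction n with
    | zero => exact fun x hx => (hA0 x).1 hx
    | succ n ih =>
      intro x hx
      rw [Function.iterate_succ_apply]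
      exact ih _ (hpA n x hx).1
  have hfix : ∀ n x, x ∈ Y → p^[n] x = x := fun n x hx => Function.iterate_fixed (hpY x hx) n
  let π : X → X := fun x => if h : ∃ n, A n x then p^[Nat.find h] x else x
  have hπA : ∀ n x, A n x → π x = p^[n] x := by
    intro n x hx
    have h : ∃ n, A n x := ⟨n, hx⟩
    simp only [π]
    rw [dif_pos h, hAu _ _ x (Nat.find_spec h) hx]
  have hπN : ∀ x, (¬∃ n, A n x) → π x = x := fun x hx => dif_neg hx
  have hπm : Measurable π := by
    intro S hS
    have : π ⁻¹' S = {x | (∃ n, A n x ∧ p^[n] x ∈ S) ∨ ((∀ n, ¬A n x) ∧ x ∈ S)} := by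
      ext x
      by_cases h : ∃ n, A n x
      · obtain ⟨n, hn⟩ := h
        simp only [Set.mem_preimage, hπA n x hn, Set.mem_ofPred_eq]
        constructor
        · exact fun hx => Or.inl ⟨n, hn, hx⟩
        · rintro (⟨m, hm, hms⟩ | ⟨h', -⟩)
          · rwa [hAu n m x hn hm]
          · exact absurd hn (h' n)
      · simp only [Set.mem_preimage, hπN x h, Set.mem_ofPred_eq]
        push Not at h
        refine ⟨fun hxS => Or.inr ⟨h, hxS⟩, ?_⟩
        rintro (⟨i, hi, -⟩ | ⟨-, hxS⟩)
        · exact absurd hi (h i)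
        · exact hxS
    rw [this]
    refine measurableSet_setOfPred.2 (Measurable.or (Measurable.exists fun n => (hAm n).and
      (measurableSet_setOfPred.1 (hpm.iterate n hS))) (Measurable.and
      (Measurable.forall fun i => (hAm i).not) (measurableSet_setOfPred.1 hS)))
  refine ⟨p, π, hpm, hπm, hpY, hpadj, fun x => ?_, fun x => ?_, ?_⟩
  · by_cases h : ∃ n, A n x
    · obtain ⟨n, hn⟩ := h
      exact ⟨n, (hπA n x hn).symm⟩
    · exact ⟨0, (hπN x h).symm⟩
  · by_cases h : ∃ n, A n x
    · obtain ⟨n, hn⟩ := h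
      cases n with
      | zero => rw [hpY x ((hA0 x).1 hn)]
      | succ n => rw [hπA _ _ hn, hπA _ _ (hpA n x hn).1, Function.iterate_succ_apply]
    · have : ¬∃ i, B i x := by
        rintro ⟨i, -, n, hn, -⟩
        exact h ⟨_, hn⟩
      rw [hpN x this]
  · rintro x ⟨y, hy, ⟨w⟩⟩
    obtain ⟨m, -, hm⟩ := hAex w.length x ⟨y, hy, w, rfl⟩
    rw [hπA m x hm]
    exact hiter m x hm

end Attach

/-! ### Shortcuts along a line -/

section Shortcuts

/-- Among intervals of integers with centres `C`, disjoint ones can be chosen so that their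
total length is at least a fifth of the number of centres. -/
theorem exists_disjoint_intervals (C : Finset ℤ) (l r : ℤ → ℤ)
    (hlr : ∀ s ∈ C, l s < s ∧ s < r s) :
    ∃ u ⊆ C, (∀ s ∈ u, ∀ t ∈ u, s ≠ t → r s < l t ∨ r t < l s) ∧
      (C.card : ℤ) ≤ ∑ s ∈ u, (5 * (r s - l s) + 1) := by
  classical
  obtain ⟨M, hM⟩ := (C.finite_toSet.image fun s => ((r s - l s : ℤ) : ℝ)).bddAbove
  obtain ⟨u, huC, hdisj, hcov⟩ := Vitali.exists_disjoint_subfamily_covering_enlargement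
    (fun s => Set.Icc (l s) (r s)) (C : Set ℤ) (fun s => ((r s - l s : ℤ) : ℝ)) 2 one_lt_two
    (fun s hs => by have := hlr s hs; exact_mod_cast (by omega : 0 ≤ r s - l s)) M
    (fun s hs => hM ⟨s, hs, rfl⟩)
    (fun s hs => ⟨s, by have := hlr s hs; exact ⟨by omega, by omega⟩⟩)
  have hufin : u.Finite := C.finite_toSet.subset huC
  have hu : ∀ s, s ∈ hufin.toFinset ↔ s ∈ u := fun s => hufin.mem_toFinset
  refine ⟨hufin.toFinset, fun s hs => huC ((hu s).1 hs), fun s hs t ht hst => ?_, ?_⟩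
  · have h := hdisj ((hu s).1 hs) ((hu t).1 ht) hst
    by_contra! hcon
    have hs' := hlr s (huC ((hu s).1 hs))
    have ht' := hlr t (huC ((hu t).1 ht))
    exact Set.disjoint_left.1 h
      (show max (l s) (l t) ∈ Set.Icc (l s) (r s) from ⟨le_max_left _ _, by omega⟩)
      ⟨le_max_right _ _, by omega⟩
  · have hsub : C ⊆ hufin.toFinset.biUnion fun t =>
        Finset.Icc (l t - 2 * (r t - l t)) (r t + 2 * (r t - l t)) := by
      intro s hs
      obtain ⟨t, ht, ⟨z, hz1, hz2⟩, hst⟩ := hcov s hs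
      have hst' : r s - l s ≤ 2 * (r t - l t) := by exact_mod_cast hst
      have := hlr s hs
      simp only [Set.mem_Icc] at hz1 hz2
      rw [Finset.mem_biUnion]
      refine ⟨t, (hu t).2 ht, Finset.mem_Icc.2 ⟨by omega, by omega⟩⟩
    have h1 := (Finset.card_le_card hsub).trans Finset.card_biUnion_le
    calc (C.card : ℤ) ≤ ((∑ t ∈ hufin.toFinset,
          (Finset.Icc (l t - 2 * (r t - l t)) (r t + 2 * (r t - l t))).card : ℕ) : ℤ) := by
          exact_mod_cast h1
      _ = ∑ s ∈ hufin.toFinset, (5 * (r s - l s) + 1) := by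
          push_cast
          refine Finset.sum_congr rfl fun t ht => ?_
          have := hlr t (huC ((hu t).1 ht))
          rw [Int.card_Icc, Int.toNat_of_nonneg (by omega)]
          ring

/-- Shortcuts make a piece of a line shorter: let `γ` be a path whose vertices carry disjoint finite
connected blobs (the fibres of `π`), and let every vertex of `C` in the segment from `γ a` to
`γ b` be jumped over, at distance more than `N`, by an edge between two blobs of the
segment. Then the ends of the segment are joined by a connected set that loses about a fifth of the
vertices in `C`; it consists of the vertices not jumped over by a disjoint family of such edges
and of the blobs at the ends of these edges. -/
theorem exists_connected_shortcut {V : Type*} {G : SimpleGraph V} {γ : ℤ → V}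
    (hadj : ∀ i, G.Adj (γ i) (γ (i + 1))) {π : V → V} (hπ : ∀ i, π (γ i) = γ i)
    (hfib : ∀ i, {y | π y = γ i}.Finite)
    (hconn : ∀ y i, π y = γ i → (within G {y | π y = γ i}).Reachable y (γ i))
    (N R : ℕ) (a b : ℤ) (hab : a ≤ b) (C : Finset ℤ)
    (hC : ∀ s ∈ C, ∃ u v l r, G.Adj u v ∧ π u = γ l ∧ π v = γ r ∧ a ≤ l ∧ r ≤ b ∧
      l + N < s ∧ s + N < r) :
    ∃ S : Set V, S ⊆ {y | ∃ t ∈ Set.Icc a b, π y = γ t} ∧ γ a ∈ S ∧ γ b ∈ S ∧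
      (∀ y ∈ S, ∀ z ∈ S, (within G S).Reachable y z) ∧
      N * (5 * S.ncard + C.card) ≤ (5 * N + 6 + 10 * R) * (b + 1 - a).toNat +
        5 * N * {y | ∃ t ∈ Set.Icc a b, π y = γ t ∧ R < {z | π z = γ t}.ncard}.ncard := by
  classical
  have : Nonempty V := ⟨γ 0⟩
  choose! U W l r hUW hU hW hal hrb hl hr using hC
  obtain ⟨u, huC, hdisj, hcard⟩ := exists_disjoint_intervals C l r
    (fun s hs => by have := hl s hs; have := hr s hs; omega)
  -- the positions that no edge of the disjoint family `u` jumps over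
  let kept : Finset ℤ := (Finset.Icc a b).filter fun t => ∀ s ∈ u, t ≤ l s ∨ r s ≤ t
  have hkept : ∀ t, t ∈ kept ↔ (a ≤ t ∧ t ≤ b) ∧ ∀ s ∈ u, t ≤ l s ∨ r s ≤ t := fun t => by
    simp [kept]
  have hu : ∀ s ∈ u, a ≤ l s ∧ l s + N < s ∧ s + N < r s ∧ r s ≤ b := fun s hs =>
    ⟨hal s (huC hs), hl s (huC hs), hr s (huC hs), hrb s (huC hs)⟩
  have hlk : ∀ s ∈ u, l s ∈ kept := by
    intro s hs
    rw [hkept]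
    refine ⟨by have := hu s hs; omega, fun t ht => ?_⟩
    by_cases hst : s = t
    · subst hst; exact Or.inl le_rfl
    · have := hdisj s hs t ht hst
      have := hu s hs
      omega
  have hrk : ∀ s ∈ u, r s ∈ kept := by
    intro s hs
    rw [hkept]
    refine ⟨by have := hu s hs; omega, fun t ht => ?_⟩
    by_cases hst : s = t
    · subst hst; exact Or.inr le_rfl
    · have := hdisj s hs t ht hst
      have := hu s hs
      omega
  -- the positions of the ends of these edges; their blobs are kept as a whole
  let Q : Finset ℤ := u.image l ∪ u.image r
  have hQ : ∀ t ∈ Q, t ∈ kept := by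
    intro t ht
    simp only [Q, Finset.mem_union, Finset.mem_image] at ht
    rcases ht with ⟨s, hs, rfl⟩ | ⟨s, hs, rfl⟩
    · exact hlk s hs
    · exact hrk s hs
  let S : Set V := {y | (∃ t ∈ kept, y = γ t) ∨ ∃ t ∈ Q, π y = γ t}
  have hSγ : ∀ t ∈ kept, γ t ∈ S := fun t ht => Or.inl ⟨t, ht, rfl⟩
  have hak : a ∈ kept := by
    rw [hkept]
    exact ⟨⟨le_rfl, hab⟩, fun s hs => Or.inl (hu s hs).1⟩
  have hbk : b ∈ kept := by
    rw [hkept]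
    exact ⟨⟨hab, le_rfl⟩, fun s hs => Or.inr (hu s hs).2.2.2⟩
  have hblob : ∀ t ∈ Q, ∀ y, π y = γ t → (within G S).Reachable y (γ t) := fun t ht y hy =>
    (hconn y t hy).mono (within_mono le_rfl fun z hz => Or.inr ⟨t, ht, hz⟩)
  have hlQ : ∀ s ∈ u, l s ∈ Q := fun s hs =>
    Finset.mem_union_left _ (Finset.mem_image_of_mem _ hs)
  have hrQ : ∀ s ∈ u, r s ∈ Q := fun s hs =>
    Finset.mem_union_right _ (Finset.mem_image_of_mem _ hs)
  have hline : ∀ n : ℕ, ∀ s : ℤ, s = a + n → s ∈ kept → (within G S).Reachable (γ a) (γ s) := by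
    intro n
    induction n using Nat.strong_induction_on with
    | _ n ih =>
      intro s hs hsk
      rcases Nat.eq_zero_or_pos n with rfl | hn
      · rw [hs]; simp
      by_cases hk : s - 1 ∈ kept
      · have h1 := ih (n - 1) (by omega) (s - 1) (by omega) hk
        have h2 := hadj (s - 1)
        rw [sub_add_cancel] at h2
        have h3 : (within G S).Adj (γ (s - 1)) (γ s) := ⟨h2, hSγ _ hk, hSγ _ hsk⟩
        exact h1.trans h3.reachable
      · rw [hkept] at hk hsk
        push Not at hk
        obtain ⟨t, ht, h1, h2⟩ := hk (by omega)
        have h3 : s = r t := by have := hsk.2 t ht; omega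
        have h4 := hu t ht
        have h5 := ih (l t - a).toNat (by omega) (l t) (by omega) (hlk t ht)
        have h6 : (within G S).Adj (U t) (W t) := ⟨hUW t (huC ht),
          Or.inr ⟨l t, hlQ t ht, hU t (huC ht)⟩, Or.inr ⟨r t, hrQ t ht, hW t (huC ht)⟩⟩
        rw [h3]
        exact (h5.trans (hblob _ (hlQ t ht) _ (hU t (huC ht))).symm).trans
          (h6.reachable.trans (hblob _ (hrQ t ht) _ (hW t (huC ht))))
  have hroot : ∀ y ∈ S, (within G S).Reachable (γ a) y := by
    have hγ : ∀ t ∈ kept, (within G S).Reachable (γ a) (γ t) := fun t ht =>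
      hline (t - a).toNat t (by have := (hkept t).1 ht; omega) ht
    rintro y (⟨t, ht, rfl⟩ | ⟨t, ht, hy⟩)
    · exact hγ t ht
    · exact (hγ t (hQ t ht)).trans (hblob t ht y hy).symm
  refine ⟨S, ?_, hSγ a hak, hSγ b hbk, fun y hy z hz => (hroot y hy).symm.trans (hroot z hz), ?_⟩
  · rintro y (⟨t, ht, rfl⟩ | ⟨t, ht, hy⟩)
    · exact ⟨t, ((hkept t).1 ht).1, hπ t⟩
    · exact ⟨t, ((hkept t).1 (hQ t ht)).1, hy⟩
  set Big : Set V := {y | ∃ t ∈ Set.Icc a b, π y = γ t ∧ R < {z | π z = γ t}.ncard}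
  have hBigfin : Big.Finite := by
    refine ((Set.finite_Icc a b).biUnion fun t _ => hfib t).subset ?_
    rintro y ⟨t, ht, hy, -⟩
    exact Set.mem_biUnion ht hy
  -- the size of `S`
  have hScard : S.ncard ≤ kept.card + 2 * u.card * R + Big.ncard := by
    let Q' : Finset ℤ := Q.filter fun t => {z | π z = γ t}.ncard ≤ R
    have hsub : S ⊆ ↑(kept.image γ) ∪ ↑(Q'.biUnion fun t => (hfib t).toFinset) ∪ Big := by
      rintro y (⟨t, ht, rfl⟩ | ⟨t, ht, hy⟩)
      · exact Or.inl (Or.inl (by simpa using ⟨t, ht, rfl⟩))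
      · by_cases hR : {z | π z = γ t}.ncard ≤ R
        · refine Or.inl (Or.inr ?_)
          simp only [Finset.coe_biUnion, Set.mem_iUnion]
          exact ⟨t, by simp [Q', ht, hR], by simpa using hy⟩
        · exact Or.inr ⟨t, ((hkept t).1 (hQ t ht)).1, hy, not_le.1 hR⟩
    refine (Set.ncard_le_ncard hsub (((Finset.finite_toSet _).union
      (Finset.finite_toSet _)).union hBigfin)).trans ?_
    refine (Set.ncard_union_le _ _).trans ?_
    gcongr
    refine (Set.ncard_union_le _ _).trans ?_
    rw [Set.ncard_coe_finset, Set.ncard_coe_finset]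
    refine add_le_add Finset.card_image_le ?_
    refine Finset.card_biUnion_le.trans ?_
    have h1 : ∑ t ∈ Q', (hfib t).toFinset.card ≤ ∑ t ∈ Q', R := by
      refine Finset.sum_le_sum fun t ht => ?_
      rw [← Set.ncard_eq_toFinset_card _ (hfib t)]
      exact (Finset.mem_filter.1 ht).2
    refine h1.trans ?_
    rw [Finset.sum_const, smul_eq_mul]
    gcongr
    calc Q'.card ≤ Q.card := Finset.card_filter_le _ _
      _ ≤ (u.image l).card + (u.image r).card := Finset.card_union_le _ _
      _ ≤ u.card + u.card := add_le_add Finset.card_image_le Finset.card_image_le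
      _ = 2 * u.card := by ring
  -- the vertices jumped over
  have hjump : kept.card + ∑ s ∈ u, (Finset.Ioo (l s) (r s)).card ≤ (Finset.Icc a b).card := by
    rw [← Finset.card_biUnion, ← Finset.card_union_of_disjoint]
    · refine Finset.card_le_card (Finset.union_subset (Finset.filter_subset _ _) ?_)
      intro t ht
      simp only [Finset.mem_biUnion, Finset.mem_Ioo] at ht
      obtain ⟨s, hs, h1, h2⟩ := ht
      have := hu s hs
      exact Finset.mem_Icc.2 ⟨by omega, by omega⟩
    · rw [Finset.disjoint_left]
      intro t ht ht'
      simp only [Finset.mem_biUnion, Finset.mem_Ioo] at ht'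
      obtain ⟨s, hs, h1, h2⟩ := ht'
      have := ((hkept t).1 ht).2 s hs
      omega
    · intro s hs t ht hst
      change Disjoint _ _
      rw [Finset.disjoint_left]
      intro z hz hz'
      rw [Finset.mem_Ioo] at hz hz'
      have := hdisj s hs t ht hst
      omega
  have hjump' : (kept.card : ℤ) + ∑ s ∈ u, (r s - l s - 1) ≤ b + 1 - a := by
    have h1 : ((kept.card + ∑ s ∈ u, (Finset.Ioo (l s) (r s)).card : ℕ) : ℤ) ≤
        ((Finset.Icc a b).card : ℤ) := by exact_mod_cast hjump
    rw [Int.card_Icc, Int.toNat_of_nonneg (by omega)] at h1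
    push_cast at h1
    refine le_trans (le_of_eq ?_) h1
    congr 1
    refine Finset.sum_congr rfl fun s hs => ?_
    have := hu s hs
    rw [Int.card_Ioo, Int.toNat_of_nonneg (by omega)]
  have hucard : (N : ℤ) * u.card ≤ b + 1 - a := by
    have h1 : ∑ s ∈ u, (N : ℤ) ≤ ∑ s ∈ u, (r s - l s - 1) :=
      Finset.sum_le_sum fun s hs => by have := hu s hs; omega
    rw [Finset.sum_const, nsmul_eq_mul, mul_comm] at h1
    have h2 : (0 : ℤ) ≤ kept.card := by positivity
    omega
  have hJ : (((b + 1 - a).toNat : ℕ) : ℤ) = b + 1 - a := Int.toNat_of_nonneg (by omega)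
  have hc1 : (C.card : ℤ) ≤ 5 * ∑ s ∈ u, (r s - l s - 1) + 6 * u.card := by
    refine hcard.trans (le_of_eq ?_)
    rw [Finset.mul_sum]
    have : (6 : ℤ) * u.card = ∑ s ∈ u, 6 := by rw [Finset.sum_const]; simp [mul_comm]
    rw [this, ← Finset.sum_add_distrib]
    exact Finset.sum_congr rfl fun s _ => by ring
  have hS' : (S.ncard : ℤ) ≤ kept.card + 2 * u.card * R + Big.ncard := by exact_mod_cast hScard
  zify
  rw [hJ]
  set D := ∑ s ∈ u, (r s - l s - 1)
  have h1 : 5 * (S.ncard : ℤ) + C.card ≤ 5 * (b + 1 - a) + (6 + 10 * R) * u.card +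
      5 * Big.ncard := by linarith
  have h2 : (N : ℤ) * (5 * S.ncard + C.card) ≤ N * (5 * (b + 1 - a) + (6 + 10 * R) * u.card +
      5 * Big.ncard) := mul_le_mul_of_nonneg_left h1 (by positivity)
  have h3 : (6 + 10 * (R : ℤ)) * (N * u.card) ≤ (6 + 10 * R) * (b + 1 - a) :=
    mul_le_mul_of_nonneg_left hucard (by positivity)
  linarith

end Shortcuts

/-! ### Sections and cores of lines -/

section Sections

variable {X : Type*} [MeasurableSpace X]

/-- A Borel set that meets almost every component of `G` in a nonempty set inducing a connected
subgraph. -/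
structure IsSection (G : SimpleGraph X) (μ : Measure X) (Y : Set X) : Prop where
  measurableSet : MeasurableSet Y
  ae_exists : ∀ᵐ x ∂μ, ∃ y ∈ Y, G.Reachable x y
  ae_reachable : ∀ᵐ x ∂μ, ∀ y ∈ Y, ∀ z ∈ Y, G.Reachable x y → G.Reachable x z →
    (within G Y).Reachable y z

/-- A forest of lines `L` on a Borel set, exhausted by the subforests `K n` with
finite components, such that almost every component of `G` contains at most one line. The
set is the intersection of the decreasing sections `P j`. -/
structure IsLineCore (G : SimpleGraph X) (μ : Measure X) (P : ℕ → Set X) (L : SimpleGraph X)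
    (K : ℕ → SimpleGraph X) : Prop where
  antitone : Antitone P
  isSection : ∀ j, IsSection G μ (P j)
  le : L ≤ within G (⋂ j, P j)
  isAcyclic : L.IsAcyclic
  measurable_adj : Measurable fun p : X × X => L.Adj p.1 p.2
  ae_adj : ∀ᵐ x ∂μ, ∀ y ∈ ⋂ j, P j, G.Reachable x y → ∃ a b, a ≠ b ∧ ∀ z, L.Adj y z ↔ z = a ∨ z = b
  ae_reachable : ∀ᵐ x ∂μ, ∀ y ∈ ⋂ j, P j, ∀ z ∈ ⋂ j, P j, G.Reachable x y → G.Reachable x z →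
    L.Reachable y z
  exhaustion : IsExhaustion L K

variable [StandardBorelSpace X] {G : SimpleGraph X} {μ : Measure X} [IsFiniteMeasure μ]
  {e : ℕ → X → X}

/-- A spanning forest of a section is pruned for ever. All stages are sections, and the vertices that
survive form at most one line in a component. -/
theorem IsSection.exists_isLineCore (hG : IsTame G μ e) (hend : ∀ᵐ x ∂μ, OneEndedAt G x)
    {H : ℕ → SimpleGraph X} (hH : IsExhaustion G H) {Y : Set X} (hY : IsSection G μ Y) :
    ∃ P L K, IsLineCore G μ P L K ∧ P 0 = Y := by
  obtain ⟨T, hTmono, hTle, hTac, hTr, hTm⟩ := hG.exists_spanning_forests hH hY.measurableSet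
  set U := unionGraph T with hU
  have hUY : ∀ a b, U.Adj a b → a ∈ Y := fun a b ⟨n, h⟩ => (hTle n h).2.1
  have hUG : U ≤ G := fun a b ⟨n, h⟩ => hH.le n (hTle n h).1
  have hUm : Measurable fun p : X × X => U.Adj p.1 p.2 := Measurable.exists fun n => hTm n
  have hUac : U.IsAcyclic := isAcyclic_unionGraph hTmono hTac
  have hUr : ∀ {y z}, (within G Y).Reachable y z → U.Reachable y z := by
    intro y z h
    obtain ⟨n, hn⟩ := hH.exists_reachable h
    rw [← hTr n] at hn
    exact hn.mono (le_unionGraph T n)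
  have hPm : ∀ j, MeasurableSet (prune U Y j) := by
    intro j
    induction j with
    | zero => exact hY.measurableSet
    | succ j ih =>
      have ihm : Measurable fun x => x ∈ prune U Y j := measurableSet_setOfPred.1 ih
      refine ih.inter (measurableSet_setOfPred.2 ?_)
      refine hG.measurable_exists (π := id) measurable_id
        (P := fun x a => a ∈ prune U Y j ∧ ∃ b ∈ prune U Y j, a ≠ b ∧ U.Adj x a ∧ U.Adj x b) ?_
        (fun x a ⟨_, b, _, _, h, _⟩ => (hUG h).reachable)
      refine (ihm.comp measurable_snd).and ?_
      refine hG.measurable_exists (π := fun p : X × X => p.1) measurable_fst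
        (P := fun p b => b ∈ prune U Y j ∧ p.2 ≠ b ∧ U.Adj p.1 p.2 ∧ U.Adj p.1 b) ?_
        (fun p b ⟨_, _, _, h⟩ => (hUG h).reachable)
      refine (ihm.comp measurable_snd).and (Measurable.and ?_ (Measurable.and ?_ ?_))
      · exact (measurable_eq_of_measurable (measurable_snd.comp measurable_fst)
          measurable_snd).not
      · exact hUm.comp measurable_fst
      · exact hUm.comp (f := fun q : (X × X) × X => (q.1.1, q.2)) (by fun_prop)
  have hPY : ∀ j, prune U Y j ⊆ Y := fun j => prune_antitone U Y (Nat.zero_le j)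
  have hPsec : ∀ j, IsSection G μ (prune U Y j) := by
    intro j
    refine ⟨hPm j, ?_, ?_⟩
    · induction j with
      | zero => exact hY.ae_exists
      | succ j ih =>
        filter_upwards [hG.ae_infinite_of_nonempty (hPm j) (hend.mono fun _ h => h.infinite), ih,
          hY.ae_reachable] with x hx hx2 hx3
        obtain ⟨y, hy, hxy⟩ := hx2
        obtain ⟨z, hz, hyz⟩ := prune_succ_nonempty hUY j (x := y) ((hx ⟨y, hy, hxy⟩).mono
          fun z hz => ⟨hUr (hx3 y (hPY j hy) z (hPY j hz.2) hxy hz.1), hz.2⟩)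
        exact ⟨z, hz, hxy.trans (hyz.mono hUG)⟩
    · filter_upwards [hY.ae_reachable] with x hx y hy z hz hxy hxz
      exact (within_prune_reachable hUY j hy hz
        (hUr (hx y (hPY j hy) z (hPY j hz) hxy hxz))).mono (within_mono hUG subset_rfl)
  set l := ⋂ j, prune U Y j with hl
  have hlm : MeasurableSet l := MeasurableSet.iInter hPm
  have hLm := measurable_within_const hUm hlm
  have hLle : within U l ≤ G := (within_le _ _).trans hUG
  have hKm : ∀ n, Measurable fun p : X × X => (within (T n) l).Adj p.1 p.2 := fun n =>
    measurable_within_const (hTm n) hlm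
  have hKG : ∀ n, within (T n) l ≤ G := fun n =>
    ((within_le _ _).trans (le_unionGraph T n)).trans hUG
  have hKfin : ∀ n x, {y | (within (T n) l).Reachable x y}.Finite := fun n x =>
    (hH.finite n x).subset fun y hy =>
      hy.mono ((within_le _ _).trans ((hTle n).trans (within_le _ _)))
  refine ⟨prune U Y, within U l, fun n => within (T n) l, ⟨prune_antitone U Y, hPsec,
    within_mono hUG subset_rfl, hUac.anti (within_le _ _), hLm, ?_, ?_,
    ⟨fun m n h => within_mono (hTmono h) subset_rfl,
      fun n => within_mono (le_unionGraph T n) subset_rfl, hKm, hKfin,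
      fun x y ⟨⟨n, h⟩, h'⟩ => ⟨n, h, h'⟩⟩⟩, rfl⟩
  swap
  · filter_upwards [hY.ae_reachable] with x hx y hy z hz hxy hxz
    exact within_iInter_prune_reachable hUY hy hz
      (hUr (hx y (Set.mem_iInter.1 hy 0) z (Set.mem_iInter.1 hz 0) hxy hxz))
  -- the degree in the core is at least two, and its average is at most two
  have hdm : Measurable fun x => ∑' z, ind ((within U l).Adj x z) :=
    hG.measurable_tsum (π := id) measurable_id (measurable_ind hLm)
      (fun x z h => (hLle (ind_ne_zero.1 h)).reachable)
  have hlind : Measurable fun x => 2 * ind (x ∈ l) :=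
    (measurable_ind (measurableSet_setOfPred.1 hlm)).const_mul 2
  have hge : ∀ x, 2 * ind (x ∈ l) ≤ ∑' z, ind ((within U l).Adj x z) := by
    intro x
    by_cases hx : x ∈ l
    · obtain ⟨a, ha, b, hb, hab, hxa, hxb⟩ := exists_two_adj_iInter_prune (T := U)
        ((hG.finite_neighborSet x).subset fun y hy => hUG hy) hx
      classical
      refine le_trans ?_ (ENNReal.sum_le_tsum {a, b})
      have h1 : (within U l).Adj x a := ⟨hxa, hx, ha⟩
      have h2 : (within U l).Adj x b := ⟨hxb, hx, hb⟩
      rw [Finset.sum_pair hab, ind_pos hx, ind_pos h1, ind_pos h2]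
      norm_num
    · rw [ind_neg hx, mul_zero]
      exact zero_le
  have hint : ∫⁻ x, ∑' z, ind ((within U l).Adj x z) ∂μ ≤ ∫⁻ x, 2 * ind (x ∈ l) ∂μ := by
    have h1 : ∀ x, ∑' z, ind ((within U l).Adj x z) = ⨆ n, ∑' z, ind ((within (T n) l).Adj x z) := by
      intro x
      have hfin : ∀ S : SimpleGraph X, S ≤ U → ∑' z, ind ((within S l).Adj x z) =
          ∑ z ∈ (hG.finite_neighborSet x).toFinset, ind ((within S l).Adj x z) := by
        intro S hS
        refine tsum_eq_sum fun z hz => ind_neg fun h => hz ?_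
        simpa using hUG (hS h.1)
      rw [hfin U le_rfl]
      simp only [fun n => hfin (T n) (le_unionGraph T n)]
      rw [← ENNReal.finsetSum_iSup_of_monotone fun z m n hmn => ind_mono
        fun h => (within_mono (hTmono hmn) subset_rfl h : (within (T n) l).Adj x z)]
      refine Finset.sum_congr rfl fun z _ => ?_
      by_cases h : (within U l).Adj x z
      · obtain ⟨⟨n, hn⟩, h'⟩ := h
        refine le_antisymm ((ind_le_one _).trans ?_) (iSup_le fun n => ind_mono fun h =>
          ⟨le_unionGraph T n h.1, h.2⟩)
        refine le_trans ?_ (le_iSup _ n)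
        rw [ind_pos]
        exact ⟨hn, h'⟩
      · rw [ind_neg h]
        refine (ENNReal.iSup_eq_zero.2 fun n => ind_neg fun h' => h
          ⟨le_unionGraph T n h'.1, h'.2⟩).symm
    simp only [h1]
    have hdn : ∀ n, Measurable fun x => ∑' z, ind ((within (T n) l).Adj x z) := fun n =>
      hG.measurable_tsum (π := id) measurable_id (measurable_ind (hKm n))
        (fun x z h => (hKG n (ind_ne_zero.1 h)).reachable)
    rw [lintegral_iSup hdn fun m n hmn x => ENNReal.tsum_le_tsum fun z => ind_mono
      fun h => within_mono (hTmono hmn) subset_rfl h]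
    refine iSup_le fun n => ?_
    refine hG.lintegral_mono_of_class_sum_le (hKG n) (hKm n) (ae_of_all _ (hKfin n)) (hdn n) hlind
      (ae_of_all _ fun x => ?_)
    by_cases hx : x ∈ l
    · refine (tsum_degree_le ((hTac n).anti (within_le _ _)) x (hKfin n x)).trans (le_of_eq ?_)
      rw [← ENNReal.tsum_mul_left]
      refine tsum_congr fun y => ?_
      by_cases hxy : (within (T n) l).Reachable x y
      · rw [ind_pos hxy, ind_pos (mem_of_within_reachable hxy hx)]; simp
      · rw [ind_neg hxy]; simp
    · refine le_of_eq_of_le (ENNReal.tsum_eq_zero.2 fun y => ?_) zero_le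
      by_cases hxy : (within (T n) l).Reachable x y
      · have hy : y ∉ l := fun hy => hx (mem_of_within_reachable hxy.symm hy)
        rw [ENNReal.tsum_eq_zero.2 fun z => ind_neg fun h => hy h.2.1, mul_zero]
      · rw [ind_neg hxy, zero_mul]
  have hne : ∫⁻ x, 2 * ind (x ∈ l) ∂μ ≠ ⊤ := by
    refine ne_top_of_le_ne_top (b := ∫⁻ _, 2 ∂μ) ?_
      (lintegral_mono fun x => mul_le_of_le_one_right zero_le (ind_le_one _))
    rw [lintegral_const]
    exact ENNReal.mul_ne_top (by norm_num) (measure_ne_top _ _)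
  have hdeg := hG.ae_reachable (ae_eq_of_ae_le_of_lintegral_le (ae_of_all μ hge) hne
    hdm.aemeasurable hint)
  filter_upwards [hdeg] with x hx y hy hxy
  have h2 := hx y hxy
  have h1 : {z | (within U l).Adj y z}.Finite :=
    (hG.finite_neighborSet y).subset fun z hz => hLle hz
  rw [ind_pos hy, mul_one, tsum_ind_eq_ncard (fun z => (within U l).Adj y z) h1] at h2
  have h3 : {z | (within U l).Adj y z}.ncard = 2 := by exact_mod_cast h2.symm
  obtain ⟨a, b, hab, h⟩ := Set.ncard_eq_two.1 h3
  refine ⟨a, b, hab, fun z => ?_⟩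
  have : z ∈ {z | (within U l).Adj y z} ↔ z ∈ ({a, b} : Set X) := by rw [h]
  simpa using this

end Sections

section Crossing

variable {V : Type*}

theorem exists_adj_of_reachable {H : SimpleGraph V} {a b : V} {P : V → Prop} (ha : P a)
    (hb : ¬P b) (h : H.Reachable a b) :
    ∃ u v, H.Reachable a u ∧ H.Adj u v ∧ P u ∧ ¬P v := by
  by_contra! hcon
  exact hb (reachable_induction (P := P) ha (fun u v hau hu huv => hcon u v hau huv hu) h)

/-- In a one-ended graph with a line, onto which all vertices are projected with finite fibres,
every vertex of the line is jumped over by an edge. -/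
theorem OneEndedAt.exists_crossing {G : SimpleGraph V} {γ : ℤ → V} (hend : OneEndedAt G (γ 0))
    (hinj : Function.Injective γ) (hadj : ∀ i, G.Adj (γ i) (γ (i + 1))) {π : V → V}
    (hπγ : ∀ i, π (γ i) = γ i) (hπ : ∀ x, G.Reachable (γ 0) x → ∃ i, π x = γ i)
    (hfin : ∀ i, {y | π y = γ i}.Finite) (s : ℤ) (N : ℕ) :
    ∃ u v l r, G.Adj u v ∧ π u = γ l ∧ π v = γ r ∧ l + N < s ∧ s + N < r := by
  -- removing the fibres of the middle segment does not separate the two ends of the line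
  let K : Set V := {y | ∃ t ∈ Set.Icc (s - N) (s + N), π y = γ t}
  have hK : K.Finite := by
    refine ((Set.finite_Icc (s - N) (s + N)).biUnion fun t _ => hfin t).subset ?_
    rintro y ⟨t, ht, hy⟩
    exact Set.mem_biUnion ht hy
  have hKγ : ∀ t : ℤ, t < s - N ∨ s + N < t → γ t ∈ Kᶜ := by
    rintro t ht ⟨t', ht', h⟩
    rw [hπγ] at h
    have := hinj h
    simp only [Set.mem_Icc] at ht'
    omega
  have hpos : ∀ n : ℕ, (within G Kᶜ).Reachable (γ (s + N + 1)) (γ (s + N + 1 + n)) := by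
    intro n
    induction n with
    | zero => simp
    | succ n ih =>
      refine ih.trans (SimpleGraph.Adj.reachable ⟨?_, hKγ _ (by omega), hKγ _ (by push_cast; omega)⟩)
      have := hadj (s + N + 1 + n)
      push_cast
      rwa [← add_assoc]
  have hneg : ∀ n : ℕ, (within G Kᶜ).Reachable (γ (s - N - 1)) (γ (s - N - 1 - n)) := by
    intro n
    induction n with
    | zero => simp
    | succ n ih =>
      refine ih.trans (SimpleGraph.Adj.reachable ⟨?_, hKγ _ (by omega), hKγ _ (by push_cast; omega)⟩)
      have := hadj (s - N - 1 - n - 1)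
      rw [sub_add_cancel] at this
      push_cast
      rw [← sub_sub]
      exact this.symm
  have hline : ∀ n : ℕ, ∀ t : ℤ, G.Reachable (γ t) (γ (t + n)) := by
    intro n t
    induction n with
    | zero => simp
    | succ n ih =>
      have := hadj (t + n)
      push_cast
      rw [← add_assoc]
      exact ih.trans this.reachable
  have hline' : ∀ t, G.Reachable (γ 0) (γ t) := by
    intro t
    rcases le_total 0 t with ht | ht
    · have := hline t.toNat 0
      rwa [Int.toNat_of_nonneg ht, zero_add] at this
    · have := hline (-t).toNat t
      rw [Int.toNat_of_nonneg (by omega), add_neg_cancel] at this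
      exact this.symm
  have hreach := hend.reachable K hK (γ (s - N - 1)) (γ (s + N + 1))
    (hline' _) (hline' _)
    ((Set.infinite_range_of_injective (f := fun n : ℕ => γ (s - N - 1 - n)) (fun m n h => by
      have := hinj h; omega)).mono (by rintro _ ⟨n, rfl⟩; exact hneg n))
    ((Set.infinite_range_of_injective (f := fun n : ℕ => γ (s + N + 1 + n)) (fun m n h => by
      have := hinj h; omega)).mono (by rintro _ ⟨n, rfl⟩; exact hpos n))
  obtain ⟨u, v, hu, huv, ⟨l, hl, hul⟩, hv⟩ := exists_adj_of_reachable
    (P := fun y => ∃ l : ℤ, l < s - N ∧ π y = γ l) ⟨s - N - 1, by omega, hπγ _⟩ (by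
      rintro ⟨l, hl, h⟩
      rw [hπγ] at h
      have := hinj h
      omega) hreach
  obtain ⟨r, hr⟩ := hπ v ((hline' _).trans ((hu.trans huv.reachable).mono (within_le _ _)))
  refine ⟨u, v, l, r, huv.1, hul, hr, by omega, ?_⟩
  by_contra hcon
  by_cases h : r < s - N
  · exact hv ⟨r, h, hr⟩
  · exact huv.2.2 ⟨r, ⟨by omega, by omega⟩, hr⟩

/-- In a graph that consists of lines, walks are at least as long as the distance of the parameters of
their ends. -/
theorem abs_sub_le_walk_length {L : SimpleGraph V} {γ : ℤ → V}
    (hL : ∀ i z, L.Adj (γ i) z → z = γ (i + 1) ∨ z = γ (i - 1)) {x y : V} (w : L.Walk x y) :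
    ∀ i, x = γ i → ∃ j, y = γ j ∧ |i - j| ≤ w.length := by
  induction w with
  | nil => intro i hi; exact ⟨i, hi, by simp⟩
  | cons h w ih =>
    rintro i rfl
    rw [SimpleGraph.Walk.length_cons]
    rcases hL i _ h with h' | h'
    · obtain ⟨j, hj, hij⟩ := ih _ h'
      refine ⟨j, hj, ?_⟩
      rw [abs_le] at hij ⊢
      push_cast
      omega
    · obtain ⟨j, hj, hij⟩ := ih _ h'
      refine ⟨j, hj, ?_⟩
      rw [abs_le] at hij ⊢
      push_cast
      omega

theorem exists_walk_line {K : SimpleGraph V} {γ : ℤ → V} (a : ℤ) (n : ℕ)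
    (h : ∀ i, a ≤ i → i < a + n → K.Adj (γ i) (γ (i + 1))) :
    ∃ w : K.Walk (γ a) (γ (a + n)), w.length = n := by
  induction n with
  | zero => exact ⟨(SimpleGraph.Walk.nil : K.Walk (γ a) (γ a)).copy rfl (by simp), by simp⟩
  | succ n ih =>
    obtain ⟨w, hw⟩ := ih fun i h1 h2 => h i h1 (by push_cast; omega)
    have h1 := h (a + n) (by omega) (by push_cast; omega)
    exact ⟨(w.concat h1).copy rfl (by push_cast; ring_nf), by simp [hw]⟩

/-- A connected subgraph of a line is a segment. -/
theorem reachable_segment {K : SimpleGraph V} {γ : ℤ → V}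
    (hK : ∀ i z, K.Adj (γ i) z → z = γ (i + 1) ∨ z = γ (i - 1)) (hinj : Function.Injective γ)
    {a b : ℤ} (h : K.Reachable (γ a) (γ b)) :
    ∀ c, min a b ≤ c → c ≤ max a b → K.Reachable (γ a) (γ c) := by
  have h1 := reachable_induction (P := fun y => ∃ t, y = γ t ∧
    ∀ c, min a t ≤ c → c ≤ max a t → K.Reachable (γ a) (γ c)) ⟨a, rfl, fun c h1 h2 => by
      have : c = a := by omega
      rw [this]⟩ ?_ h
  · obtain ⟨t, ht, h⟩ := h1
    rw [hinj ht]
    exact h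
  · rintro _ v hu ⟨t, rfl, ih⟩ huv
    have hv := hu.trans huv.reachable
    rcases hK t v huv with rfl | rfl
    · refine ⟨t + 1, rfl, fun c h1 h2 => ?_⟩
      by_cases hc : c = t + 1
      · rw [hc]; exact hv
      · exact ih c (by omega) (by omega)
    · refine ⟨t - 1, rfl, fun c h1 h2 => ?_⟩
      by_cases hc : c = t - 1
      · rw [hc]; exact hv
      · exact ih c (by omega) (by omega)

end Crossing

/-! ### Shortcuts in terms of projections -/

section ShortcutSet

variable {V : Type*}

theorem reachable_iterate {G : SimpleGraph V} {p : V → V} (hp : ∀ x, p x = x ∨ G.Adj x (p x))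
    (x : V) (k : ℕ) : G.Reachable x (p^[k] x) := by
  induction k with
  | zero => exact SimpleGraph.Reachable.refl _
  | succ k ih =>
    rw [Function.iterate_succ_apply']
    rcases hp (p^[k] x) with h | h
    · rwa [h]
    · exact ih.trans h.reachable

theorem iterate_invariant {p : V → V} {β : Type*} {π : V → β} (hπ : ∀ x, π (p x) = π x) (x : V)
    (k : ℕ) : π (p^[k] x) = π x := by
  induction k with
  | zero => rfl
  | succ k ih => rw [Function.iterate_succ_apply', hπ, ih]

/-- The fibres of the projection along a parent function are connected. -/
theorem within_fiber_reachable {G : SimpleGraph V} {p π : V → V}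
    (hp : ∀ x, p x = x ∨ G.Adj x (p x)) (hpk : ∀ x, ∃ k, p^[k] x = π x)
    (hπ : ∀ x, π (p x) = π x) (y : V) :
    (within G {z | π z = π y}).Reachable y (π y) := by
  obtain ⟨k, hk⟩ := hpk y
  suffices h : (within G {z | π z = π y}).Reachable y (p^[k] y) by rwa [hk] at h
  clear hk
  induction k with
  | zero => exact SimpleGraph.Reachable.refl _
  | succ k ih =>
    rw [Function.iterate_succ_apply']
    rcases hp (p^[k] y) with h | h
    · rwa [h]
    · refine ih.trans (SimpleGraph.Adj.reachable ⟨h, iterate_invariant hπ y k, ?_⟩)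
      exact (hπ _).trans (iterate_invariant hπ y k)

/-- The edge `u v` jumps over `i`: in the forest of lines `L`, the vertex `i` lies between `π u`
and `π v`, at distance more than `N` from both, and the subforest `K` contains the path from
`π u` to `π v`. -/
def JumpsOver (G L K : SimpleGraph V) (π : V → V) (N : ℕ) (i u v : V) : Prop :=
  G.Adj u v ∧ ∃ k m, N < k ∧ N < m ∧ (∃ w : K.Walk (π u) i, w.length = k) ∧
    (∃ w : K.Walk i (π v), w.length = m) ∧ ∀ j < k + m, ¬∃ w : L.Walk (π u) (π v), w.length = j

/-- The shortcuts of `exists_connected_shortcut` for one component of the subforest `K` of lines, stated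
without a parametrization of the line. The set contains all vertices at which a line leaves the
component. -/
theorem exists_shortcut_set {G L K : SimpleGraph V} (hKL : K ≤ L) (hLG : L ≤ G) {γ : ℤ → V}
    (hinj : Function.Injective γ) (hLγ : ∀ i z, L.Adj (γ i) z ↔ z = γ (i + 1) ∨ z = γ (i - 1))
    {π : V → V} (hπ : ∀ i, π (γ i) = γ i) (hfib : ∀ i, {y | π y = γ i}.Finite)
    (hconn : ∀ y i, π y = γ i → (within G {y | π y = γ i}).Reachable y (γ i)) (N R : ℕ) (s₀ : ℤ)
    (hfin : {y | K.Reachable (γ s₀) y}.Finite) :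
    ∃ S : Set V, S ⊆ {y | K.Reachable (γ s₀) (π y)} ∧
      (∀ i z, K.Reachable (γ s₀) i → L.Adj i z → ¬K.Reachable (γ s₀) z → i ∈ S) ∧
      (∀ y ∈ S, ∀ z ∈ S, (within G S).Reachable y z) ∧
      N * (5 * S.ncard + {i | K.Reachable (γ s₀) i ∧ ∃ u v, JumpsOver G L K π N i u v}.ncard) ≤
        (5 * N + 6 + 10 * R) * {y | K.Reachable (γ s₀) y}.ncard +
        5 * N * {y | K.Reachable (γ s₀) (π y) ∧ R < {z | π z = π y}.ncard}.ncard := by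
  classical
  have hLγ' : ∀ i z, L.Adj (γ i) z → z = γ (i + 1) ∨ z = γ (i - 1) := fun i z => (hLγ i z).1
  have hKγ : ∀ i z, K.Adj (γ i) z → z = γ (i + 1) ∨ z = γ (i - 1) := fun i z h => hLγ' i z (hKL h)
  have hmem : ∀ y, K.Reachable (γ s₀) y → ∃ t, y = γ t := fun y ⟨w⟩ => by
    obtain ⟨t, ht, -⟩ := abs_sub_le_walk_length hKγ w s₀ rfl
    exact ⟨t, ht⟩
  have hAfin : {t | K.Reachable (γ s₀) (γ t)}.Finite := by
    have h := Set.Finite.preimage (f := γ) (s := {y | K.Reachable (γ s₀) y}) hinj.injOn hfin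
    exact h
  have hA0 : hAfin.toFinset.Nonempty := ⟨s₀, by simp⟩
  set a := hAfin.toFinset.min' hA0 with ha
  set b := hAfin.toFinset.max' hA0 with hb
  have haA : K.Reachable (γ s₀) (γ a) := by
    simpa using hAfin.toFinset.min'_mem hA0
  have hbA : K.Reachable (γ s₀) (γ b) := by
    simpa using hAfin.toFinset.max'_mem hA0
  have hab : a ≤ b := Finset.min'_le _ _ (Finset.max'_mem _ _)
  have hA : ∀ t, K.Reachable (γ s₀) (γ t) ↔ t ∈ Set.Icc a b := by
    intro t
    constructor
    · intro h
      exact ⟨Finset.min'_le _ _ (by simpa using h), Finset.le_max' _ _ (by simpa using h)⟩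
    · intro h
      refine haA.trans (reachable_segment hKγ hinj (haA.symm.trans hbA) t ?_ ?_)
      · rw [min_eq_left hab]; exact h.1
      · rw [max_eq_right hab]; exact h.2
  let C : Finset ℤ := (Finset.Icc a b).filter fun t => ∃ u v, JumpsOver G L K π N (γ t) u v
  have hadj : ∀ i, G.Adj (γ i) (γ (i + 1)) := fun i => hLG ((hLγ i _).2 (Or.inl rfl))
  obtain ⟨S, hS, haS, hbS, hSc, hcount⟩ := exists_connected_shortcut hadj hπ hfib hconn N R a b hab
    C (by
      intro s hs
      obtain ⟨u, v, huv, k, m, hk, hm, ⟨w, hw⟩, ⟨w', hw'⟩, hno⟩ := (Finset.mem_filter.1 hs).2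
      have hsA : K.Reachable (γ s₀) (γ s) := by
        rw [hA]; simpa using (Finset.mem_filter.1 hs).1
      obtain ⟨l, hl⟩ := hmem (π u) (hsA.trans w.reachable.symm)
      obtain ⟨r, hr⟩ := hmem (π v) (hsA.trans w'.reachable)
      have hl' := hsA.trans w.reachable.symm
      have hr' := hsA.trans w'.reachable
      rw [hl, hA] at hl'
      rw [hr, hA] at hr'
      obtain ⟨s', hs', h1⟩ := abs_sub_le_walk_length hKγ w l hl
      obtain ⟨r', hr'', h2⟩ := abs_sub_le_walk_length hKγ w' s rfl
      rw [← hinj hs'] at h1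
      rw [hr] at hr''
      rw [← hinj hr''] at h2
      have h3 : (k + m : ℤ) ≤ |l - r| := by
        by_contra! hlt
        rcases le_total l r with hlr | hlr
        · obtain ⟨q, hq⟩ := exists_walk_line (K := L) (γ := γ) l (r - l).toNat
            (fun i _ _ => (hLγ i _).2 (Or.inl rfl))
          rw [abs_of_nonpos (by omega)] at hlt
          have h4 : γ (l + (r - l).toNat) = π v := by
            rw [hr, Int.toNat_of_nonneg (by omega), add_sub_cancel]
          exact hno (r - l).toNat (by omega) ⟨q.copy hl.symm h4, by simpa using hq⟩
        · obtain ⟨q, hq⟩ := exists_walk_line (K := L) (γ := γ) r (l - r).toNat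
            (fun i _ _ => (hLγ i _).2 (Or.inl rfl))
          rw [abs_of_nonneg (by omega)] at hlt
          have h4 : γ (r + (l - r).toNat) = π u := by
            rw [hl, Int.toNat_of_nonneg (by omega), add_sub_cancel]
          exact hno (l - r).toNat (by omega) ⟨q.reverse.copy h4 hr.symm, by simpa using hq⟩
      rw [hw, abs_le] at h1
      rw [hw', abs_le] at h2
      rcases le_abs.1 h3 with h3 | h3
      · exact ⟨v, u, r, l, huv.symm, hr, hl, hr'.1, hl'.2, by omega, by omega⟩
      · exact ⟨u, v, l, r, huv, hl, hr, hl'.1, hr'.2, by omega, by omega⟩)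
  refine ⟨S, ?_, ?_, hSc, ?_⟩
  · intro y hy
    obtain ⟨t, ht, hyt⟩ := hS hy
    change K.Reachable (γ s₀) (π y)
    rw [hyt, hA]
    exact ht
  · intro i z hi hiz hz
    obtain ⟨t, rfl⟩ := hmem i hi
    rw [hA, Set.mem_Icc] at hi
    rcases hLγ' t z hiz with rfl | rfl
    · rw [hA, Set.mem_Icc] at hz
      have : t = b := by omega
      rwa [this]
    · rw [hA, Set.mem_Icc] at hz
      have : t = a := by omega
      rwa [this]
  · have h1 : {i | K.Reachable (γ s₀) i ∧ ∃ u v, JumpsOver G L K π N i u v} = γ '' (C : Set ℤ) := by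
      ext i
      constructor
      · rintro ⟨hi, h⟩
        obtain ⟨t, rfl⟩ := hmem i hi
        refine ⟨t, ?_, rfl⟩
        rw [hA] at hi
        simpa [C] using And.intro hi h
      · rintro ⟨t, ht, rfl⟩
        have ht' : (a ≤ t ∧ t ≤ b) ∧ ∃ u v, JumpsOver G L K π N (γ t) u v := by simpa [C] using ht
        exact ⟨(hA t).2 ht'.1, ht'.2⟩
    have h2 : {y | K.Reachable (γ s₀) y} = γ '' Set.Icc a b := by
      ext y
      constructor
      · intro hy
        obtain ⟨t, rfl⟩ := hmem y hy
        exact ⟨t, (hA t).1 hy, rfl⟩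
      · rintro ⟨t, ht, rfl⟩
        exact (hA t).2 ht
    have h3 : {y | K.Reachable (γ s₀) (π y) ∧ R < {z | π z = π y}.ncard} =
        {y | ∃ t ∈ Set.Icc a b, π y = γ t ∧ R < {z | π z = γ t}.ncard} := by
      ext y
      constructor
      · rintro ⟨hy, h⟩
        obtain ⟨t, ht⟩ := hmem (π y) hy
        rw [ht] at h hy
        exact ⟨t, (hA t).1 hy, ht, h⟩
      · rintro ⟨t, ht, hy, h⟩
        refine ⟨?_, ?_⟩
        · rw [hy, hA]; exact ht
        · rw [hy]; exact h
    rw [h1, h2, h3, Set.ncard_image_of_injective _ hinj, Set.ncard_image_of_injective _ hinj,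
      Set.ncard_coe_finset]
    have h4 : (Set.Icc a b).ncard = (b + 1 - a).toNat := by
      rw [← Finset.coe_Icc, Set.ncard_coe_finset, Int.card_Icc]
    rw [h4]
    exact hcount

end ShortcutSet

/-! ### Borel shortcuts -/

section Shortening

variable {X : Type*} [MeasurableSpace X]

/-- A Borel parent function `p` that moves every vertex along an edge towards `Y`, if `Y` can
be reached, and the vertex `π x` at which `x` arrives. -/
structure IsParent (G : SimpleGraph X) (Y : Set X) (p π : X → X) : Prop where
  measurable_parent : Measurable p
  measurable_proj : Measurable π
  eq_self : ∀ x ∈ Y, p x = x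
  eq_or_adj : ∀ x, p x = x ∨ G.Adj x (p x)
  exists_iterate : ∀ x, ∃ k, p^[k] x = π x
  proj_parent : ∀ x, π (p x) = π x
  proj_mem : ∀ x, (∃ y ∈ Y, G.Reachable x y) → π x ∈ Y

variable {G : SimpleGraph X} {Y : Set X} {p π : X → X}

theorem IsParent.reachable (h : IsParent G Y p π) (x : X) : G.Reachable x (π x) := by
  obtain ⟨k, hk⟩ := h.exists_iterate x
  rw [← hk]
  exact reachable_iterate h.eq_or_adj x k

theorem IsParent.proj_eq_self (h : IsParent G Y p π) {x : X} (hx : x ∈ Y) : π x = x := by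
  obtain ⟨k, hk⟩ := h.exists_iterate x
  rw [← hk]
  exact Function.iterate_fixed (h.eq_self x hx) k

/-- The graph with the edges of `K` and the edges from vertices to their parents. -/
def parentGraph (p : X → X) (K : SimpleGraph X) : SimpleGraph X where
  Adj x y := x ≠ y ∧ (p x = y ∨ p y = x ∨ K.Adj x y)
  symm := ⟨fun _ _ h => ⟨h.1.symm, by
    rcases h.2 with h | h | h
    exacts [Or.inr (Or.inl h), Or.inl h, Or.inr (Or.inr h.symm)]⟩⟩
  loopless := ⟨fun _ h => h.1 rfl⟩

theorem IsParent.parentGraph_le (h : IsParent G Y p π) {K : SimpleGraph X} (hK : K ≤ G) :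
    parentGraph p K ≤ G := by
  rintro x y ⟨hne, rfl | rfl | hxy⟩
  · exact (h.eq_or_adj x).resolve_left hne.symm
  · exact ((h.eq_or_adj y).resolve_left hne).symm
  · exact hK hxy

/-- The components of `parentGraph p K` are the preimages under `π` of the components of `K`. -/
theorem IsParent.parentGraph_reachable (h : IsParent G Y p π) {K : SimpleGraph X}
    (hK : ∀ a b, K.Adj a b → a ∈ Y) (x y : X) :
    (parentGraph p K).Reachable x y ↔ K.Reachable (π x) (π y) := by
  constructor
  · intro hxy
    refine reachable_induction (P := fun y => K.Reachable (π x) (π y))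
      (SimpleGraph.Reachable.refl _) ?_ hxy
    rintro u v - hu ⟨-, rfl | rfl | huv⟩
    · rwa [h.proj_parent]
    · rwa [h.proj_parent] at hu
    · refine hu.trans ?_
      rw [h.proj_eq_self (hK _ _ huv), h.proj_eq_self (hK _ _ huv.symm)]
      exact huv.reachable
  · intro hxy
    have h1 : ∀ z, (parentGraph p K).Reachable z (π z) := by
      intro z
      obtain ⟨k, hk⟩ := h.exists_iterate z
      rw [← hk]
      refine reachable_iterate (fun x => ?_) z k
      by_cases hx : p x = x
      · exact Or.inl hx
      · exact Or.inr ⟨Ne.symm hx, Or.inl rfl⟩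
    refine ((h1 x).trans (hxy.mono ?_)).trans (h1 y).symm
    exact fun a b hab => ⟨hab.ne, Or.inr (Or.inr hab)⟩

theorem lintegral_mul_ind {μ : Measure X} {S : Set X} (hS : MeasurableSet S) (c : ℝ≥0∞) :
    ∫⁻ x, c * ind (x ∈ S) ∂μ = c * μ S := by
  have hm : Measurable fun x => ind (x ∈ S) := measurable_ind (measurableSet_setOfPred.1 hS)
  rw [lintegral_const_mul _ hm]
  congr 1
  have : (fun x => ind (x ∈ S)) = S.indicator 1 := by
    ext x
    by_cases hx : x ∈ S <;> simp [ind, hx]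
  rw [this, lintegral_indicator_one hS]

variable {μ : Measure X}

/-- The line of the core in a component is parametrized by the integers. -/
theorem IsLineCore.ae_exists_line {P : ℕ → Set X} {L : SimpleGraph X} {K : ℕ → SimpleGraph X}
    (hc : IsLineCore G μ P L K) : ∀ᵐ x ∂μ, ∀ i ∈ ⋂ j, P j, G.Reachable x i →
      ∃ γ : ℤ → X, Function.Injective γ ∧ γ 0 = i ∧
        (∀ i z, L.Adj (γ i) z ↔ z = γ (i + 1) ∨ z = γ (i - 1)) ∧
        ∀ y, L.Reachable i y ↔ ∃ i, γ i = y := by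
  filter_upwards [hc.ae_adj] with x hx i hi hxi
  obtain ⟨γ, h1, h2, h3⟩ := exists_line_parametrization hc.isAcyclic i (fun y hy =>
    hx y (reachable_induction (P := fun y => y ∈ ⋂ j, P j) hi (fun u v _ _ huv => (hc.le huv).2.2) hy)
      (hxi.trans (hy.mono (hc.le.trans (within_le _ _)))))
  obtain ⟨t, ht⟩ := (h3 i).1 (SimpleGraph.Reachable.refl _)
  refine ⟨fun s => γ (s + t), fun a b h => by have := h1 h; omega, by simpa using ht,
    fun s z => by rw [h2]; ring_nf, fun y => ?_⟩
  rw [h3]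
  exact ⟨fun ⟨s, hs⟩ => ⟨s - t, by simpa using hs⟩, fun ⟨s, hs⟩ => ⟨s + t, hs⟩⟩

variable [StandardBorelSpace X] {e : ℕ → X → X}

theorem measurable_parentGraph (hp : Measurable p) {K : SimpleGraph X}
    (hK : Measurable fun q : X × X => K.Adj q.1 q.2) :
    Measurable fun q : X × X => (parentGraph p K).Adj q.1 q.2 :=
  (measurable_eq_of_measurable measurable_fst measurable_snd).not.and
    ((measurable_eq_of_measurable (hp.comp measurable_fst) measurable_snd).or
      ((measurable_eq_of_measurable (hp.comp measurable_snd) measurable_fst).or hK))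

theorem IsEnum.measurable_jumpsOver (he : IsEnum G e) (hp : IsParent G Y p π)
    {L K : SimpleGraph X} (hL : L ≤ G) (hK : K ≤ G)
    (hGm : Measurable fun q : X × X => G.Adj q.1 q.2)
    (hLm : Measurable fun q : X × X => L.Adj q.1 q.2)
    (hKm : Measurable fun q : X × X => K.Adj q.1 q.2) (N : ℕ) :
    Measurable fun i => ∃ u v, JumpsOver G L K π N i u v := by
  have hw : ∀ {S : SimpleGraph X}, S ≤ G → (Measurable fun q : X × X => S.Adj q.1 q.2) → ∀ n,
      Measurable fun q : X × X => ∃ w : S.Walk q.1 q.2, w.length = n := by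
    intro S hS hSm n
    exact (he.measurable_walk (α := Unit) (H := fun _ => S) (fun _ => hS)
      (hSm.comp (f := fun p : Unit × X × X => p.2) (by fun_prop)) n).comp
      (f := fun p : X × X => ((), p)) (by fun_prop)
  have hπ := hp.measurable_proj
  refine he.measurable_exists (π := id) measurable_id ?_ ?_
  swap
  · rintro i u ⟨v, -, k, m, -, -, ⟨w, -⟩, -⟩
    exact (w.reachable.mono hK).symm.trans (hp.reachable u).symm
  refine he.measurable_exists (π := fun q : X × X => q.2) measurable_snd ?_
    (fun q v h => h.1.reachable)
  unfold JumpsOver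
  refine (hGm.comp (f := fun q : (X × X) × X => (q.1.2, q.2)) (by fun_prop)).and ?_
  refine Measurable.exists fun k => Measurable.exists fun m => measurable_const.and
    (measurable_const.and (Measurable.and ?_ (Measurable.and ?_ ?_)))
  · exact (hw hK hKm k).comp (f := fun q : (X × X) × X => (π q.1.2, q.1.1)) (by fun_prop)
  · exact (hw hK hKm m).comp (f := fun q : (X × X) × X => (q.1.1, π q.2)) (by fun_prop)
  · refine Measurable.forall fun j => Measurable.imp measurable_const (Measurable.not ?_)
    exact (hw hL hLm j).comp (f := fun q : (X × X) × X => (π q.1.2, π q.2)) (by fun_prop)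

/-- The vertices that lie in large fibres of the projection `π`. -/
def largeFibers (π : X → X) (R : ℕ) : Set X := {y | (R : ℝ≥0∞) < ∑' z, ind (π z = π y)}

theorem IsTame.measurableSet_largeFibers (hG : IsTame G μ e) (hp : IsParent G Y p π) (R : ℕ) :
    MeasurableSet (largeFibers π R) :=
  measurableSet_lt measurable_const
    ((hG.measurable_fiber_tsum hp.measurable_proj hp.reachable).comp hp.measurable_proj)

variable [IsFiniteMeasure μ]

/-- The core of lines of a section, shortened by the selection of shortcuts in each of the finite
components of `K n`. -/
theorem IsLineCore.exists_shortened (hG : IsTame G μ e) {P : ℕ → Set X}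
    {L : SimpleGraph X} {K : ℕ → SimpleGraph X} (hc : IsLineCore G μ P L K)
    (hp : IsParent G (⋂ j, P j) p π) (N R n : ℕ) :
    ∃ S : Set X, MeasurableSet S ∧ (∀ y ∈ S, ∃ z ∈ ⋂ j, P j, G.Reachable y z) ∧
      (∀ᵐ x ∂μ, (∃ z ∈ ⋂ j, P j, G.Reachable x z) → (∃ y ∈ S, G.Reachable x y) ∧
        ∀ y ∈ S, ∀ z ∈ S, G.Reachable x y → G.Reachable x z → (within G S).Reachable y z) ∧
      N * (5 * μ S + μ {i | ∃ u v, JumpsOver G L (K n) π N i u v}) ≤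
        (5 * N + 6 + 10 * R) * μ (⋂ j, P j) + 5 * N * μ (largeFibers π R) := by
  set l := ⋂ j, P j with hl
  have hlm : MeasurableSet l := MeasurableSet.iInter fun j => (hc.isSection j).measurableSet
  have hLl : ∀ a b, L.Adj a b → a ∈ l := fun a b h => (hc.le h).2.1
  have hLG : L ≤ G := fun a b h => (hc.le h).1
  have hKL : K n ≤ L := hc.exhaustion.le n
  have hKG : K n ≤ G := hKL.trans hLG
  have hKl : ∀ a b, (K n).Adj a b → a ∈ l := fun a b h => hLl a b (hKL h)
  have hKm := hc.exhaustion.measurable_adj n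
  set Γ := parentGraph p (K n) with hΓ
  have hΓG : Γ ≤ G := hp.parentGraph_le hKG
  have hΓm : Measurable fun q : X × X => Γ.Adj q.1 q.2 :=
    measurable_parentGraph hp.measurable_parent hKm
  have hΓr : ∀ x y, Γ.Reachable x y ↔ (K n).Reachable (π x) (π y) := hp.parentGraph_reachable hKl
  have hΓR := hG.measurable_reachable_of_le hΓG hΓm
  have hKmem : ∀ x y, (K n).Reachable x y → x ∈ l → y ∈ l := fun x y h hx =>
    reachable_induction (P := fun y => y ∈ l) hx (fun u v _ _ huv => hKl v u huv.symm) h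
  set Cov : Set X := {i | ∃ u v, JumpsOver G L (K n) π N i u v} with hCov
  have hCovm : MeasurableSet Cov := measurableSet_setOfPred.2
    (hG.measurable_jumpsOver hp hLG hKG hG.measurable_adj hc.measurable_adj hKm N)
  have hCovl : Cov ⊆ l := by
    rintro i ⟨u, v, -, k, m, hk, -, ⟨w, hw⟩, -⟩
    by_contra hi
    have h1 : i = π u := by
      by_contra hne
      obtain ⟨a, b, -, hab, ha, hb⟩ := exists_adj_of_reachable (P := fun y => y = i) rfl
        (fun h => hne h.symm) w.reachable.symm
      subst ha
      exact hi (hKl _ _ hab)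
    subst h1
    cases w with
    | nil => simp at hw; omega
    | cons h _ => exact hi (hKl _ _ h)
  have hBm := hG.measurableSet_largeFibers hp R
  set B := largeFibers π R with hB
  -- almost every component is good
  have hfib := hG.ae_reachable (hG.ae_finite_fiber hp.measurable_proj hp.reachable)
  have hΓfin : ∀ᵐ x ∂μ, {y | Γ.Reachable x y}.Finite := by
    filter_upwards [hfib] with x hx
    refine ((hc.exhaustion.finite n (π x)).biUnion (t := fun z => {y | π y = z}) fun z hz =>
      hx z ((hp.reachable x).trans (hz.mono hKG))).subset fun y hy => ?_
    exact Set.mem_biUnion (x := π y) ((hΓr x y).1 hy) rfl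
  -- `Z x θ` is the set that `θ` marks on the `Γ`-component of `x`; by `Q` it contains the ends of the
  -- piece of the line, is connected, and is short
  let Z : X → (X → X → ℤ) → Set X := fun x θ => {y | Γ.Reachable x y ∧ θ y y ≠ 0}
  let Q : X → (X → X → ℤ) → Prop := fun x θ =>
    (∀ i, ∀ z, Γ.Reachable x i → L.Adj i z → ¬Γ.Reachable x z → i ∈ Z x θ) ∧
    (∀ y, ∀ z, y ∈ Z x θ → z ∈ Z x θ → (within G (Z x θ)).Reachable y z) ∧
    N * (5 * ∑' y, ind (y ∈ Z x θ) + ∑' i, ind (Γ.Reachable x i ∧ i ∈ Cov)) ≤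
      (5 * N + 6 + 10 * R) * ∑' y, ind (Γ.Reachable x y ∧ y ∈ l) +
        5 * N * ∑' y, ind (Γ.Reachable x y ∧ y ∈ B)
  have hQm : ∀ θ : X → X → ℤ, (Measurable fun p : X × X => θ p.1 p.2) →
      Measurable fun x => Q x θ := by
    intro θ hθ
    have hZ : Measurable fun q : X × X => q.2 ∈ Z q.1 θ := by
      refine hΓR.and (Measurable.not ?_)
      have h1 : Measurable fun q : X × X => θ q.2 q.2 :=
        hθ.comp (f := fun q : X × X => (q.2, q.2)) (by fun_prop)
      exact measurableSet_setOfPred.1 (h1 (measurableSet_singleton 0))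
    have hset : ∀ {D : Set X}, MeasurableSet D →
        Measurable fun x => ∑' y, ind (Γ.Reachable x y ∧ y ∈ D) := by
      intro D hD
      exact hG.measurable_tsum (π := id) measurable_id
        (measurable_ind (hΓR.and (measurableSet_setOfPred.1 (measurable_snd hD))))
        (fun x y h => (ind_ne_zero.1 h).1.mono hΓG)
    refine Measurable.and ?_ (Measurable.and ?_ ?_)
    · refine hG.measurable_forall (π := id) measurable_id ?_ ?_
      · refine hG.measurable_forall (π := fun q : X × X => q.2) measurable_snd ?_ ?_
        · refine (hΓR.comp measurable_fst).imp (Measurable.imp ?_ (Measurable.imp ?_ ?_))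
          · exact hc.measurable_adj.comp (f := fun q : (X × X) × X => (q.1.2, q.2)) (by fun_prop)
          · exact (hΓR.comp (f := fun q : (X × X) × X => (q.1.1, q.2)) (by fun_prop)).not
          · exact hZ.comp measurable_fst
        · intro q z h
          push Not at h
          exact (hLG h.2.1).reachable
      · intro x i h
        push Not at h
        obtain ⟨z, h, -⟩ := h
        exact h.mono hΓG
    · refine hG.measurable_forall (π := id) measurable_id ?_ ?_
      · refine hG.measurable_forall (π := fun q : X × X => q.1) measurable_fst ?_ ?_
        · refine (hZ.comp measurable_fst).imp (Measurable.imp ?_ ?_)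
          · exact hZ.comp (f := fun q : (X × X) × X => (q.1.1, q.2)) (by fun_prop)
          · have h1 := hG.measurable_reachable_param (H := fun x => within G (Z x θ))
              (fun x => within_le _ _) (measurable_within (H := fun _ : X => G)
                (S := fun x => Z x θ) (hG.measurable_adj.comp (f := fun q : X × X × X => q.2) (by fun_prop)) hZ)
            exact h1.comp (f := fun q : (X × X) × X => (q.1.1, q.1.2, q.2)) (by fun_prop)
        · intro q z h
          push Not at h
          exact h.2.1.1.mono hΓG
      · intro x y h
        push Not at h
        obtain ⟨z, h, -⟩ := h
        exact h.1.mono hΓG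
    · refine measurableSet_setOfPred.1 (measurableSet_le ?_ ?_)
      · refine (Measurable.add (Measurable.const_mul ?_ _) (hset hCovm)).const_mul _
        exact hG.measurable_tsum (π := id) measurable_id (measurable_ind hZ)
          (fun x y h => (ind_ne_zero.1 h).1.mono hΓG)
      · exact ((hset hlm).const_mul _).add ((hset hBm).const_mul _)
  have hQl : ∀ x θ θ', (∀ y z, Γ.Reachable x y → Γ.Reachable x z → θ y z = θ' y z) →
      Q x θ → Q x θ' := by
    intro x θ θ' h hQ
    have h1 : Z x θ = Z x θ' := by
      ext y
      refine and_congr_right fun hy => ?_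
      rw [h y y hy hy]
    simp only [Q, ← h1]
    exact hQ
  have hQi : ∀ x y θ, Γ.Reachable x y → Q x θ → Q y θ := by
    intro x y θ hxy hQ
    have h1 : Γ.Reachable x = Γ.Reachable y := by
      ext z
      exact ⟨fun h => hxy.symm.trans h, fun h => hxy.trans h⟩
    have h2 : Z x θ = Z y θ := by simp only [Z, h1]
    simp only [Q, ← h1, ← h2]
    exact hQ
  obtain ⟨θ, hθm, -, hθ⟩ := hG.exists_measurable_selection hΓG hΓm Q hQm hQl hQi
  have hlines := hc.ae_exists_line
  have hQ : ∀ᵐ x ∂μ, (∃ z ∈ l, G.Reachable x z) → Q x θ := by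
    filter_upwards [hfib, hΓfin, hlines, hc.ae_reachable] with x hx hxΓ hxl hxr hx1
    refine hθ x hxΓ ?_
    have hπl := hp.proj_mem x hx1
    obtain ⟨γ, hγ, hγ0, hγL, hγr⟩ := hxl (π x) hπl (hp.reachable x)
    have hγl : ∀ i, γ i ∈ l := fun i => hLl _ _ ((hγL i _).2 (Or.inl rfl))
    have hγG : ∀ i, G.Reachable x (γ i) := fun i =>
      (hp.reachable x).trans (((hγr _).2 ⟨i, rfl⟩).mono hLG)
    obtain ⟨S, hS, hends, hSc, hcount⟩ := exists_shortcut_set hKL hLG hγ hγL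
      (fun i => hp.proj_eq_self (hγl i)) (fun i => hx _ (hγG i))
      (fun y i hy => by
        have := within_fiber_reachable hp.eq_or_adj hp.exists_iterate hp.proj_parent y
        rwa [hy] at this) N R 0
      (hc.exhaustion.finite n _)
    rw [hγ0] at hS hends hcount
    classical
    have hZS : Z x (fun y _ => if y ∈ S then 1 else 0) = S := by
      ext y
      simp only [Z, Set.mem_ofPred_eq]
      constructor
      · rintro ⟨-, h⟩
        by_contra hy
        simp [hy] at h
      · intro hy
        exact ⟨(hΓr x y).2 (hS hy), by simp [hy]⟩
    have hRl : ∀ y ∈ l, (Γ.Reachable x y ↔ (K n).Reachable (π x) y) := fun y hy => by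
      rw [hΓr, hp.proj_eq_self hy]
    refine ⟨fun y _ => if y ∈ S then 1 else 0, ?_⟩
    simp only [Q, hZS]
    refine ⟨fun i z hi hiz hz => hends i z ((hRl i (hLl i z hiz)).1 hi) hiz
      fun h => hz ((hRl z (hLl z i hiz.symm)).2 h), fun y z hy hz => hSc y hy z hz, ?_⟩
    have e1 : {i | Γ.Reachable x i ∧ i ∈ Cov} =
        {i | (K n).Reachable (π x) i ∧ ∃ u v, JumpsOver G L (K n) π N i u v} := by
      ext i
      exact ⟨fun h => ⟨(hRl i (hCovl h.2)).1 h.1, h.2⟩, fun h => ⟨(hRl i (hCovl h.2)).2 h.1, h.2⟩⟩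
    have e2 : {y | Γ.Reachable x y ∧ y ∈ l} = {y | (K n).Reachable (π x) y} := by
      ext y
      exact ⟨fun h => (hRl y h.2).1 h.1, fun h => ⟨(hRl y (hKmem _ _ h hπl)).2 h, hKmem _ _ h hπl⟩⟩
    have e3 : {y | Γ.Reachable x y ∧ y ∈ B} =
        {y | (K n).Reachable (π x) (π y) ∧ R < {z | π z = π y}.ncard} := by
      ext y
      simp only [Set.mem_ofPred_eq, hΓr]
      refine and_congr_right fun hy => ?_
      have hyfin : {z | π z = π y}.Finite := hx _ ((hp.reachable x).trans (hy.mono hKG))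
      rw [hB, largeFibers, Set.mem_ofPred_eq, tsum_ind_eq_ncard (fun z => π z = π y) hyfin]
      exact Nat.cast_lt
    have f1 : ∀ D : Set X, {y | Γ.Reachable x y ∧ y ∈ D}.Finite := fun D =>
      hxΓ.subset fun y hy => hy.1
    have f2 : {y | y ∈ S}.Finite := hxΓ.subset fun y hy => (hΓr x y).2 (hS hy)
    rw [tsum_ind_eq_ncard _ (f1 _), tsum_ind_eq_ncard _ (f1 _), tsum_ind_eq_ncard _ (f1 _),
      tsum_ind_eq_ncard _ f2, e1, e2, e3]
    exact_mod_cast hcount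
  have hθ0 : MeasurableSet {y | θ y y ≠ 0} :=
    ((hθm.comp (f := fun y : X => (y, y)) (by fun_prop)) (measurableSet_singleton 0)).compl
  have hX1 : MeasurableSet {x | ∃ z ∈ l, G.Reachable x z} := by
    refine measurableSet_setOfPred.2 (hG.measurable_exists (π := id) measurable_id
      (P := fun x z => z ∈ l ∧ G.Reachable x z) ?_ (fun x z h => h.2))
    exact (measurableSet_setOfPred.1 (measurable_snd hlm)).and hG.measurable_reachable
  have hS0 : MeasurableSet ({y | θ y y ≠ 0} ∩ {x | ∃ z ∈ l, G.Reachable x z}) := hθ0.inter hX1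
  refine ⟨{y | θ y y ≠ 0} ∩ {x | ∃ z ∈ l, G.Reachable x z}, hS0, fun y hy => hy.2, ?_, ?_⟩
  · filter_upwards [hG.ae_reachable hQ, hlines, hc.ae_reachable] with x hxQ hxl hxr hx1
    set S := {y | θ y y ≠ 0} ∩ {x | ∃ z ∈ l, G.Reachable x z} with hS
    have hcomp : ∀ y, G.Reachable x y → ∃ z ∈ l, G.Reachable y z := fun y hy => by
      obtain ⟨z, hz, hxz⟩ := hx1
      exact ⟨z, hz, hy.symm.trans hxz⟩
    have hQ' : ∀ y, G.Reachable x y → Q y θ := fun y hy => hxQ y hy (hcomp y hy)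
    have hZS : ∀ y, G.Reachable x y → Z y θ ⊆ S := fun y hy z hz =>
      ⟨hz.2, hcomp z (hy.trans (hz.1.mono hΓG))⟩
    obtain ⟨y₀, hy₀, hxy₀⟩ := hx1
    obtain ⟨γ, hγ, hγ0, hγL, hγr⟩ := hxl y₀ hy₀ hxy₀
    have hLinf : {y | L.Reachable y₀ y}.Infinite :=
      (Set.infinite_range_of_injective hγ).mono (by rintro _ ⟨i, rfl⟩; exact (hγr _).2 ⟨i, rfl⟩)
    obtain ⟨z₀, hz₀, hz₀'⟩ := hLinf.exists_notMem_finite (hc.exhaustion.finite n y₀)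
    have hz₀l : ∀ z, L.Reachable y₀ z → z ∈ l := fun z hz =>
      reachable_induction (P := fun y => y ∈ l) hy₀ (fun u v _ _ huv => hLl v u huv.symm) hz
    obtain ⟨u, v, hu, huv, hu', hv⟩ := exists_adj_of_reachable (P := fun y => Γ.Reachable y₀ y)
      (SimpleGraph.Reachable.refl _) (fun h => hz₀' (by
        rw [hΓr, hp.proj_eq_self hy₀, hp.proj_eq_self (hz₀l _ hz₀)] at h
        exact h)) hz₀
    have hxu := hxy₀.trans (hu.mono hLG)
    have huS : u ∈ S := hZS y₀ hxy₀ ((hQ' y₀ hxy₀).1 u v hu' huv hv)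
    refine ⟨⟨u, huS, hxu⟩, ?_⟩
    -- the line is followed from class to class
    have hmain : ∀ i, L.Reachable u i → ∀ s, Γ.Reachable i s → s ∈ S →
        (within G S).Reachable u s := by
      intro i hi
      have hstep : ∀ i, L.Reachable u i → i ∈ S → ∀ s, Γ.Reachable i s → s ∈ S →
          (within G S).Reachable i s := by
        intro i hi hiS s his hs
        have hxi := hxu.trans (hi.mono hLG)
        exact ((hQ' i hxi).2.1 i s ⟨SimpleGraph.Reachable.refl _, hiS.1⟩ ⟨his, hs.1⟩).mono
          (within_mono le_rfl (hZS i hxi))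
      refine reachable_induction (P := fun i => ∀ s, Γ.Reachable i s → s ∈ S →
        (within G S).Reachable u s) (hstep u (SimpleGraph.Reachable.refl _) huS) ?_ hi
      intro i j hi ih hij s hjs hs
      by_cases hΓij : Γ.Reachable i j
      · exact ih s (hΓij.trans hjs) hs
      have hj := hi.trans hij.reachable
      have hxi := hxu.trans (hi.mono hLG)
      have hxj := hxu.trans (hj.mono hLG)
      have hiS : i ∈ S := hZS i hxi
        ((hQ' i hxi).1 i j (SimpleGraph.Reachable.refl _) hij hΓij)
      have hjS : j ∈ S := hZS j hxj
        ((hQ' j hxj).1 j i (SimpleGraph.Reachable.refl _) hij.symm fun h => hΓij h.symm)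
      have hadj : (within G S).Adj i j := ⟨hLG hij, hiS, hjS⟩
      exact ((ih i (SimpleGraph.Reachable.refl _) hiS).trans hadj.reachable).trans
        (hstep j hj hjS s hjs hs)
    have hroot : ∀ y ∈ S, G.Reachable x y → (within G S).Reachable u y := by
      intro y hy hxy
      have hπy : π y ∈ l := hp.proj_mem y hy.2
      refine hmain (π y) (hxr u (hz₀l u hu) (π y) hπy hxu (hxy.trans (hp.reachable y))) y ?_ hy
      rw [hΓr, hp.proj_eq_self hπy]
    intro y hy z hz hxy hxz
    exact (hroot y hy hxy).symm.trans (hroot z hz hxz)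
  · set S := {y | θ y y ≠ 0} ∩ {x | ∃ z ∈ l, G.Reachable x z} with hS
    have hm : ∀ {D : Set X}, MeasurableSet D → ∀ c : ℝ≥0∞, Measurable fun x => c * ind (x ∈ D) :=
      fun hD c => (measurable_ind (measurableSet_setOfPred.1 hD)).const_mul c
    have h := hG.lintegral_mono_of_class_sum_le hΓG hΓm hΓfin
      (g₁ := fun x => N * 5 * ind (x ∈ S) + N * ind (x ∈ Cov))
      (g₂ := fun x => (5 * N + 6 + 10 * R) * ind (x ∈ l) + 5 * N * ind (x ∈ B))
      ((hm hS0 _).add (hm hCovm _)) ((hm hlm _).add (hm hBm _)) ?_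
    · rw [lintegral_add_left (hm hS0 _), lintegral_add_left (hm hlm _), lintegral_mul_ind hS0,
        lintegral_mul_ind hCovm, lintegral_mul_ind hlm, lintegral_mul_ind hBm] at h
      rw [mul_add, ← mul_assoc]
      exact h
    · have hsum : ∀ x (D E : Set X) (c d : ℝ≥0∞),
          ∑' y, ind (Γ.Reachable x y) * (c * ind (y ∈ D) + d * ind (y ∈ E)) =
            c * ∑' y, ind (Γ.Reachable x y ∧ y ∈ D) + d * ∑' y, ind (Γ.Reachable x y ∧ y ∈ E) := by
        intro x D E c d
        rw [← ENNReal.tsum_mul_left, ← ENNReal.tsum_mul_left, ← ENNReal.tsum_add]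
        refine tsum_congr fun y => ?_
        rw [ind_and, ind_and]
        ring
      filter_upwards [hQ] with x hx
      rw [hsum, hsum]
      by_cases hx1 : ∃ z ∈ l, G.Reachable x z
      · have h1 := (hx hx1).2.2
        rw [mul_add, ← mul_assoc] at h1
        refine le_trans (add_le_add (mul_le_mul_right (ENNReal.tsum_le_tsum fun y =>
          ind_mono fun hy => ⟨hy.1, hy.2.1⟩) _) le_rfl) h1
      · have h0 : ∀ D : Set X, (∀ y ∈ D, ∃ z ∈ l, G.Reachable y z) →
            ∑' y, ind (Γ.Reachable x y ∧ y ∈ D) = 0 := fun D hD => by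
          refine ENNReal.tsum_eq_zero.2 fun y => ind_neg fun hy => hx1 ?_
          obtain ⟨z, hz, hyz⟩ := hD y hy.2
          exact ⟨z, hz, (hy.1.mono hΓG).trans hyz⟩
        rw [h0 S fun y hy => hy.2, h0 Cov fun y hy => ⟨y, hCovl hy, SimpleGraph.Reachable.refl _⟩]
        simp

end Shortening

/-! ### Sections of small measure -/

section SmallSections

variable {X : Type*} [MeasurableSpace X] [StandardBorelSpace X] {G : SimpleGraph X}
  {μ : Measure X} [IsFiniteMeasure μ] {e : ℕ → X → X}

/-- In a one-ended graph, almost every vertex of the core of lines is jumped over by an edge. -/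
theorem IsLineCore.ae_jumpsOver (hG : IsTame G μ e) (hend : ∀ᵐ x ∂μ, OneEndedAt G x) {P : ℕ → Set X}
    {L : SimpleGraph X} {K : ℕ → SimpleGraph X} (hc : IsLineCore G μ P L K) {p π : X → X}
    (hp : IsParent G (⋂ j, P j) p π) (N : ℕ) :
    ∀ᵐ i ∂μ, i ∈ ⋂ j, P j → ∃ n, ∃ u v, JumpsOver G L (K n) π N i u v := by
  have hfib := hG.ae_reachable (hG.ae_finite_fiber hp.measurable_proj hp.reachable)
  have hLG : L ≤ G := fun a b h => (hc.le h).1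
  filter_upwards [hfib, hc.ae_exists_line, hc.ae_reachable, hend] with i hfib hline hreach hend hi
  obtain ⟨γ, hγ, hγ0, hγL, hγr⟩ := hline i hi (SimpleGraph.Reachable.refl _)
  have hγl : ∀ t, γ t ∈ ⋂ j, P j := fun t => (hc.le ((hγL t _).2 (Or.inl rfl))).2.1
  have hγG : ∀ t, G.Reachable i (γ t) := fun t => ((hγr _).2 ⟨t, rfl⟩).mono hLG
  obtain ⟨u, v, l, r, huv, hu, hv, hl, hr⟩ := (hγ0 ▸ hend : OneEndedAt G (γ 0)).exists_crossing hγ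
    (fun t => hLG ((hγL t _).2 (Or.inl rfl))) (fun t => hp.proj_eq_self (hγl t)) (fun x hx => by
      have hix : G.Reachable i x := by rwa [hγ0] at hx
      have hπx := hp.proj_mem x ⟨i, hi, hix.symm⟩
      obtain ⟨t, ht⟩ := (hγr (π x)).1 (hreach i hi (π x) hπx (SimpleGraph.Reachable.refl _)
        (hix.trans (hp.reachable x)))
      exact ⟨t, ht.symm⟩) (fun t => hfib _ (hγG t)) 0 N
  have h1 : ∃ n, ∀ t, l ≤ t → t < r → (K n).Adj (γ t) (γ (t + 1)) := by
    choose m hm using fun t => hc.exhaustion.exists_adj _ _ ((hγL t _).2 (Or.inl rfl))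
    obtain ⟨n, hn⟩ := ((Set.finite_Ico l r).image m).bddAbove
    exact ⟨n, fun t h1 h2 => hc.exhaustion.mono (hn ⟨t, ⟨h1, h2⟩, rfl⟩) (hm t)⟩
  obtain ⟨n, hn⟩ := h1
  refine ⟨n, u, v, huv, (-l).toNat, r.toNat, by omega, by omega, ?_, ?_, ?_⟩
  · obtain ⟨w, hw⟩ := exists_walk_line (K := K n) (γ := γ) l (-l).toNat
      fun t h1 h2 => hn t h1 (by omega)
    have h2 : γ (l + (-l).toNat) = i := by
      rw [Int.toNat_of_nonneg (by omega), add_neg_cancel, hγ0]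
    exact ⟨w.copy hu.symm h2, by simpa using hw⟩
  · obtain ⟨w, hw⟩ := exists_walk_line (K := K n) (γ := γ) 0 r.toNat
      fun t h1 h2 => hn t (by omega) (by omega)
    have h2 : γ (0 + r.toNat) = π v := by
      rw [Int.toNat_of_nonneg (by omega), zero_add, hv]
    exact ⟨w.copy hγ0 h2, by simpa using hw⟩
  · rintro j hj ⟨w, hw⟩
    obtain ⟨t, ht, h⟩ := abs_sub_le_walk_length (fun t z => (hγL t z).1) w l hu
    rw [hv] at ht
    rw [← hγ ht, hw, abs_le] at h
    omega

/-- A section can be replaced by one of about four fifths of its measure: where a line survives the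
pruning, by the shortened line, elsewhere by a late stage of the pruning. -/
theorem IsSection.exists_shortened (hG : IsTame G μ e) (hend : ∀ᵐ x ∂μ, OneEndedAt G x)
    {H : ℕ → SimpleGraph X} (hH : IsExhaustion G H) {Y : Set X} (hY : IsSection G μ Y)
    {ε : ℝ≥0∞} (hε : ε ≠ 0) : ∃ Y', IsSection G μ Y' ∧ 5 * μ Y' ≤ 4 * μ Y + ε := by
  obtain ⟨P, L, K, hc, rfl⟩ := hY.exists_isLineCore hG hend hH
  set l := ⋂ j, P j with hl
  have hPm := fun j => (hc.isSection j).measurableSet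
  have hlm : MeasurableSet l := MeasurableSet.iInter hPm
  have hLG : L ≤ G := fun a b h => (hc.le h).1
  obtain ⟨p, π, h1, h2, h3, h4, h5, h6, h7⟩ := hG.exists_parent le_rfl hG.measurable_adj hlm
  have hp : IsParent G l p π := ⟨h1, h2, h3, h4, h5, h6, h7⟩
  -- an infinite `ε` imposes no condition
  wlog hεt : ε ≠ ⊤ generalizing ε
  · obtain ⟨Y', hY', -⟩ := this one_ne_zero ENNReal.one_ne_top
    refine ⟨Y', hY', ?_⟩
    rw [not_not.1 hεt]
    simp
  -- `7 * δ` is lost on the lines and `5 * δ` on the components without a line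
  obtain ⟨δ, hδ0, hδ⟩ : ∃ δ : ℝ≥0∞, δ ≠ 0 ∧ 12 * δ ≤ ε := by
    refine ⟨ε / 12, (ENNReal.div_pos hε (by norm_num)).ne', ?_⟩
    rw [ENNReal.mul_div_cancel (by norm_num) (by norm_num)]
  have hδt : δ ≠ ⊤ := by
    rintro rfl
    rw [ENNReal.mul_top (by norm_num)] at hδ
    exact hεt (top_le_iff.1 hδ)
  -- few vertices lie in large fibres
  obtain ⟨R, hR⟩ : ∃ R, μ (largeFibers π R) ≤ δ := by
    have hfib := hG.ae_reachable (hG.ae_finite_fiber hp.measurable_proj hp.reachable)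
    have hmono : Antitone (largeFibers π) := fun m n hmn y hy =>
      lt_of_le_of_lt (Nat.cast_le.2 hmn : (m : ℝ≥0∞) ≤ n) hy
    have h0 : μ (⋂ R, largeFibers π R) = 0 := by
      rw [measure_eq_zero_iff_ae_notMem]
      filter_upwards [hfib] with x hx h
      have h1 : {z | π z = π x}.Finite := hx _ (hp.reachable x)
      have h2 := Set.mem_iInter.1 h {z | π z = π x}.ncard
      rw [largeFibers, Set.mem_ofPred_eq, tsum_ind_eq_ncard (fun z => π z = π x) h1] at h2
      exact lt_irrefl _ h2
    have ht := tendsto_measure_iInter_atTop (μ := μ) (s := largeFibers π)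
      (fun R => (hG.measurableSet_largeFibers hp R).nullMeasurableSet) hmono ⟨0, measure_ne_top _ _⟩
    rw [h0] at ht
    obtain ⟨R, hR⟩ := (ht.eventually (gt_mem_nhds (pos_iff_ne_zero.2 hδ0))).exists
    exact ⟨R, hR.le⟩
  -- long jumps are few, so that the fibres of size at most `R` at their ends are negligible
  obtain ⟨N, hN⟩ := ENNReal.exists_nat_mul_gt (a := δ) (b := (6 + 10 * R) * μ l) hδ0
    (ENNReal.mul_ne_top (by
      exact_mod_cast ENNReal.natCast_ne_top (6 + 10 * R)) (measure_ne_top _ _))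
  have hN0 : N ≠ 0 := by
    rintro rfl
    simp at hN
  -- almost all of the core is jumped over inside the pieces of a late stage `n`
  obtain ⟨n, hn⟩ : ∃ n, μ l ≤ μ {i | ∃ u v, JumpsOver G L (K n) π N i u v} + δ := by
    by_cases hl0 : μ l = 0
    · exact ⟨0, by rw [hl0]; exact zero_le⟩
    have hmono : Monotone fun n => {i | ∃ u v, JumpsOver G L (K n) π N i u v} := by
      rintro m n hmn i ⟨u, v, huv, k, q, hk, hq, ⟨w, hw⟩, ⟨w', hw'⟩, hno⟩
      have hle := hc.exhaustion.mono hmn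
      exact ⟨u, v, huv, k, q, hk, hq, ⟨w.mapLe hle, by simpa using hw⟩,
        ⟨w'.mapLe hle, by simpa using hw'⟩, hno⟩
    have h1 : μ l ≤ μ (⋃ n, {i | ∃ u v, JumpsOver G L (K n) π N i u v}) := by
      refine measure_mono_ae ?_
      filter_upwards [hc.ae_jumpsOver hG hend hp N] with i hi hil
      obtain ⟨n, hn⟩ := hi hil
      exact Set.mem_iUnion.2 ⟨n, hn⟩
    rw [hmono.measure_iUnion] at h1
    obtain ⟨n, hn⟩ := lt_iSup_iff.1 ((ENNReal.sub_lt_self (measure_ne_top μ l) hl0 hδ0).trans_le h1)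
    exact ⟨n, tsub_le_iff_right.1 hn.le⟩
  obtain ⟨S, hSm, hSl, hSsec, hSμ⟩ := hc.exists_shortened hG hp N R n
  -- on the components that do not meet the core, the sections `P j` decrease to the empty set
  have hX1 : MeasurableSet {x | ∃ z ∈ l, G.Reachable x z} := by
    refine measurableSet_setOfPred.2 (hG.measurable_exists (π := id) measurable_id
      (P := fun x z => z ∈ l ∧ G.Reachable x z) ?_ (fun x z h => h.2))
    exact (measurableSet_setOfPred.1 (measurable_snd hlm)).and hG.measurable_reachable
  set X1 := {x | ∃ z ∈ l, G.Reachable x z} with hX1def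
  obtain ⟨j, hj⟩ : ∃ j, μ (P j \ X1) ≤ δ := by
    have h0 : ⋂ j, P j \ X1 = ∅ := by
      rw [Set.eq_empty_iff_forall_notMem]
      intro x hx
      rw [Set.mem_iInter] at hx
      exact (hx 0).2 ⟨x, Set.mem_iInter.2 fun j => (hx j).1, SimpleGraph.Reachable.refl _⟩
    have ht := tendsto_measure_iInter_atTop (μ := μ) (s := fun j => P j \ X1)
      (fun j => ((hPm j).diff hX1).nullMeasurableSet)
      (fun i j hij => Set.sdiff_subset_sdiff_left (hc.antitone hij)) ⟨0, measure_ne_top _ _⟩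
    rw [h0, measure_empty] at ht
    obtain ⟨j, hj⟩ := (ht.eventually (gt_mem_nhds (pos_iff_ne_zero.2 hδ0))).exists
    exact ⟨j, hj.le⟩
  have hX1inv : ∀ {x y}, G.Reachable x y → (x ∈ X1 ↔ y ∈ X1) := fun {x y} hxy =>
    ⟨fun ⟨z, hz, h⟩ => ⟨z, hz, hxy.symm.trans h⟩, fun ⟨z, hz, h⟩ => ⟨z, hz, hxy.trans h⟩⟩
  refine ⟨S ∪ P j \ X1, ⟨hSm.union ((hPm j).diff hX1), ?_, ?_⟩, ?_⟩
  · filter_upwards [hSsec, (hc.isSection j).ae_exists] with x h1 h2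
    by_cases hx : x ∈ X1
    · obtain ⟨y, hy, hxy⟩ := (h1 hx).1
      exact ⟨y, Or.inl hy, hxy⟩
    · obtain ⟨y, hy, hxy⟩ := h2
      exact ⟨y, Or.inr ⟨hy, fun h => hx ((hX1inv hxy).2 h)⟩, hxy⟩
  · filter_upwards [hSsec, (hc.isSection j).ae_reachable] with x h1 h2 y hy z hz hxy hxz
    by_cases hx : x ∈ X1
    · have h3 : ∀ {y}, G.Reachable x y → y ∈ S ∪ P j \ X1 → y ∈ S := fun hxy hy =>
        hy.resolve_right fun h => h.2 ((hX1inv hxy).1 hx)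
      exact ((h1 hx).2 y (h3 hxy hy) z (h3 hxz hz) hxy hxz).mono
        (within_mono le_rfl Set.subset_union_left)
    · have h3 : ∀ {y}, G.Reachable x y → y ∈ S ∪ P j \ X1 → y ∈ P j := fun hxy hy =>
        (hy.resolve_left fun h => hx ((hX1inv hxy).2 (hSl _ h))).1
      refine reachable_of_adj_imp ?_ (h2 y (h3 hxy hy) z (h3 hxz hz) hxy hxz)
      intro u v hu huv
      have hxu := hxy.trans (hu.mono (within_le _ _))
      exact ⟨huv.1, Or.inr ⟨huv.2.1, fun h => hx ((hX1inv hxu).2 h)⟩,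
        Or.inr ⟨huv.2.2, fun h => hx ((hX1inv (hxu.trans huv.1.reachable)).2 h)⟩⟩
  · have hlP : μ l ≤ μ (P 0) := measure_mono (Set.iInter_subset _ _)
    have h8 : 5 * μ S ≤ 4 * μ l + 7 * δ := by
      set c := μ {i | ∃ u v, JumpsOver G L (K n) π N i u v}
      have hlt : μ l ≠ ⊤ := measure_ne_top _ _
      have hc : (N : ℝ≥0∞) * (5 * μ S + c) ≤ N * (5 * μ l + 6 * δ) := by
        calc (N : ℝ≥0∞) * (5 * μ S + c) ≤ (5 * N + 6 + 10 * R) * μ l + 5 * N * μ (largeFibers π R) :=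
              hSμ
          _ = 5 * N * μ l + (6 + 10 * R) * μ l + 5 * N * μ (largeFibers π R) := by ring
          _ ≤ 5 * N * μ l + N * δ + 5 * N * δ := by gcongr
          _ = N * (5 * μ l + 6 * δ) := by ring
      have hc' : 5 * μ S + c ≤ 5 * μ l + 6 * δ :=
        (ENNReal.mul_le_mul_iff_right (by exact_mod_cast hN0) (ENNReal.natCast_ne_top N)).1 hc
      refine (ENNReal.add_le_add_iff_right hlt).1 ?_
      calc 5 * μ S + μ l ≤ 5 * μ S + (c + δ) := by gcongr
        _ = 5 * μ S + c + δ := by ring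
        _ ≤ 5 * μ l + 6 * δ + δ := by gcongr
        _ = 4 * μ l + 7 * δ + μ l := by ring
    calc 5 * μ (S ∪ P j \ X1) ≤ 5 * (μ S + μ (P j \ X1)) := by
          gcongr
          exact measure_union_le _ _
      _ = 5 * μ S + 5 * μ (P j \ X1) := by ring
      _ ≤ 4 * μ (P 0) + 7 * δ + 5 * δ := by gcongr; exact h8.trans (by gcongr)
      _ = 4 * μ (P 0) + 12 * δ := by ring
      _ ≤ 4 * μ (P 0) + ε := by gcongr

theorem isSection_univ {X : Type*} [MeasurableSpace X] {G : SimpleGraph X} {μ : Measure X} :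
    IsSection G μ Set.univ :=
  ⟨MeasurableSet.univ, ae_of_all _ fun x => ⟨x, trivial, SimpleGraph.Reachable.refl _⟩,
    ae_of_all _ fun _ _ _ _ _ hxy hxz => (hxy.symm.trans hxz).mono fun _ _ h => ⟨h, trivial, trivial⟩⟩

/-- A one-ended hyperfinite graph has connected sections of arbitrarily small measure. -/
theorem exists_isSection_measure_lt (hG : IsTame G μ e) (hend : ∀ᵐ x ∂μ, OneEndedAt G x)
    {H : ℕ → SimpleGraph X} (hH : IsExhaustion G H) {ε : ℝ≥0∞} (hε : ε ≠ 0) :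
    ∃ Y, IsSection G μ Y ∧ μ Y < ε := by
  set q := ⨅ Y : {Y // IsSection G μ Y}, μ Y.1 with hq
  have hqt : q ≠ ⊤ := ne_top_of_le_ne_top (measure_ne_top μ Set.univ)
    (iInf_le (fun Y : {Y // IsSection G μ Y} => μ Y.1) ⟨_, isSection_univ⟩)
  have hq0 : q = 0 := by
    by_contra hq0
    -- otherwise a section of measure less than `q + q / 10` could be shortened below the infimum `q`,
    -- as `4 * 1.1 + 0.1 < 5`
    have h10 : q / 10 ≠ 0 := (ENNReal.div_pos hq0 (by norm_num)).ne'
    have h11 : q < q + q / 10 := ENNReal.lt_add_right hqt h10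
    obtain ⟨⟨Y, hY⟩, hYq⟩ := iInf_lt_iff.1 (hq ▸ h11)
    obtain ⟨Y', hY', hμ⟩ := hY.exists_shortened hG hend hH h10
    have h1 : q ≤ μ Y' := iInf_le (fun Y : {Y // IsSection G μ Y} => μ Y.1) ⟨Y', hY'⟩
    have h2 : 5 * q ≤ 4 * (q + q / 10) + q / 10 :=
      calc 5 * q ≤ 5 * μ Y' := by gcongr
        _ ≤ 4 * μ Y + q / 10 := hμ
        _ ≤ 4 * (q + q / 10) + q / 10 := by gcongr
    clear_value q
    lift q to NNReal using hqt
    have h3 : (q : ℝ≥0∞) / 10 = ((q / 10 : NNReal) : ℝ≥0∞) := by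
      rw [ENNReal.coe_div (by norm_num)]; norm_num
    rw [h3] at h2
    have h4 : 5 * q ≤ 4 * (q + q / 10) + q / 10 := by exact_mod_cast h2
    have h5 : (0 : ℝ) < q := by
      have : q ≠ 0 := by simpa using hq0
      positivity
    have h6 : 5 * (q : ℝ) ≤ 4 * (q + q / 10) + q / 10 := by exact_mod_cast h4
    linarith
  have := iInf_lt_iff.1 (show q < ε by rw [hq0]; exact pos_iff_ne_zero.2 hε)
  obtain ⟨⟨Y, hY⟩, h⟩ := this
  exact ⟨Y, hY, h⟩

end SmallSections

/-! ### Rounding flows in finite graphs -/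

section Rounding

variable {V : Type*}

open Classical in
/-- The number of times a walk traverses the edge from `x` to `y`. -/
noncomputable def dartCount {F : SimpleGraph V} {u v : V} (w : F.Walk u v) (x y : V) : ℕ :=
  (w.darts.map SimpleGraph.Dart.toProd).count (x, y)

theorem dartCount_ne_zero {F : SimpleGraph V} {u v : V} {w : F.Walk u v} {x y : V}
    (h : dartCount w x y ≠ 0) : F.Adj x y ∧ s(x, y) ∈ w.edges := by
  classical
  have h1 : (x, y) ∈ w.darts.map SimpleGraph.Dart.toProd :=
    List.count_pos_iff.1 (Nat.pos_of_ne_zero h)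
  obtain ⟨d, hd, hxy⟩ := List.mem_map.1 h1
  refine ⟨?_, ?_⟩
  · have := d.adj
    rwa [hxy] at this
  · refine List.mem_map.2 ⟨d, hd, ?_⟩
    rw [SimpleGraph.Dart.edge, hxy]

open Classical in
/-- The flow along a walk has a source at its start and a sink at its end, which cancel for a closed
walk. -/
theorem sum_dartCount [Fintype V] {F : SimpleGraph V} {u v : V} (w : F.Walk u v)
    (x : V) : ∑ y, ((dartCount w x y : ℝ) - dartCount w y x) =
      (if u = x then 1 else 0) - if v = x then 1 else 0 := by
  induction w with
  | nil => simp [dartCount]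
  | @cons a b c h w ih =>
    have hc : ∀ x y, (dartCount (SimpleGraph.Walk.cons h w) x y : ℝ) =
        dartCount w x y + if a = x ∧ b = y then 1 else 0 := by
      intro x y
      rw [dartCount, SimpleGraph.Walk.darts_cons, List.map_cons, List.count_cons]
      simp [dartCount, Prod.ext_iff]
    simp only [hc]
    have h1 : ∀ y, (dartCount w x y + (if a = x ∧ b = y then 1 else 0) -
        (dartCount w y x + if a = y ∧ b = x then 1 else 0) : ℝ) =
        (dartCount w x y - dartCount w y x) + ((if b = y then if a = x then 1 else 0 else 0) -
          if a = y then if b = x then 1 else 0 else 0) := by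
      have key : ∀ (p q r s : Prop) (A B : ℝ), A + (if p ∧ q then 1 else 0) -
          (B + if r ∧ s then 1 else 0) = (A - B) + ((if q then if p then 1 else 0 else 0) -
            if r then if s then 1 else 0 else 0) := by
        intro p q r s A B
        by_cases hp : p <;> by_cases hq : q <;> by_cases hr : r <;> by_cases hs : s <;>
          simp [hp, hq, hr, hs] <;> ring
      exact fun y => key _ _ _ _ _ _
    simp only [h1]
    rw [Finset.sum_add_distrib, ih, Finset.sum_sub_distrib]
    simp only [Finset.sum_ite_eq, Finset.mem_univ, if_true]
    ring

/-- A finite graph without leaves that has an edge carries a nonzero circulation. -/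
theorem exists_circulation [Fintype V] {F : SimpleGraph V}
    (hdeg : ∀ x y, F.Adj x y → ∃ z, z ≠ y ∧ F.Adj x z) (hne : ∃ x y, F.Adj x y) :
    ∃ c : V → V → ℝ, (∀ x y, c x y = -c y x) ∧ (∀ x y, c x y ≠ 0 → F.Adj x y) ∧
      (∀ x, ∑ y, c x y = 0) ∧ ∃ x y, 0 < c x y := by
  classical
  have hac : ¬F.IsAcyclic := by
    intro hac
    obtain ⟨x, y, hxy⟩ := hne
    set c := F.connectedComponentMk x
    have hc : ∀ y, y ∈ c.supp ↔ F.Reachable x y := fun y => by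
      rw [SimpleGraph.ConnectedComponent.mem_supp_iff, SimpleGraph.ConnectedComponent.eq]
      exact SimpleGraph.reachable_comm
    have : Nontrivial c := ⟨⟨⟨x, (hc x).2 (SimpleGraph.Reachable.refl _)⟩,
      ⟨y, (hc y).2 hxy.reachable⟩, fun h => hxy.ne (Subtype.ext_iff.1 h)⟩⟩
    obtain ⟨v, hv⟩ := (hac.isTree_connectedComponent c).exists_vert_degree_one_of_nontrivial
    obtain ⟨⟨w, hw⟩, hvw, huniq⟩ := SimpleGraph.degree_eq_one_iff_existsUnique_adj.1 hv
    obtain ⟨z, hzw, hvz⟩ := hdeg v w hvw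
    have hz : z ∈ c.supp := (hc z).2 (((hc v).1 v.2).trans hvz.reachable)
    exact hzw (Subtype.ext_iff.1 (huniq ⟨z, hz⟩ hvz))
  simp only [SimpleGraph.IsAcyclic, not_forall, not_not] at hac
  obtain ⟨u, w, hw⟩ := hac
  refine ⟨fun x y => dartCount w x y - dartCount w y x, fun x y => by ring, fun x y h => ?_,
    fun x => by rw [sum_dartCount, sub_self], ?_⟩
  · by_contra hxy
    have h1 : dartCount w x y = 0 := by
      by_contra hne
      exact hxy (dartCount_ne_zero hne).1
    have h2 : dartCount w y x = 0 := by
      by_contra hne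
      exact hxy (dartCount_ne_zero hne).1.symm
    exact h (by simp [h1, h2])
  · cases w with
    | nil => exact absurd hw SimpleGraph.Walk.not_isCycle_nil
    | @cons _ b _ h p =>
      refine ⟨u, b, ?_⟩
      have h1 : s(u, b) ∉ p.edges := (SimpleGraph.Walk.cons_isCycle_iff p h).1 hw |>.2
      have h2 : dartCount (SimpleGraph.Walk.cons h p) u b ≠ 0 := by
        rw [dartCount, SimpleGraph.Walk.darts_cons, List.map_cons]
        exact (List.count_pos_iff.2 List.mem_cons_self).ne'
      have h3 : dartCount (SimpleGraph.Walk.cons h p) b u = 0 := by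
        rw [dartCount, SimpleGraph.Walk.darts_cons, List.map_cons, List.count_eq_zero,
          List.mem_cons, not_or]
        refine ⟨fun heq => h.ne (Prod.ext_iff.1 heq).2, fun hmem => h1 ?_⟩
        obtain ⟨d, hd, hbu⟩ := List.mem_map.1 hmem
        refine List.mem_map.2 ⟨d, hd, ?_⟩
        rw [SimpleGraph.Dart.edge, hbu]
        exact Sym2.eq_swap
      simpa [h3] using Nat.pos_of_ne_zero h2

theorem floor_eq_neg_ceil {a b : ℝ} (h : a = -b) : ⌊a⌋ = -⌈b⌉ := by
  rw [h, Int.floor_neg]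

/-- A real flow with integer net flows on a finite complete graph can be rounded to an integer flow
with the same net flows: while there are fractional values, they lie on a cycle, along which flow
is pushed until one of them becomes an integer. -/
theorem exists_rounding [Fintype V] (θ : V → V → ℝ) (hanti : ∀ x y, θ x y = -θ y x)
    (hint : ∀ x, ∃ k : ℤ, ∑ y, θ x y = k) :
    ∃ h : V → V → ℤ, (∀ x y, h x y = -h y x) ∧ (∀ x y, ⌊θ x y⌋ ≤ h x y ∧ h x y ≤ ⌈θ x y⌉) ∧
      ∀ x, ∑ y, (h x y : ℝ) = ∑ y, θ x y := by
  classical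
  generalize hn : (Finset.univ.filter fun p : V × V => ∀ k : ℤ, θ p.1 p.2 ≠ k).card = n
  induction n using Nat.strong_induction_on generalizing θ with
  | _ n ih =>
  by_cases hfrac : ∃ x y, ∀ k : ℤ, θ x y ≠ k
  swap
  · push Not at hfrac
    choose h hh using hfrac
    refine ⟨h, fun x y => ?_, fun x y => ?_, fun x => by simp only [hh]⟩
    · have := hanti x y
      rw [hh, hh] at this
      exact_mod_cast this
    · rw [hh]; simp
  -- the graph of fractional values has no leaves, as the net flows are integers
  let F : SimpleGraph V :=
    { Adj := fun x y => ∀ k : ℤ, θ x y ≠ k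
      symm := ⟨fun x y h k hk => h (-k) (by rw [hanti, hk]; simp)⟩
      loopless := ⟨fun x h => h 0 (by have := hanti x x; push_cast; linarith)⟩ }
  obtain ⟨c, hcanti, hcF, hc0, hcpos⟩ := exists_circulation (F := F) (by
    intro x y hxy
    by_contra! hcon
    obtain ⟨k, hk⟩ := hint x
    have h1 : ∀ z, ∃ m : ℤ, z ≠ y → θ x z = m := by
      intro z
      by_cases hz : z = y
      · exact ⟨0, fun h => absurd hz h⟩
      · have := hcon z hz
        change ¬∀ k : ℤ, θ x z ≠ k at this
        push Not at this
        obtain ⟨m, hm⟩ := this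
        exact ⟨m, fun _ => hm⟩
    choose m hm using h1
    refine hxy (k - ∑ z ∈ Finset.univ.erase y, m z) ?_
    rw [← Finset.add_sum_erase _ _ (Finset.mem_univ y),
      Finset.sum_congr rfl fun z hz => hm z (Finset.ne_of_mem_erase hz)] at hk
    push_cast
    linarith) hfrac
  -- the first time at which a value on the support of `c` becomes an integer
  let P := Finset.univ.filter fun p : V × V => 0 < c p.1 p.2
  have hP : P.Nonempty := by
    obtain ⟨x, y, h⟩ := hcpos
    exact ⟨(x, y), by simpa [P] using h⟩
  obtain ⟨q, hq, hmin⟩ := P.exists_min_image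
    (fun p => ((⌈θ p.1 p.2⌉ : ℝ) - θ p.1 p.2) / c p.1 p.2) hP
  set t := ((⌈θ q.1 q.2⌉ : ℝ) - θ q.1 q.2) / c q.1 q.2 with ht
  have hqc : 0 < c q.1 q.2 := (Finset.mem_filter.1 hq).2
  have ht0 : 0 ≤ t := div_nonneg (sub_nonneg.2 (Int.le_ceil _)) hqc.le
  have hle : ∀ x y, 0 ≤ c x y → θ x y ≤ θ x y + t * c x y ∧
      θ x y + t * c x y ≤ ⌈θ x y⌉ := by
    intro x y hxy
    refine ⟨by have := mul_nonneg ht0 hxy; linarith, ?_⟩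
    rcases hxy.eq_or_lt with h | h
    · rw [← h, mul_zero, add_zero]; exact Int.le_ceil _
    · have := hmin (x, y) (by simpa [P] using h)
      rw [le_div_iff₀ h] at this
      simp only at this
      linarith
  have hge : ∀ x y, c x y ≤ 0 → θ x y + t * c x y ≤ θ x y ∧
      (⌊θ x y⌋ : ℝ) ≤ θ x y + t * c x y := by
    intro x y hxy
    have h1 := hle y x (by rw [hcanti]; linarith)
    have h2 : (⌊θ x y⌋ : ℝ) = -⌈θ y x⌉ := by
      exact_mod_cast congrArg (Int.cast : ℤ → ℝ) (floor_eq_neg_ceil (hanti x y))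
    rw [h2, hanti x y, hcanti x y]
    constructor <;> linarith [h1.1, h1.2]
  have hbd : ∀ x y, (⌊θ x y⌋ : ℝ) ≤ θ x y + t * c x y ∧ θ x y + t * c x y ≤ ⌈θ x y⌉ := by
    intro x y
    rcases le_total 0 (c x y) with h | h
    · exact ⟨(Int.floor_le _).trans (hle x y h).1, (hle x y h).2⟩
    · exact ⟨(hge x y h).2, (hge x y h).1.trans (Int.le_ceil _)⟩
  have hsum : ∀ x, ∑ y, (θ x y + t * c x y) = ∑ y, θ x y := by
    intro x
    rw [Finset.sum_add_distrib, ← Finset.mul_sum, hc0, mul_zero, add_zero]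
  obtain ⟨h, h1, h2, h3⟩ := ih _ (by
    rw [← hn]
    refine Finset.card_lt_card (Finset.ssubset_iff_of_subset ?_ |>.2 ⟨q, ?_, ?_⟩)
    · intro p hp
      rw [Finset.mem_filter] at hp ⊢
      refine ⟨hp.1, ?_⟩
      by_cases hcp : c p.1 p.2 = 0
      · have := hp.2
        rwa [hcp, mul_zero, add_zero] at this
      · exact hcF _ _ hcp
    · exact Finset.mem_filter.2 ⟨Finset.mem_univ _, hcF _ _ hqc.ne'⟩
    · rw [Finset.mem_filter]
      rintro ⟨-, h⟩
      refine h ⌈θ q.1 q.2⌉ ?_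
      rw [ht, div_mul_cancel₀ _ hqc.ne']
      ring) (fun x y => θ x y + t * c x y)
    (fun x y => by rw [hanti x y, hcanti x y]; ring)
    (fun x => by obtain ⟨k, hk⟩ := hint x; exact ⟨k, by rw [hsum, hk]⟩) rfl
  refine ⟨h, h1, fun x y => ⟨le_trans ?_ (h2 x y).1, (h2 x y).2.trans ?_⟩, fun x => by
    rw [h3, hsum]⟩
  · exact Int.le_floor.2 (hbd x y).1
  · exact Int.ceil_le.2 (hbd x y).2

/-- Rounding on a finite set `D`, where the net flows are preserved only on a subset `C`. -/
theorem exists_rounding_on (D C : Finset V) (hCD : C ⊆ D) (θ : V → V → ℝ)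
    (hanti : ∀ x ∈ D, ∀ y ∈ D, θ x y = -θ y x) (hint : ∀ x ∈ C, ∃ k : ℤ, ∑ y ∈ D, θ x y = k) :
    ∃ h : V → V → ℤ, (∀ x ∈ D, ∀ y ∈ D, h x y = -h y x) ∧
      (∀ x y, ⌊θ x y⌋ ≤ h x y ∧ h x y ≤ ⌈θ x y⌉) ∧
      ∀ x ∈ C, ∑ y ∈ D, (h x y : ℝ) = ∑ y ∈ D, θ x y := by
  classical
  -- an additional vertex `none` absorbs the net flow out of the vertices outside `C`
  let s : D → ℝ := fun x => if x.1 ∈ C then 0 else -∑ y ∈ D, θ x y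
  let ϑ : Option D → Option D → ℝ
    | some x, some y => θ x y
    | some x, none => s x
    | none, some y => -s y
    | none, none => 0
  have hD : ∀ f : V → ℝ, ∑ y : D, f y = ∑ y ∈ D, f y := fun f => Finset.sum_coe_sort D f
  have htot : ∑ x ∈ D, ∑ y ∈ D, θ x y = 0 := by
    have h1 : ∑ x ∈ D, ∑ y ∈ D, θ x y = ∑ x ∈ D, ∑ y ∈ D, -θ y x :=
      Finset.sum_congr rfl fun x hx => Finset.sum_congr rfl fun y hy => hanti x hx y hy
    have h2 : ∑ x ∈ D, ∑ y ∈ D, -θ y x = -∑ x ∈ D, ∑ y ∈ D, θ x y := by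
      rw [Finset.sum_comm]
      simp only [Finset.sum_neg_distrib]
    linarith
  have hs : ∀ x : D, s x = if x.1 ∈ C then 0 else -∑ y ∈ D, θ x y := fun x => rfl
  obtain ⟨h, h1, h2, h3⟩ := exists_rounding ϑ (by
    rintro (_ | x) (_ | y)
    · simp [ϑ]
    · simp [ϑ]
    · simp [ϑ]
    · exact hanti x x.2 y y.2) (by
    rintro (_ | x)
    · choose! k hk using hint
      refine ⟨-∑ y ∈ C, k y, ?_⟩
      rw [Fintype.sum_option]
      simp only [ϑ]
      have h4 : ∑ y : D, -s y = ∑ y ∈ D, if y ∈ C then 0 else ∑ z ∈ D, θ y z := by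
        rw [← hD]
        refine Finset.sum_congr rfl fun y _ => ?_
        rw [hs]
        split_ifs <;> simp
      have h5 : ∑ y ∈ D, ∑ z ∈ D, θ y z = (∑ y ∈ D, if y ∈ C then (k y : ℝ) else 0) +
          ∑ y ∈ D, if y ∈ C then 0 else ∑ z ∈ D, θ y z := by
        rw [← Finset.sum_add_distrib]
        refine Finset.sum_congr rfl fun y _ => ?_
        split_ifs with hy
        · rw [hk y hy]; simp
        · simp
      rw [Finset.sum_ite_mem, Finset.inter_eq_right.2 hCD, htot] at h5
      rw [h4]
      push_cast
      linarith
    · by_cases hx : x.1 ∈ C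
      · obtain ⟨k, hk⟩ := hint x hx
        refine ⟨k, ?_⟩
        rw [Fintype.sum_option]
        simp only [ϑ]
        rw [hD, hk, hs, if_pos hx, zero_add]
      · refine ⟨0, ?_⟩
        rw [Fintype.sum_option]
        simp only [ϑ]
        rw [hD, hs, if_neg hx]
        simp)
  refine ⟨fun x y => if hxy : x ∈ D ∧ y ∈ D then h (some ⟨x, hxy.1⟩) (some ⟨y, hxy.2⟩)
    else ⌊θ x y⌋, fun x hx y hy => ?_, fun x y => ?_, fun x hx => ?_⟩
  · dsimp only
    rw [dif_pos ⟨hx, hy⟩, dif_pos ⟨hy, hx⟩, h1]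
  · dsimp only
    split_ifs with hxy
    · exact h2 (some ⟨x, hxy.1⟩) (some ⟨y, hxy.2⟩)
    · exact ⟨le_rfl, Int.floor_le_ceil _⟩
  · have hxD := hCD hx
    have h4 := h3 (some ⟨x, hxD⟩)
    have h5 : h (some ⟨x, hxD⟩) none = 0 := by
      have := h2 (some ⟨x, hxD⟩) none
      simp only [ϑ, hs, hx, if_true, Int.floor_zero, Int.ceil_zero] at this
      omega
    rw [Fintype.sum_option, Fintype.sum_option, h5] at h4
    simp only [ϑ, hs, hx, if_true, Int.cast_zero, zero_add] at h4
    rw [hD (fun y => θ x y)] at h4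
    rw [← h4, ← Finset.sum_coe_sort D]
    refine Finset.sum_congr rfl fun y _ => ?_
    dsimp only
    rw [dif_pos ⟨hxD, y.2⟩]

theorem abs_sub_lt_one_of_floor_le {a : ℝ} {k : ℤ} (h1 : ⌊a⌋ ≤ k) (h2 : k ≤ ⌈a⌉) :
    |(k : ℝ) - a| < 1 := by
  have h3 : (⌊a⌋ : ℝ) ≤ k := by exact_mod_cast h1
  have h4 : (k : ℝ) ≤ ⌈a⌉ := by exact_mod_cast h2
  rw [abs_lt]
  constructor <;> linarith [Int.lt_floor_add_one a, Int.ceil_lt_add_one a]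

/-- On a locally finite graph, every real flow with integer net flows can be rounded to an integer
flow with the same net flows, by compactness. -/
theorem exists_integer_flow {G : SimpleGraph V} (hfin : ∀ x, {y | G.Adj x y}.Finite) {f : V → ℤ}
    {φ : V → V → ℝ} (hanti : ∀ x y, G.Adj x y → φ x y = -φ y x)
    (hφ : ∀ x, ∑ᶠ y ∈ {y | G.Adj x y}, φ x y = f x) :
    ∃ ψ : V → V → ℤ, (∀ x y, G.Adj x y → ψ x y = -ψ y x) ∧
      (∀ x y, G.Adj x y → |(ψ x y : ℝ) - φ x y| < 1) ∧
      ∀ x, ∑ᶠ y ∈ {y | G.Adj x y}, (ψ x y : ℝ) = f x := by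
  classical
  let θ : V → V → ℝ := fun x y => if G.Adj x y then φ x y else 0
  have hθ : ∀ x y, G.Adj x y → θ x y = φ x y := fun x y h => if_pos h
  have hθanti : ∀ x y, θ x y = -θ y x := by
    intro x y
    simp only [θ, G.adj_comm y x]
    split_ifs with h
    · exact hanti x y h
    · simp
  -- the integer flows within the bounds form an intersection of closed subsets of a compact set
  let K : Set (V × V → ℤ) := Set.univ.pi fun p => Set.Icc ⌊θ p.1 p.2⌋ ⌈θ p.1 p.2⌉
  have hK : IsCompact K := isCompact_univ_pi fun p => (Set.finite_Icc _ _).isCompact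
  let A : V → Set (V × V → ℤ) := fun x => {h | (∀ y, G.Adj x y → h (x, y) = -h (y, x)) ∧
    ∑ y ∈ (hfin x).toFinset, h (x, y) = f x}
  have hA : ∀ x, IsClosed (A x) := by
    intro x
    have h1 : IsClosed {h : V × V → ℤ | ∀ y, G.Adj x y → h (x, y) = -h (y, x)} := by
      simp only [Set.ofPred_forall]
      exact isClosed_iInter fun y => isClosed_iInter fun _ =>
        isClosed_eq (continuous_apply _) (continuous_apply _).neg
    exact h1.inter (isClosed_eq (continuous_finsetSum _ fun y _ => continuous_apply _)
      continuous_const)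
  have hfs : ∀ (x : V) (g : V → ℝ), ∑ᶠ y ∈ {y | G.Adj x y}, g y =
      ∑ y ∈ (hfin x).toFinset, g y := fun x g => finsum_mem_eq_finite_toFinset_sum g (hfin x)
  obtain ⟨h, hhK, hhA⟩ := hK.inter_iInter_nonempty A hA (by
    intro u
    let D : Finset V := u ∪ u.biUnion fun x => (hfin x).toFinset
    have hsub : ∀ x ∈ u, (hfin x).toFinset ⊆ D := fun x hx =>
      (Finset.subset_biUnion_of_mem (fun x => (hfin x).toFinset) hx).trans
        Finset.subset_union_right
    have hsum : ∀ x ∈ u, ∀ g : V → ℝ, (∀ y, ¬G.Adj x y → g y = 0) →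
        ∑ y ∈ D, g y = ∑ y ∈ (hfin x).toFinset, g y := fun x hx g hg =>
      (Finset.sum_subset (hsub x hx) fun y _ hy => hg y (by simpa using hy)).symm
    have hrow : ∀ x ∈ u, ∑ y ∈ D, θ x y = f x := by
      intro x hx
      rw [hsum x hx _ fun y hy => if_neg hy, ← hφ x, hfs]
      exact Finset.sum_congr rfl fun y hy => hθ x y (by simpa using hy)
    obtain ⟨h, h1, h2, h3⟩ := exists_rounding_on D u Finset.subset_union_left θ
      (fun x _ y _ => hθanti x y) (fun x hx => ⟨f x, hrow x hx⟩)
    refine ⟨fun p => h p.1 p.2, fun p _ => h2 p.1 p.2, Set.mem_iInter₂.2 fun x hx => ⟨?_, ?_⟩⟩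
    · intro y hxy
      exact h1 x (Finset.subset_union_left hx) y (hsub x hx (by simpa using hxy))
    · have h4 := h3 x hx
      rw [hrow x hx, hsum x hx _ fun y hy => ?_] at h4
      · exact_mod_cast h4
      · have := h2 x y
        simp only [θ, if_neg hy, Int.floor_zero, Int.ceil_zero] at this
        have h5 : h x y = 0 := by omega
        rw [h5, Int.cast_zero])
  rw [Set.mem_iInter] at hhA
  refine ⟨fun x y => h (x, y), fun x y hxy => (hhA x).1 y hxy, fun x y hxy => ?_, fun x => ?_⟩
  · have h1 := hhK (x, y) trivial
    have := abs_sub_lt_one_of_floor_le h1.1 h1.2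
    rwa [hθ x y hxy] at this
  · rw [hfs]
    exact_mod_cast (hhA x).2

end Rounding

section MeasurableRounding

variable {X : Type*} [MeasurableSpace X] [StandardBorelSpace X] {G : SimpleGraph X}
  {e : ℕ → X → X}

/-- The rounding of a Borel flow inside finite components can be chosen in a Borel way. -/
theorem IsEnum.exists_measurable_rounding (he : IsEnum G e) {H : SimpleGraph X} (hle : H ≤ G)
    (hH : Measurable fun p : X × X => H.Adj p.1 p.2) {θ : X → X → ℝ}
    (hθ : Measurable fun p : X × X => θ p.1 p.2) (hsupp : ∀ x y, θ x y ≠ 0 → H.Reachable x y) :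
    ∃ h : X → X → ℤ, (Measurable fun p : X × X => h p.1 p.2) ∧
      ∀ x, {y | H.Reachable x y}.Finite → (∀ y, H.Reachable x y → ∀ z, θ y z = -θ z y) →
        (∀ y, H.Reachable x y → ∃ k : ℤ, ∑ᶠ z, θ y z = k) →
        (∀ y, h x y = -h y x) ∧ (∀ y, |(h x y : ℝ) - θ x y| < 1) ∧
        ∑ᶠ y, (h x y : ℝ) = ∑ᶠ y, θ x y := by
  classical
  have hR := he.measurable_reachable_of_le hle hH
  let Q : X → (X → X → ℤ) → Prop := fun x h =>
    (∀ y, ∀ z, H.Reachable x y → H.Reachable x z → h y z = -h z y ∧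
      ⌊θ y z⌋ ≤ h y z ∧ h y z ≤ ⌈θ y z⌉) ∧
    ∀ y, H.Reachable x y → ∑ᶠ z, (if H.Reachable x z then (h y z : ℝ) else 0) = ∑ᶠ z, θ y z
  have hQm : ∀ h : X → X → ℤ, (Measurable fun p : X × X => h p.1 p.2) →
      Measurable fun x => Q x h := by
    intro h hh
    refine Measurable.and ?_ ?_
    · refine he.measurable_forall (π := id) measurable_id ?_ ?_
      · refine he.measurable_forall (π := fun q : X × X => q.1) measurable_fst ?_ ?_
        · have hz : Measurable fun q : (X × X) × X => h q.1.2 q.2 :=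
            hh.comp (f := fun q : (X × X) × X => (q.1.2, q.2)) (by fun_prop)
          have hz' : Measurable fun q : (X × X) × X => h q.2 q.1.2 :=
            hh.comp (f := fun q : (X × X) × X => (q.2, q.1.2)) (by fun_prop)
          have hθz : Measurable fun q : (X × X) × X => θ q.1.2 q.2 :=
            hθ.comp (f := fun q : (X × X) × X => (q.1.2, q.2)) (by fun_prop)
          refine (hR.comp measurable_fst).imp (Measurable.imp ?_ (Measurable.and ?_
            (Measurable.and ?_ ?_)))
          · exact hR.comp (f := fun q : (X × X) × X => (q.1.1, q.2)) (by fun_prop)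
          · exact measurableSet_setOfPred.1 (measurableSet_eq_fun hz hz'.neg)
          · exact measurableSet_setOfPred.1 (measurableSet_le hθz.floor hz)
          · exact measurableSet_setOfPred.1 (measurableSet_le hz hθz.ceil)
        · intro q z hq
          rw [Classical.not_imp, Classical.not_imp] at hq
          exact hq.2.1.mono hle
      · intro x y hq
        simp only [not_forall, exists_prop] at hq
        obtain ⟨z, hz, -⟩ := hq
        exact hz.mono hle
    · refine he.measurable_forall (π := id) measurable_id ?_ ?_
      · refine hR.imp (measurableSet_setOfPred.1 (measurableSet_eq_fun ?_ ?_))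
        · refine he.measurable_finsum (π := fun q : X × X => q.1) measurable_fst
            (f := fun q z => if H.Reachable q.1 z then (h q.2 z : ℝ) else 0) ?_ ?_
          · refine Measurable.ite (measurableSet_setOfPred.2 ?_) ?_ measurable_const
            · exact hR.comp (f := fun q : (X × X) × X => (q.1.1, q.2)) (by fun_prop)
            · exact measurable_from_top.comp
                (hh.comp (f := fun q : (X × X) × X => (q.1.2, q.2)) (by fun_prop))
          · intro q z hq
            have : H.Reachable q.1 z := by
              by_contra hne
              exact hq (if_neg hne)
            exact this.mono hle
        · refine he.measurable_finsum (π := fun q : X × X => q.2) measurable_snd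
            (f := fun q z => θ q.2 z) ?_ (fun q z hq => (hsupp _ _ hq).mono hle)
          exact hθ.comp (f := fun q : (X × X) × X => (q.1.2, q.2)) (by fun_prop)
      · intro x y hq
        rw [Classical.not_imp] at hq
        exact hq.1.mono hle
  have hQl : ∀ x h h', (∀ y z, H.Reachable x y → H.Reachable x z → h y z = h' y z) →
      Q x h → Q x h' := by
    intro x h h' heq hQ
    refine ⟨fun y z hy hz => ?_, fun y hy => ?_⟩
    · rw [← heq y z hy hz, ← heq z y hz hy]
      exact hQ.1 y z hy hz
    · rw [← hQ.2 y hy]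
      refine finsum_congr fun z => ?_
      split_ifs with hz
      · rw [heq y z hy hz]
      · rfl
  have hQi : ∀ x y h, H.Reachable x y → Q x h → Q y h := by
    intro x y h hxy hQ
    have h1 : ∀ z, H.Reachable x z ↔ H.Reachable y z := fun z =>
      ⟨fun h => hxy.symm.trans h, fun h => hxy.trans h⟩
    simp only [Q, ← h1]
    exact hQ
  obtain ⟨h, hm, h0, hh⟩ := he.exists_measurable_selection hle hH Q hQm hQl hQi
  refine ⟨h, hm, fun x hfin hanti hint => ?_⟩
  have hmem : ∀ y, y ∈ hfin.toFinset ↔ H.Reachable x y := fun y => by simp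
  have hrow : ∀ y, H.Reachable x y → ∑ᶠ z, θ y z = ∑ z ∈ hfin.toFinset, θ y z := fun y hy =>
    finsum_eq_sum_of_support_subset _ fun z hz => by
      rw [Finset.mem_coe, hmem]
      exact hy.trans (hsupp y z hz)
  have hQx : Q x h := by
    refine hh x hfin ?_
    obtain ⟨h', h1, h2, h3⟩ := exists_rounding_on hfin.toFinset hfin.toFinset subset_rfl θ
      (fun y hy z _ => hanti y ((hmem y).1 hy) z)
      (fun y hy => by rw [← hrow y ((hmem y).1 hy)]; exact hint y ((hmem y).1 hy))
    refine ⟨h', fun y z hy hz => ⟨h1 y ((hmem y).2 hy) z ((hmem z).2 hz), h2 y z⟩, fun y hy => ?_⟩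
    rw [hrow y hy, ← h3 y ((hmem y).2 hy), finsum_eq_sum_of_support_subset (s := hfin.toFinset)]
    · exact Finset.sum_congr rfl fun z hz => if_pos ((hmem z).1 hz)
    · intro z hz
      rw [Finset.mem_coe, hmem]
      by_contra hne
      exact hz (if_neg hne)
  have hxx : H.Reachable x x := SimpleGraph.Reachable.refl _
  refine ⟨fun y => ?_, fun y => ?_, ?_⟩
  · by_cases hxy : H.Reachable x y
    · exact (hQx.1 x y hxx hxy).1
    · rw [h0 _ _ hxy, h0 _ _ fun h => hxy h.symm, neg_zero]
  · by_cases hxy : H.Reachable x y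
    · exact abs_sub_lt_one_of_floor_le (hQx.1 x y hxx hxy).2.1 (hQx.1 x y hxx hxy).2.2
    · have : θ x y = 0 := by
        by_contra hne
        exact hxy (hsupp x y hne)
      rw [h0 _ _ hxy, this]
      simp
  · rw [← hQx.2 x hxx]
    refine finsum_congr fun y => ?_
    split_ifs with hxy
    · rfl
    · rw [h0 _ _ hxy, Int.cast_zero]

end MeasurableRounding

/-! ### Vanishing sections and layers -/

section Layers

variable {V : Type*}

/-- The component of `x` in the complement of `Z` is good if its neighbours in `Z` are connected to
each other in `Z \ Z'`. -/
def IsGood (G : SimpleGraph V) (Z Z' : Set V) (x : V) : Prop :=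
  x ∉ Z ∧ ∀ a, ∀ u, ∀ b, ∀ v, (within G Zᶜ).Reachable x a → G.Adj a u → u ∈ Z →
    (within G Zᶜ).Reachable x b → G.Adj b v → v ∈ Z → (within G (Z \ Z')).Reachable u v

theorem IsGood.of_reachable {G : SimpleGraph V} {Z Z' : Set V} {x y : V} (h : IsGood G Z Z' x)
    (hxy : (within G Zᶜ).Reachable x y) : IsGood G Z Z' y :=
  ⟨mem_of_within_reachable hxy h.1, fun a u b v ha hau hu hb hbv hv =>
    h.2 a u b v (hxy.trans ha) hau hu (hxy.trans hb) hbv hv⟩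

/-- The least level at which `x` lies in a good component (zero if there is none). -/
noncomputable def goodLevel (G : SimpleGraph V) (Z : ℕ → Set V) (x : V) : ℕ :=
  sInf {n | IsGood G (Z n) (Z (n + 1)) x}

variable {G : SimpleGraph V} {Z : ℕ → Set V}

/-- The difference of two consecutive sections is disjoint from the components at levels up to `k`, and
each of its connected parts lies in one component at every later level. So the good level is constant
on such a part. -/
theorem goodLevel_eq_of_reachable (hZ : Antitone Z) {k : ℕ} {u v : V}
    (h : (within G (Z k \ Z (k + 1))).Reachable u v) :
    (within G {w | goodLevel G Z w = goodLevel G Z u}).Reachable u v := by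
  have h1 : ∀ a b, (within G (Z k \ Z (k + 1))).Adj a b → ∀ m,
      IsGood G (Z m) (Z (m + 1)) a → IsGood G (Z m) (Z (m + 1)) b := by
    intro a b hab m hm
    rcases le_or_gt m k with hmk | hmk
    · exact absurd (hZ hmk hab.2.1.1) hm.1
    · have h2 : (within G (Z m)ᶜ).Adj a b := ⟨hab.1, fun h => hab.2.1.2 (hZ hmk h),
        fun h => hab.2.2.2 (hZ hmk h)⟩
      exact hm.of_reachable h2.reachable
  have h2 : ∀ a b, (within G (Z k \ Z (k + 1))).Adj a b → goodLevel G Z a = goodLevel G Z b := by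
    intro a b hab
    have : ∀ m, IsGood G (Z m) (Z (m + 1)) a ↔ IsGood G (Z m) (Z (m + 1)) b := fun m =>
      ⟨h1 a b hab m, h1 b a hab.symm m⟩
    simp only [goodLevel, this]
  have h3 := reachable_induction (P := fun v => goodLevel G Z v = goodLevel G Z u ∧
    (within G {w | goodLevel G Z w = goodLevel G Z u}).Reachable u v)
    ⟨rfl, SimpleGraph.Reachable.refl _⟩ (fun a b _ ha hab => by
      have hb := (h2 a b hab).symm.trans ha.1
      exact ⟨hb, ha.2.trans (SimpleGraph.Adj.reachable ⟨hab.1, ha.1, hb⟩)⟩) h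
  exact h3.2

/-- A component of the set where the good level is at most `n` is a good component at some level
`k ≤ n`. -/
theorem exists_isGood_of_goodLevel_le (hZ : Antitone Z) {x : V} {n : ℕ}
    (hgood : ∀ y, G.Reachable x y → ∃ m, IsGood G (Z m) (Z (m + 1)) y)
    (hx : goodLevel G Z x ≤ n) :
    ∃ k ≤ n, IsGood G (Z k) (Z (k + 1)) x ∧
      ∀ y, (within G {z | goodLevel G Z z ≤ n}).Reachable x y →
        (within G (Z k)ᶜ).Reachable x y := by
  classical
  have hmem : ∀ y, G.Reachable x y →
      IsGood G (Z (goodLevel G Z y)) (Z (goodLevel G Z y + 1)) y := fun y hy =>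
    Nat.sInf_mem (s := {n | IsGood G (Z n) (Z (n + 1)) y}) (hgood y hy)
  let P : ℕ → Prop := fun k => IsGood G (Z k) (Z (k + 1)) x
  -- at the greatest good level `k ≤ n`, a vertex of `Z k` next to the component would produce a good
  -- level of `x` between `k` and `n`
  have hk : P (Nat.findGreatest P n) :=
    Nat.findGreatest_spec (P := P) hx (hmem x (SimpleGraph.Reachable.refl _))
  set k := Nat.findGreatest P n
  refine ⟨k, Nat.findGreatest_le n, hk, fun y hy => ?_⟩
  refine reachable_induction (P := fun y => (within G (Z k)ᶜ).Reachable x y)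
    (SimpleGraph.Reachable.refl _) (fun y z hxy hTy hyz => ?_) hy
  have hyk : y ∉ Z k := mem_of_within_reachable hTy hk.1
  suffices hz : z ∉ Z k from
    hTy.trans (SimpleGraph.Adj.reachable ⟨hyz.1, hyk, hz⟩)
  intro hz
  have hxz : G.Reachable x z := (hxy.mono (within_le _ _)).trans hyz.1.reachable
  have hgz := hmem z hxz
  have hkz : k < goodLevel G Z z := by
    by_contra! hle
    exact hgz.1 (hZ hle hz)
  have hTT : within G (Z k)ᶜ ≤ within G (Z (goodLevel G Z z))ᶜ :=
    within_mono le_rfl fun w hw h => hw (hZ hkz.le h)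
  have hzy : (within G (Z (goodLevel G Z z))ᶜ).Adj z y :=
    ⟨hyz.1.symm, hgz.1, fun h => hyk (hZ hkz.le h)⟩
  have hgx : P (goodLevel G Z z) := hgz.of_reachable (hzy.reachable.trans (hTy.mono hTT).symm)
  exact absurd (Nat.le_findGreatest hyz.2.2 hgx) (not_le.2 hkz)

/-- The vertices of bounded good level form finite components. -/
theorem finite_of_goodLevel_le (hZ : Antitone Z) {x : V} {n : ℕ}
    (hfin : ∀ k, {y | (within G (Z k)ᶜ).Reachable x y}.Finite)
    (hgood : ∀ y, G.Reachable x y → ∃ m, IsGood G (Z m) (Z (m + 1)) y) :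
    {y | (within G {z | goodLevel G Z z ≤ n}).Reachable x y}.Finite := by
  by_cases hx : goodLevel G Z x ≤ n
  · obtain ⟨k, -, -, hk⟩ := exists_isGood_of_goodLevel_le hZ hgood hx
    exact (hfin k).subset hk
  · refine (Set.finite_singleton x).subset fun y hy => ?_
    refine reachable_induction (P := fun y => y = x) rfl ?_ hy
    rintro u v - rfl huv
    exact absurd huv.2.1 hx

/-- All edges that leave a component of the vertices of good level at most `n` upwards end in one
connected piece of a single level. -/
theorem reachable_of_lt_goodLevel (hZ : Antitone Z) {x y u v : V} {n : ℕ}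
    (hgood : ∀ y, G.Reachable x y → ∃ m, IsGood G (Z m) (Z (m + 1)) y)
    (hx : goodLevel G Z x ≤ n) (hxy : (within G {z | goodLevel G Z z ≤ n}).Reachable x y)
    (hxu : G.Adj x u) (hyv : G.Adj y v) (hu : n < goodLevel G Z u) (hv : n < goodLevel G Z v) :
    (within G {w | goodLevel G Z w = goodLevel G Z u}).Reachable u v := by
  obtain ⟨k, hkn, hgx, hk⟩ := exists_isGood_of_goodLevel_le hZ hgood hx
  have hTy := hk y hxy
  have hyk : y ∉ Z k := mem_of_within_reachable hTy hgx.1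
  have hmem : ∀ a w, (within G (Z k)ᶜ).Reachable x a → G.Adj a w → n < goodLevel G Z w →
      w ∈ Z k := by
    intro a w ha haw hw
    by_contra hwk
    have hak : a ∉ Z k := mem_of_within_reachable ha hgx.1
    have h1 : (within G (Z k)ᶜ).Adj a w := ⟨haw, hak, hwk⟩
    have h2 := hgx.of_reachable (ha.trans h1.reachable)
    exact absurd ((Nat.sInf_le h2).trans hkn) (not_le.2 hw)
  exact goodLevel_eq_of_reachable hZ (hgx.2 x u y v (SimpleGraph.Reachable.refl _) hxu
    (hmem x u (SimpleGraph.Reachable.refl _) hxu hu) hTy hyv (hmem y v hTy hyv hv))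

end Layers

section Vanishing

variable {X : Type*} [MeasurableSpace X]

/-- A decreasing sequence of sections that eventually leave almost every vertex, with finite
components of the complements. -/
structure IsVanishing (G : SimpleGraph X) (μ : Measure X) (Z : ℕ → Set X) : Prop where
  antitone : Antitone Z
  isSection : ∀ n, IsSection G μ (Z n)
  finite : ∀ n x, {y | (within G (Z n)ᶜ).Reachable x y}.Finite
  ae_exists : ∀ᵐ x ∂μ, ∃ n, x ∉ Z n

/-- A Borel numbering of the vertices by layers such that the vertices below any level fall into
finite components, and the neighbours above the level of each such component lie in one connected
component of a single layer. -/
structure IsLayering (G : SimpleGraph X) (μ : Measure X) (lam : X → ℕ) : Prop where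
  measurable : Measurable lam
  ae_finite : ∀ᵐ x ∂μ, ∀ n, {y | (within G {z | lam z ≤ n}).Reachable x y}.Finite
  ae_reachable : ∀ᵐ x ∂μ, ∀ n y u v, lam x ≤ n → (within G {z | lam z ≤ n}).Reachable x y →
    G.Adj x u → G.Adj y v → n < lam u → n < lam v → (within G {z | lam z = lam u}).Reachable u v

variable [StandardBorelSpace X] {G : SimpleGraph X} {μ : Measure X} {e : ℕ → X → X}

theorem IsTame.measurable_isGood (hG : IsTame G μ e) {Z Z' : Set X} (hZ : MeasurableSet Z)
    (hZ' : MeasurableSet Z') : Measurable fun x => IsGood G Z Z' x := by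
  have hT := hG.measurable_reachable_of_le (within_le G Zᶜ)
    (measurable_within_const hG.measurable_adj hZ.compl)
  have hU := hG.measurable_reachable_of_le (within_le G (Z \ Z'))
    (measurable_within_const hG.measurable_adj (hZ.diff hZ'))
  have hZm : Measurable fun x => x ∈ Z := measurableSet_setOfPred.1 hZ
  have hA := hG.measurable_adj
  refine hZm.not.and ?_
  refine hG.measurable_forall (π := id) measurable_id ?_ ?_
  swap
  · intro x a h
    push Not at h
    obtain ⟨-, -, -, h, -⟩ := h
    exact h.mono (within_le _ _)
  refine hG.measurable_forall (π := fun q : X × X => q.2) measurable_snd ?_ ?_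
  swap
  · intro q u h
    push Not at h
    obtain ⟨-, -, -, h, -⟩ := h
    exact h.reachable
  refine hG.measurable_forall (π := fun q : (X × X) × X => q.1.1) (by fun_prop) ?_ ?_
  swap
  · intro q b h
    push Not at h
    obtain ⟨-, -, -, -, h, -⟩ := h
    exact h.mono (within_le _ _)
  refine hG.measurable_forall (π := fun q : ((X × X) × X) × X => q.2) measurable_snd ?_ ?_
  swap
  · intro q v h
    push Not at h
    exact h.2.2.2.2.1.reachable
  refine Measurable.imp ?_ (Measurable.imp ?_ (Measurable.imp ?_ (Measurable.imp ?_
    (Measurable.imp ?_ (Measurable.imp ?_ ?_)))))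
  · exact hT.comp (f := fun q : (((X × X) × X) × X) × X => (q.1.1.1.1, q.1.1.1.2)) (by fun_prop)
  · exact hA.comp (f := fun q : (((X × X) × X) × X) × X => (q.1.1.1.2, q.1.1.2)) (by fun_prop)
  · exact hZm.comp (f := fun q : (((X × X) × X) × X) × X => q.1.1.2) (by fun_prop)
  · exact hT.comp (f := fun q : (((X × X) × X) × X) × X => (q.1.1.1.1, q.1.2)) (by fun_prop)
  · exact hA.comp (f := fun q : (((X × X) × X) × X) × X => (q.1.2, q.2)) (by fun_prop)
  · exact hZm.comp (f := fun q : (((X × X) × X) × X) × X => q.2) (by fun_prop)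
  · exact hU.comp (f := fun q : (((X × X) × X) × X) × X => (q.1.1.2, q.2)) (by fun_prop)

/-- As the sections vanish, almost every component of the complement of `Z n` is good for `Z n`
and `Z m`, if `m` is large. -/
theorem IsVanishing.ae_isGood (hG : IsTame G μ e) {Z : ℕ → Set X} (hZ : IsVanishing G μ Z)
    (n : ℕ) : ∀ᵐ x ∂μ, x ∉ Z n → ∃ m, IsGood G (Z n) (Z m) x := by
  filter_upwards [hG.ae_reachable hZ.ae_exists, (hZ.isSection n).ae_reachable] with x hx hxr hxn
  have hTle := within_le G (Z n)ᶜ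
  let U : Set X := {u | u ∈ Z n ∧ ∃ a, (within G (Z n)ᶜ).Reachable x a ∧ G.Adj a u}
  have hUfin : U.Finite := by
    refine ((hZ.finite n x).biUnion fun a _ => hG.finite_neighborSet a).subset ?_
    rintro u ⟨-, a, ha, hau⟩
    exact Set.mem_biUnion ha hau
  have hUx : ∀ u ∈ U, G.Reachable x u := fun u ⟨_, a, ha, hau⟩ =>
    (ha.mono hTle).trans hau.reachable
  have h1 : ∀ u v, ∃ m, u ∈ U → v ∈ U → (within G (Z n \ Z m)).Reachable u v := by
    intro u v
    by_cases huv : u ∈ U ∧ v ∈ U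
    swap
    · exact ⟨0, fun h h' => absurd ⟨h, h'⟩ huv⟩
    obtain ⟨hu, hv⟩ := huv
    have h2 := reachable_induction (P := fun v => ∃ m, (within G (Z n \ Z m)).Reachable u v)
      ⟨0, SimpleGraph.Reachable.refl _⟩ (fun a b hua ⟨m, hm⟩ hab => by
        have hxa := (hUx u hu).trans (hua.mono (within_le _ _))
        obtain ⟨i, hi⟩ := hx a hxa
        obtain ⟨j, hj⟩ := hx b (hxa.trans hab.1.reachable)
        have hmono : ∀ {k}, k ≤ max m (max i j) → Z (max m (max i j)) ⊆ Z k := fun h =>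
          hZ.antitone h
        refine ⟨max m (max i j), (hm.mono (within_mono le_rfl
          (Set.sdiff_subset_sdiff_right (hmono (le_max_left _ _))))).trans
          (SimpleGraph.Adj.reachable ⟨hab.1, ⟨hab.2.1, fun h => hi (hmono ?_ h)⟩,
            ⟨hab.2.2, fun h => hj (hmono ?_ h)⟩⟩)⟩
        · exact (le_max_left _ _).trans (le_max_right _ _)
        · exact (le_max_right _ _).trans (le_max_right _ _))
      (hxr u hu.1 v hv.1 (hUx u hu) (hUx v hv))
    obtain ⟨m, hm⟩ := h2
    exact ⟨m, fun _ _ => hm⟩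
  choose m hm using h1
  obtain ⟨M, hM⟩ := ((hUfin.prod hUfin).image fun q => m q.1 q.2).bddAbove
  refine ⟨M, hxn, fun a u b v ha hau hu hb hbv hv => ?_⟩
  have hu' : u ∈ U := ⟨hu, a, ha, hau⟩
  have hv' : v ∈ U := ⟨hv, b, hb, hbv⟩
  exact (hm u v hu' hv').mono (within_mono le_rfl
    (Set.sdiff_subset_sdiff_right (hZ.antitone (hM ⟨(u, v), ⟨hu', hv'⟩, rfl⟩))))

variable [IsFiniteMeasure μ]

/-- Some small section contains all vertices with an edge leaving their component of `H m`. -/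
theorem exists_isSection_boundary_subset (hG : IsTame G μ e) (hend : ∀ᵐ x ∂μ, OneEndedAt G x)
    {H : ℕ → SimpleGraph X} (hH : IsExhaustion G H) {ε : ℝ≥0∞} (hε : ε ≠ 0) :
    ∃ m W, IsSection G μ W ∧ μ W < ε ∧ ∀ x y, G.Adj x y → ¬(H m).Reachable x y → x ∈ W := by
  obtain ⟨S, hS, hSε⟩ := exists_isSection_measure_lt hG hend hH (ENNReal.half_pos hε).ne'
  obtain ⟨p, π, h1, h2, h3, h4, h5, h6, h7⟩ :=
    hG.exists_parent le_rfl hG.measurable_adj hS.measurableSet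
  have hp : IsParent G S p π := ⟨h1, h2, h3, h4, h5, h6, h7⟩
  -- the vertices on the boundary of the pieces of stage `m`
  let B : ℕ → Set X := fun m => {x | ∃ y, G.Adj x y ∧ ¬(H m).Reachable x y}
  have hBm : ∀ m, MeasurableSet (B m) := fun m =>
    measurableSet_setOfPred.2 (hG.measurable_exists (π := id) measurable_id
      (hG.measurable_adj.and (hG.measurable_reachable_of_le (hH.le m) (hH.measurable_adj m)).not)
      fun x y h => h.1.reachable)
  have hBanti : Antitone B := fun m n hmn x ⟨y, hxy, h⟩ =>
    ⟨y, hxy, fun h' => h (h'.mono (hH.mono hmn))⟩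
  -- the vertices on the parent paths from these boundaries to `S`; they become fewer and fewer, since
  -- only finitely many vertices lie behind a given one
  let C : ℕ → Set X := fun m => {z | ∃ x, x ∈ B m ∧ ∃ k, p^[k] x = z}
  have hCm : ∀ m, MeasurableSet (C m) := by
    intro m
    refine measurableSet_setOfPred.2 (hG.measurable_exists (π := id) measurable_id
      ((measurableSet_setOfPred.1 (measurable_snd (hBm m))).and (Measurable.exists fun k => ?_)) ?_)
    · exact measurable_eq_of_measurable ((hp.measurable_parent.iterate k).comp measurable_snd)
        measurable_fst
    · rintro z x ⟨-, k, rfl⟩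
      exact (reachable_iterate hp.eq_or_adj x k).symm
  have hfib := hG.ae_reachable (hG.ae_finite_fiber hp.measurable_proj hp.reachable)
  have hC0 : μ (⋂ m, C m) = 0 := by
    rw [measure_eq_zero_iff_ae_notMem]
    filter_upwards [hfib] with z hz hzC
    have hfin : {x | π x = π z}.Finite := hz _ (hp.reachable z)
    have h8 : ∀ x, ∃ m, x ∉ B m := by
      intro x
      choose m hm using fun y : {y | G.Adj x y} => hH.exists_adj x y y.2
      have : Finite {y | G.Adj x y} := (hG.finite_neighborSet x).to_subtype
      obtain ⟨M, hM⟩ := (Set.finite_range m).bddAbove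
      refine ⟨M, fun ⟨y, hxy, h⟩ => h ?_⟩
      exact SimpleGraph.Adj.reachable (hH.mono (hM ⟨⟨y, hxy⟩, rfl⟩) (hm ⟨y, hxy⟩))
    choose m hm using h8
    obtain ⟨M, hM⟩ := (hfin.image m).bddAbove
    obtain ⟨x, hx, k, hk⟩ := Set.mem_iInter.1 hzC M
    have hπ : π x = π z := by rw [← hk, iterate_invariant hp.proj_parent]
    exact hm x (hBanti (hM ⟨x, hπ, rfl⟩) hx)
  have ht := tendsto_measure_iInter_atTop (μ := μ) (s := C)
    (fun m => (hCm m).nullMeasurableSet)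
    (fun m n hmn z ⟨x, hx, h⟩ => ⟨x, hBanti hmn hx, h⟩) ⟨0, measure_ne_top _ _⟩
  rw [hC0] at ht
  obtain ⟨m, hm⟩ := (ht.eventually (gt_mem_nhds (ENNReal.half_pos hε))).exists
  refine ⟨m, S ∪ C m, ⟨hS.measurableSet.union (hCm m), ?_, ?_⟩, ?_, ?_⟩
  · filter_upwards [hS.ae_exists] with x ⟨y, hy, hxy⟩
    exact ⟨y, Or.inl hy, hxy⟩
  · filter_upwards [hS.ae_exists, hS.ae_reachable] with x ⟨s, hs, hxs⟩ hx
    have h8 : ∀ y ∈ S ∪ C m, G.Reachable x y →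
        π y ∈ S ∧ (within G (S ∪ C m)).Reachable y (π y) := by
      intro y hy hxy
      refine ⟨hp.proj_mem y ⟨s, hs, hxy.symm.trans hxs⟩, ?_⟩
      rcases hy with hy | ⟨z, hz, j, rfl⟩
      · rw [hp.proj_eq_self hy]
      · obtain ⟨k, hk⟩ := hp.exists_iterate (p^[j] z)
        rw [← hk]
        clear hk
        induction k with
        | zero => exact SimpleGraph.Reachable.refl _
        | succ k ih =>
          refine ih.trans ?_
          rw [Function.iterate_succ_apply']
          rcases hp.eq_or_adj (p^[k] (p^[j] z)) with h | h
          · rw [h]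
          · refine SimpleGraph.Adj.reachable ⟨h, Or.inr ⟨z, hz, k + j, ?_⟩,
              Or.inr ⟨z, hz, k + j + 1, ?_⟩⟩
            · rw [Function.iterate_add_apply]
            · rw [Function.iterate_succ_apply', Function.iterate_add_apply]
    intro y hy z hz hxy hxz
    have hy' := h8 y hy hxy
    have hz' := h8 z hz hxz
    exact (hy'.2.trans ((hx _ hy'.1 _ hz'.1 (hxy.trans (hp.reachable y))
      (hxz.trans (hp.reachable z))).mono (within_mono le_rfl Set.subset_union_left))).trans
      hz'.2.symm
  · calc μ (S ∪ C m) ≤ μ S + μ (C m) := measure_union_le _ _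
      _ < ε / 2 + ε / 2 := ENNReal.add_lt_add hSε hm
      _ = ε := ENNReal.add_halves ε
  · intro x y hxy h
    exact Or.inr ⟨x, ⟨y, hxy, h⟩, 0, rfl⟩

/-- Small sections that contain the boundaries of the finite pieces of the exhaustion meet in almost
every component, so the unions of all but finitely many of them are sections. By the Borel-Cantelli
lemma, these unions vanish. -/
theorem exists_isVanishing (hG : IsTame G μ e) (hend : ∀ᵐ x ∂μ, OneEndedAt G x)
    {H : ℕ → SimpleGraph X} (hH : IsExhaustion G H) : ∃ Z, IsVanishing G μ Z := by
  choose m W hW hWε hmW using fun k : ℕ => exists_isSection_boundary_subset hG hend hH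
    (ε := (2⁻¹ : ℝ≥0∞) ^ k) (pow_ne_zero k (by simp))
  have hsum : ∑' k, μ (W k) ≠ ⊤ := by
    refine ne_top_of_le_ne_top ?_ (ENNReal.tsum_le_tsum fun k => (hWε k).le)
    rw [ENNReal.tsum_geometric]
    simp
  refine ⟨fun n => ⋃ k ≥ n, W k, fun a b hab => Set.biUnion_subset_biUnion_left
    fun k (hk : b ≤ k) => hab.trans hk, fun n => ⟨?_, ?_, ?_⟩, fun n x => ?_, ?_⟩
  · exact MeasurableSet.iUnion fun k => MeasurableSet.iUnion fun _ => (hW k).measurableSet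
  · filter_upwards [(hW n).ae_exists] with x ⟨y, hy, hxy⟩
    exact ⟨y, Set.mem_iUnion₂.2 ⟨n, le_rfl, hy⟩, hxy⟩
  · have hr := ae_all_iff.2 fun k => (hW k).ae_reachable
    filter_upwards [hr, hend] with x hx hinf y hy z hz hxy hxz
    simp only [Set.mem_iUnion, exists_prop] at hy hz
    obtain ⟨k, hk, hyk⟩ := hy
    obtain ⟨l, hl, hzl⟩ := hz
    -- the two sections share the boundary of a finite component
    obtain ⟨w, hw, hw'⟩ := hinf.infinite.exists_notMem_finite (hH.finite (max (m k) (m l)) x)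
    obtain ⟨u, v, hxu, huv, hu, hv⟩ := exists_adj_of_reachable
      (P := fun y => (H (max (m k) (m l))).Reachable x y) (SimpleGraph.Reachable.refl _) hw' hw
    have hmem : ∀ i, m i ≤ max (m k) (m l) → u ∈ W i := fun i hi =>
      hmW i u v huv fun h => hv (hu.trans (h.mono (hH.mono hi)))
    have h1 := hx k y hyk u (hmem k (le_max_left _ _)) hxy hxu
    have h2 := hx l u (hmem l (le_max_right _ _)) z hzl hxu hxz
    exact (h1.mono (within_mono le_rfl (Set.subset_biUnion_of_mem (u := W) hk))).trans
      (h2.mono (within_mono le_rfl (Set.subset_biUnion_of_mem (u := W) hl)))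
  · refine (hH.finite (m n) x).subset fun y hy => ?_
    refine reachable_induction (P := fun y => (H (m n)).Reachable x y)
      (SimpleGraph.Reachable.refl _) (fun u v _ hu huv => hu.trans ?_) hy
    by_contra h
    exact huv.2.1 (Set.mem_iUnion₂.2 ⟨n, le_rfl, hmW n u v huv.1 h⟩)
  · filter_upwards [ae_eventually_notMem hsum] with x hx
    obtain ⟨n, hn⟩ := eventually_atTop.1 hx
    refine ⟨n, ?_⟩
    simp only [Set.mem_iUnion, not_exists]
    exact hn

/-- A subsequence of vanishing sections for which almost every vertex lies in a good component at
some level. -/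
theorem IsVanishing.exists_subsequence (hG : IsTame G μ e) {Z : ℕ → Set X}
    (hZ : IsVanishing G μ Z) :
    ∃ k : ℕ → ℕ, StrictMono k ∧ ∀ᵐ x ∂μ, ∃ n, IsGood G (Z (k n)) (Z (k (n + 1))) x := by
  have hm := fun n => (hZ.isSection n).measurableSet
  have hgm : ∀ n m, MeasurableSet {x | ¬IsGood G (Z n) (Z m) x} := fun n m =>
    measurableSet_setOfPred.2 (hG.measurable_isGood (hm n) (hm m)).not
  have hmono : ∀ n, Antitone fun m => {x | ¬IsGood G (Z n) (Z m) x} := by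
    intro n i j hij x hx h
    refine hx ⟨h.1, fun a u b v ha hau hu hb hbv hv => (h.2 a u b v ha hau hu hb hbv hv).mono ?_⟩
    exact within_mono le_rfl (Set.sdiff_subset_sdiff_right (hZ.antitone hij))
  have h1 : ∀ n, ∃ m > n, μ {x | ¬IsGood G (Z n) (Z m) x} ≤ μ (Z n) + 2⁻¹ ^ n := by
    intro n
    have ht := tendsto_measure_iInter_atTop (μ := μ) (fun m => (hgm n m).nullMeasurableSet)
      (hmono n) ⟨0, measure_ne_top _ _⟩
    have hle : μ (⋂ m, {x | ¬IsGood G (Z n) (Z m) x}) ≤ μ (Z n) := by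
      refine measure_mono_ae ?_
      filter_upwards [hZ.ae_isGood hG n] with x hx hbad
      by_contra hxn
      obtain ⟨m, hm⟩ := hx hxn
      exact Set.mem_iInter.1 hbad m hm
    have hlt : μ (⋂ m, {x | ¬IsGood G (Z n) (Z m) x}) < μ (Z n) + 2⁻¹ ^ n :=
      hle.trans_lt (ENNReal.lt_add_right (measure_ne_top _ _) (pow_ne_zero n (by simp)))
    obtain ⟨m, hm, hmn⟩ := ((ht.eventually (gt_mem_nhds hlt)).and (eventually_gt_atTop n)).exists
    exact ⟨m, hmn, hm.le⟩
  choose g hgn hg using h1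
  let k : ℕ → ℕ := fun i => g^[i] 0
  have hk : ∀ i, k (i + 1) = g (k i) := fun i => Function.iterate_succ_apply' g i 0
  have hkm : StrictMono k := strictMono_nat_of_lt_succ fun i => by rw [hk]; exact hgn _
  refine ⟨k, hkm, ?_⟩
  have hZ0 : Tendsto (fun n => μ (Z n)) atTop (𝓝 0) := by
    have ht := tendsto_measure_iInter_atTop (μ := μ) (fun n => (hm n).nullMeasurableSet)
      hZ.antitone ⟨0, measure_ne_top _ _⟩
    have h0 : μ (⋂ n, Z n) = 0 := by
      rw [measure_eq_zero_iff_ae_notMem]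
      filter_upwards [hZ.ae_exists] with x ⟨n, hn⟩ h
      exact hn (Set.mem_iInter.1 h n)
    rwa [h0] at ht
  have ht : Tendsto (fun i => μ (Z (k i)) + 2⁻¹ ^ k i) atTop (𝓝 0) := by
    have h2 : Tendsto (fun n : ℕ => (2⁻¹ : ℝ≥0∞) ^ n) atTop (𝓝 0) :=
      ENNReal.tendsto_pow_atTop_nhds_zero_of_lt_one (by simp)
    have := (hZ0.add h2).comp hkm.tendsto_atTop
    rwa [add_zero] at this
  rw [ae_iff]
  refine le_antisymm (ge_of_tendsto' ht fun i => ?_) zero_le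
  refine le_trans (measure_mono fun x hx => ?_) (hg (k i))
  simp only [not_exists, Set.mem_ofPred_eq] at hx ⊢
  rw [← hk]
  exact hx i

/-- The layers are given by the good levels with respect to vanishing sections. -/
theorem exists_isLayering (hG : IsTame G μ e) (hend : ∀ᵐ x ∂μ, OneEndedAt G x)
    {H : ℕ → SimpleGraph X} (hH : IsExhaustion G H) : ∃ lam, IsLayering G μ lam := by
  obtain ⟨Y, hY⟩ := exists_isVanishing hG hend hH
  obtain ⟨k, hk, hgood⟩ := hY.exists_subsequence hG
  let Z : ℕ → Set X := fun n => Y (k n)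
  have hZ : Antitone Z := hY.antitone.comp_monotone hk.monotone
  have hgood' := hG.ae_reachable hgood
  have hgm : ∀ n, MeasurableSet {x | IsGood G (Z n) (Z (n + 1)) x} := fun n =>
    measurableSet_setOfPred.2 (hG.measurable_isGood (hY.isSection _).measurableSet
      (hY.isSection _).measurableSet)
  refine ⟨goodLevel G Z, ?_, ?_, ?_⟩
  · exact measurable_sInf_nat fun n => measurableSet_setOfPred.1 (hgm n)
  · filter_upwards [hgood'] with x hx n
    exact finite_of_goodLevel_le hZ (fun i => hY.finite _ x) hx
  · filter_upwards [hgood'] with x hx n y u v hxn hxy hxu hyv hu hv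
    exact reachable_of_lt_goodLevel hZ hx hxn hxy hxu hyv hu hv

end Vanishing

/-! ### Flows between layers and tree flows -/

section LayerGraph

variable {V : Type*} {G : SimpleGraph V} {lam : V → ℕ}

/-- The edges of `G` inside the layers of `lam`. -/
def layerGraph (G : SimpleGraph V) (lam : V → ℕ) : SimpleGraph V where
  Adj x y := G.Adj x y ∧ lam x = lam y
  symm := ⟨fun _ _ h => ⟨h.1.symm, h.2.symm⟩⟩
  loopless := ⟨fun _ h => h.1.ne rfl⟩

theorem layerGraph_le : layerGraph G lam ≤ G := fun _ _ h => h.1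

theorem lam_eq_of_reachable {x y : V} (h : (layerGraph G lam).Reachable x y) : lam y = lam x :=
  reachable_induction (P := fun y => lam y = lam x) rfl
    (fun _ _ _ hu (huv : (layerGraph G lam).Adj _ _) => huv.2.symm.trans hu) h

theorem layerGraph_reachable_of_within {n : ℕ} {x y : V}
    (h : (within G {z | lam z = n}).Reachable x y) : (layerGraph G lam).Reachable x y :=
  h.mono fun _ _ (hab : (within G {z | lam z = n}).Adj _ _) =>
    ⟨hab.1, hab.2.1.trans hab.2.2.symm⟩

theorem within_reachable_of_layerGraph {x y : V} {n : ℕ} (hx : lam x ≤ n)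
    (h : (layerGraph G lam).Reachable x y) : (within G {z | lam z ≤ n}).Reachable x y :=
  reachable_of_adj_imp (fun u v hu (huv : (layerGraph G lam).Adj u v) => ⟨huv.1, (lam_eq_of_reachable hu).le.trans hx,
    (lam_eq_of_reachable (hu.trans huv.reachable)).le.trans hx⟩) h

/-- The pointwise content of `IsLayering` on the component of `x`. -/
structure IsLayeringAt (G : SimpleGraph V) (lam : V → ℕ) (x : V) : Prop where
  finite : ∀ n, {y | (within G {z | lam z ≤ n}).Reachable x y}.Finite
  reachable : ∀ z, G.Reachable x z → ∀ n y u v, lam z ≤ n →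
    (within G {z | lam z ≤ n}).Reachable z y → G.Adj z u → G.Adj y v → n < lam u → n < lam v →
    (layerGraph G lam).Reachable u v

theorem IsLayeringAt.finite_layer {x : V} (h : IsLayeringAt G lam x) :
    {y | (layerGraph G lam).Reachable x y}.Finite :=
  (h.finite (lam x)).subset fun _ hy => within_reachable_of_layerGraph le_rfl hy

/-- Inside a component of the vertices up to level `n`, the vertices of level `n` are connected. -/
theorem IsLayeringAt.layer_reachable {x y : V} (h : IsLayeringAt G lam x) {n : ℕ} (hx : lam x = n)
    (hy : lam y = n) (hxy : (within G {z | lam z ≤ n}).Reachable x y) :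
    (layerGraph G lam).Reachable x y := by
  -- an excursion below level `n` starts and ends in one connected component of the layer
  refine (reachable_induction (P := fun v => (lam v = n → (layerGraph G lam).Reachable x v) ∧
    (lam v < n → ∀ w u, (within G {z | lam z ≤ n - 1}).Reachable v w → G.Adj w u → lam u = n →
      (layerGraph G lam).Reachable x u)) ⟨fun _ => SimpleGraph.Reachable.refl _,
        fun hlt => absurd hx hlt.ne⟩ ?_ hxy).1 hy
  intro u v hxu ih huv
  have hu : lam u ≤ n := huv.2.1
  have hv : lam v ≤ n := huv.2.2
  have hxv : G.Reachable x v := (hxu.mono (within_le _ _)).trans huv.1.reachable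
  refine ⟨fun hvn => ?_, fun hvn w t hvw hwt ht => ?_⟩
  · rcases hu.eq_or_lt with hun | hun
    · refine (ih.1 hun).trans (SimpleGraph.Adj.reachable ⟨huv.1, hun.trans hvn.symm⟩)
    · exact ih.2 hun u v (SimpleGraph.Reachable.refl _) huv.1 hvn
  · rcases hu.eq_or_lt with hun | hun
    · exact (ih.1 hun).trans (h.reachable v hxv (n - 1) w u t (by omega) hvw huv.1.symm hwt
        (by omega) (by omega))
    · refine ih.2 hun w t (SimpleGraph.Reachable.trans (SimpleGraph.Adj.reachable
        ⟨huv.1, ?_, ?_⟩) hvw) hwt ht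
      · exact Nat.le_sub_one_of_lt hun
      · exact Nat.le_sub_one_of_lt hvn

/-- Edges leaving a component of the vertices up to level `n` upwards start at level `n`, if this
component has a vertex of level `n`. -/
theorem IsLayeringAt.lam_eq {x z y : V} (h : IsLayeringAt G lam x)
    (hxz : (within G {w | lam w ≤ lam x}).Reachable x z) (hzy : G.Adj z y) (hy : lam x < lam y) :
    lam z = lam x := by
  have hz : lam z ≤ lam x := mem_of_within_reachable (S := {w | lam w ≤ lam x}) hxz
    (show lam x ≤ lam x from le_rfl)
  by_contra hne
  have hlt : lam z < lam x := lt_of_le_of_ne hz hne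
  obtain ⟨u, v, hu, huv, hzu, hzv⟩ := exists_adj_of_reachable
    (P := fun w => (within G {w | lam w ≤ lam z}).Reachable z w) (SimpleGraph.Reachable.refl _)
    (fun h' => absurd (mem_of_within_reachable (S := {w | lam w ≤ lam z}) h'
      (show lam z ≤ lam z from le_rfl))
      (not_le.2 hlt)) hxz.symm
  have huz : lam u ≤ lam z := mem_of_within_reachable (S := {w | lam w ≤ lam z}) hzu
    (show lam z ≤ lam z from le_rfl)
  have hv : lam z < lam v := by
    by_contra! hle
    exact hzv (hzu.trans (SimpleGraph.Adj.reachable ⟨huv.1, huz, hle⟩))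
  have h1 := h.reachable z (hxz.mono (within_le _ _)) (lam z) u y v le_rfl hzu hzy huv.1
    (hlt.trans hy) hv
  have h2 := lam_eq_of_reachable h1
  have h3 : lam v ≤ lam x := huv.2.2
  omega

theorem sum_sum_eq_zero_of_antisymm (S : Finset V) {φ : V → V → ℝ}
    (h : ∀ x ∈ S, ∀ y ∈ S, φ x y = -φ y x) : ∑ x ∈ S, ∑ y ∈ S, φ x y = 0 := by
  have h1 : ∑ x ∈ S, ∑ y ∈ S, φ x y = ∑ x ∈ S, ∑ y ∈ S, -φ y x :=
    Finset.sum_congr rfl fun x hx => Finset.sum_congr rfl fun y hy => h x hx y hy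
  have h2 : ∑ x ∈ S, ∑ y ∈ S, -φ y x = -∑ x ∈ S, ∑ y ∈ S, φ x y := by
    rw [Finset.sum_comm]
    simp only [Finset.sum_neg_distrib]
  linarith

/-- The flow conditions at the vertex `x`, with the bound `C`. -/
structure IsFlowAt (f : V → ℤ) (C : ℝ) (φ : V → V → ℝ) (x : V) : Prop where
  antisymm : ∀ y, φ x y = -φ y x
  bound : ∀ y, |φ x y| ≤ C
  sum : ∑ᶠ y, φ x y = f x

open Classical in
/-- The net flow of `φ` from `x` to higher layers. -/
noncomputable def flowUp (lam : V → ℕ) (φ : V → V → ℝ) (x : V) : ℝ :=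
  ∑ᶠ y, if lam x < lam y then φ x y else 0

open Classical in
/-- The net flow of `φ` from `x` to lower layers. -/
noncomputable def flowDown (lam : V → ℕ) (φ : V → V → ℝ) (x : V) : ℝ :=
  ∑ᶠ y, if lam y < lam x then φ x y else 0

variable {f : V → ℤ} {C : ℝ} {φ : V → V → ℝ}

open Classical in
/-- The total flow from a component of a layer to the higher layers is the net flow out of the
finite set of vertices below, and thus an integer. -/
theorem IsLayeringAt.exists_flowUp_eq (h : IsLayeringAt G lam x)
    (hN : ∀ x, {y | G.Adj x y}.Finite) (hsupp : ∀ x y, φ x y ≠ 0 → G.Adj x y)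
    (hφ : ∀ y, G.Reachable x y → IsFlowAt f C φ y) :
    ∃ k : ℤ, ∑ᶠ z, (if (layerGraph G lam).Reachable x z then flowUp lam φ z else 0) = k := by
  set n := lam x with hn
  let M := (h.finite n).toFinset
  have hM : ∀ z, z ∈ M ↔ (within G {w | lam w ≤ n}).Reachable x z := fun z => by simp [M]
  have hMn : ∀ z ∈ M, lam z ≤ n := fun z hz =>
    mem_of_within_reachable (S := {w | lam w ≤ n}) ((hM z).1 hz) hn.ge
  have hMG : ∀ z ∈ M, G.Reachable x z := fun z hz => ((hM z).1 hz).mono (within_le _ _)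
  have hM' : ∀ z ∈ M, ∀ y, G.Adj z y → (y ∈ M ↔ lam y ≤ n) := fun z hz y hzy =>
    ⟨hMn y, fun hy => (hM y).2 (((hM z).1 hz).trans
      (SimpleGraph.Adj.reachable ⟨hzy, hMn z hz, hy⟩))⟩
  have hfin : ∀ z, (Function.support fun y => φ z y).Finite := fun z =>
    (hN z).subset fun y hy => hsupp z y hy
  have hsub : ∀ (z : V) (P : V → Prop) [DecidablePred P],
      (Function.support fun y => if P y then φ z y else 0) ⊆
      Function.support fun y => φ z y := fun z P _ y hy h0 => hy (by
        simp only at h0 ⊢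
        rw [h0, ite_self])
  refine ⟨∑ z ∈ M, f z, ?_⟩
  rw [finsum_eq_sum_of_support_subset (s := M)]
  swap
  · intro z hz
    rw [Finset.mem_coe, hM]
    refine within_reachable_of_layerGraph hn.ge ?_
    by_contra hne
    exact hz (if_neg hne)
  have h1 : ∀ z ∈ M, (if (layerGraph G lam).Reachable x z then flowUp lam φ z else 0) =
      f z - ∑ y ∈ M, φ z y := by
    intro z hz
    have h2 : ∑ᶠ y, (if y ∈ M then φ z y else 0) = ∑ y ∈ M, φ z y := by
      rw [finsum_eq_sum_of_support_subset (s := M)]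
      · exact Finset.sum_congr rfl fun y hy => if_pos hy
      · intro y hy
        by_contra hne
        exact hy (if_neg hne)
    have h3 : (f z : ℝ) = ∑ᶠ y, (if y ∈ M then φ z y else 0) +
        ∑ᶠ y, (if y ∉ M then φ z y else 0) := by
      rw [← finsum_add_distrib ((hfin z).subset (hsub z _)) ((hfin z).subset (hsub z _)),
        ← (hφ z (hMG z hz)).sum]
      refine finsum_congr fun y => ?_
      by_cases hy : y ∈ M <;> simp [hy]
    rw [h3, h2, add_sub_cancel_left]
    split_ifs with hxz
    · rw [flowUp]
      have hzn : lam z = n := lam_eq_of_reachable hxz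
      refine finsum_congr fun y => ?_
      by_cases hzy : G.Adj z y
      · have := hM' z hz y hzy
        rw [hzn]
        by_cases hy : y ∈ M
        · rw [if_neg (not_lt.2 (this.1 hy)), if_neg (not_not.2 hy)]
        · rw [if_pos (not_le.1 fun h => hy (this.2 h)), if_pos hy]
      · have : φ z y = 0 := by
          by_contra hne
          exact hzy (hsupp z y hne)
        simp [this]
    · rw [finsum_eq_zero_of_forall_eq_zero]
      intro y
      by_contra hne
      have hy : y ∉ M := fun hy => hne (if_neg (not_not.2 hy))
      rw [if_pos hy] at hne
      have hzy := hsupp z y hne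
      have hyn : n < lam y := not_le.1 fun h => hy ((hM' z hz y hzy).2 h)
      have hzn := h.lam_eq ((hM z).1 hz) hzy hyn
      exact hxz (h.layer_reachable hn.symm (hzn.trans hn.symm) ((hM z).1 hz))
  rw [Finset.sum_congr rfl h1, Finset.sum_sub_distrib, sum_sum_eq_zero_of_antisymm M
    fun z hz y _ => (hφ z (hMG z hz)).antisymm y]
  push_cast
  ring

open Classical in
/-- The total flow from a component of a layer to the lower layers is an integer, since the flow to the
higher layers and the net flow out of the component are. -/
theorem IsLayeringAt.exists_flowDown_eq (h : IsLayeringAt G lam x)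
    (hN : ∀ x, {y | G.Adj x y}.Finite) (hsupp : ∀ x y, φ x y ≠ 0 → G.Adj x y)
    (hφ : ∀ y, G.Reachable x y → IsFlowAt f C φ y) :
    ∃ k : ℤ, ∑ᶠ z, (if (layerGraph G lam).Reachable x z then flowDown lam φ z else 0) = k := by
  obtain ⟨k, hk⟩ := h.exists_flowUp_eq hN hsupp hφ
  let M := h.finite_layer.toFinset
  have hM : ∀ z, z ∈ M ↔ (layerGraph G lam).Reachable x z := fun z => by simp [M]
  have hMG : ∀ z ∈ M, G.Reachable x z := fun z hz => ((hM z).1 hz).mono layerGraph_le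
  have hfin : ∀ z, (Function.support fun y => φ z y).Finite := fun z =>
    (hN z).subset fun y hy => hsupp z y hy
  have hsub : ∀ (z : V) (P : V → Prop) [DecidablePred P],
      (Function.support fun y => if P y then φ z y else 0).Finite :=
    fun z P _ => (hfin z).subset fun y hy h0 => hy (by
        simp only at h0 ⊢
        rw [h0, ite_self])
  have hsum : ∀ F : V → ℝ, ∑ᶠ z, (if (layerGraph G lam).Reachable x z then F z else 0) =
      ∑ z ∈ M, F z := by
    intro F
    rw [finsum_eq_sum_of_support_subset (s := M)]
    · exact Finset.sum_congr rfl fun z hz => if_pos ((hM z).1 hz)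
    · intro z hz
      rw [Finset.mem_coe, hM]
      by_contra hne
      exact hz (if_neg hne)
  rw [hsum] at hk ⊢
  refine ⟨∑ z ∈ M, f z - k, ?_⟩
  have h1 : ∀ z ∈ M, flowDown lam φ z = f z - flowUp lam φ z - ∑ y ∈ M, φ z y := by
    intro z hz
    have h2 : ∑ᶠ y, (if y ∈ M then φ z y else 0) = ∑ y ∈ M, φ z y := by
      rw [finsum_eq_sum_of_support_subset (s := M)]
      · exact Finset.sum_congr rfl fun y hy => if_pos hy
      · intro y hy
        by_contra hne
        exact hy (if_neg hne)
    have h3 : (f z : ℝ) = flowDown lam φ z + (flowUp lam φ z +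
        ∑ᶠ y, (if y ∈ M then φ z y else 0)) := by
      rw [flowUp, flowDown, ← finsum_add_distrib (hsub z _) (hsub z _), ← finsum_add_distrib
        (hsub z _), ← (hφ z (hMG z hz)).sum]
      · refine finsum_congr fun y => ?_
        by_cases hzy : G.Adj z y
        · have hy : y ∈ M ↔ lam y = lam z := by
            rw [hM]
            have hz' := (hM z).1 hz
            exact ⟨fun hy => (lam_eq_of_reachable hy).trans (lam_eq_of_reachable hz').symm,
              fun hy => hz'.trans (SimpleGraph.Adj.reachable ⟨hzy, hy.symm⟩)⟩
          rcases lt_trichotomy (lam y) (lam z) with hlt | heq | hgt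
          · simp [hy, hlt, hlt.not_gt, hlt.ne]
          · simp [hy, heq]
          · simp [hy, hgt, hgt.not_gt, hgt.ne']
        · have : φ z y = 0 := by
            by_contra hne
            exact hzy (hsupp z y hne)
          simp [this]
      · refine ((hsub z fun y => lam z < lam y).union (hsub z fun y => y ∈ M)).subset ?_
        exact Function.support_add _ _
    rw [h2] at h3
    linarith
  rw [Finset.sum_congr rfl h1, Finset.sum_sub_distrib, Finset.sum_sub_distrib,
    sum_sum_eq_zero_of_antisymm M fun z hz y _ => (hφ z (hMG z hz)).antisymm y, hk]
  push_cast
  ring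

end LayerGraph

section TreeFlow

variable {X : Type*} [MeasurableSpace X] {A : SimpleGraph X} {Y : Set X} {p π : X → X}

/-- Parents have no cycles, except that roots are their own parents. -/
theorem IsParent.eq_of_periodic (hp : IsParent A Y p π) {x : X} (hx : ∃ y ∈ Y, A.Reachable x y)
    {n : ℕ} (h : p^[n + 1] x = x) : p x = x := by
  obtain ⟨k, hk⟩ := hp.exists_iterate x
  have hfix : p (π x) = π x := hp.eq_self _ (hp.proj_mem x hx)
  have h1 : p^[(n + 1) * k] x = x := (show Function.IsPeriodicPt p (n + 1) x from h).mul_const k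
  rw [add_mul, one_mul, Function.iterate_add_apply, hk, Function.iterate_fixed hfix] at h1
  rw [← h1, hfix]

open Classical in
/-- The total demand of the descendants of `x`. -/
noncomputable def descendantSum (p : X → X) (d : X → ℝ) (x : X) : ℝ :=
  ∑ᶠ z, if ∃ k, p^[k] z = x then d z else 0

open Classical in
/-- The flow that carries the demands `d` along the edges from vertices to their parents. -/
noncomputable def treeFlow (p : X → X) (d : X → ℝ) (x y : X) : ℝ :=
  (if x ≠ y ∧ p y = x then descendantSum p d y else 0) -
    if x ≠ y ∧ p x = y then descendantSum p d x else 0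

open Classical in
theorem treeFlow_antisymm {V : Type*} (p : V → V) (d : V → ℝ) (x y : V) :
    treeFlow p d x y = -treeFlow p d y x := by
  have h (a b : V) (P : Prop) (t : ℝ) :
      (if a ≠ b ∧ P then t else 0) = if b ≠ a ∧ P then t else 0 :=
    if_congr (and_congr_left' ne_comm) rfl rfl
  rw [treeFlow, treeFlow, h y x, h y x]
  ring

theorem IsParent.adj_of_treeFlow_ne_zero (hp : IsParent A Y p π) {d : X → ℝ} {x y : X}
    (h : treeFlow p d x y ≠ 0) : A.Adj x y := by
  by_contra hxy
  refine h ?_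
  rw [treeFlow, if_neg, if_neg, sub_zero]
  · rintro ⟨hne, rfl⟩
    exact hxy ((hp.eq_or_adj x).resolve_left hne.symm)
  · rintro ⟨hne, rfl⟩
    exact hxy ((hp.eq_or_adj y).resolve_left hne).symm

open Classical in
/-- The tree flow satisfies the demands except at the roots, where the total demand of the component
arrives. -/
theorem IsParent.sum_children (hp : IsParent A Y p π) {d : X → ℝ} {x : X}
    (hx : ∃ y ∈ Y, A.Reachable x y) (hfin : {y | A.Reachable x y}.Finite) :
    ∑ᶠ y, treeFlow p d x y = (if p x = x then descendantSum p d x else 0) - d x := by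
  let C := hfin.toFinset
  have hC : ∀ y, y ∈ C ↔ A.Reachable x y := fun y => by simp [C]
  have hxC : x ∈ C := (hC x).2 (SimpleGraph.Reachable.refl _)
  have hpC : p x ∈ C := (hC _).2 (by
    have := reachable_iterate hp.eq_or_adj x 1
    exact this)
  have hD : ∀ w ∈ C, descendantSum p d w = ∑ z ∈ C, if ∃ k, p^[k] z = w then d z else 0 := by
    intro w hw
    rw [descendantSum, finsum_eq_sum_of_support_subset]
    intro z hz
    have h1 : ∃ k, p^[k] z = w := by
      by_contra hne
      exact hz (if_neg hne)
    obtain ⟨k, rfl⟩ := h1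
    rw [Finset.mem_coe, hC]
    exact ((hC _).1 hw).trans (reachable_iterate hp.eq_or_adj z k).symm
  rw [finsum_eq_sum_of_support_subset (s := C)]
  swap
  · intro y hy
    rw [Finset.mem_coe, hC]
    exact (hp.adj_of_treeFlow_ne_zero hy).reachable
  simp only [treeFlow]
  rw [Finset.sum_sub_distrib]
  -- every proper descendant of `x` is a descendant of exactly one child of `x`
  have hchild : ∀ z ∈ C, ∑ y ∈ C, (if (x ≠ y ∧ p y = x) ∧ ∃ k, p^[k] z = y then (1 : ℝ) else 0) =
      (if ∃ k, p^[k] z = x then 1 else 0) - if z = x then 1 else 0 := by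
    intro z hz
    by_cases hzx : z = x
    · subst hzx
      rw [if_pos ⟨0, rfl⟩, if_pos rfl, sub_self]
      refine Finset.sum_eq_zero fun y _ => if_neg ?_
      rintro ⟨⟨hne, hpy⟩, k, rfl⟩
      rw [← Function.iterate_succ_apply' p] at hpy
      exact hne (Function.iterate_fixed (hp.eq_of_periodic hx hpy) k).symm
    rw [if_neg hzx, sub_zero]
    by_cases hk : ∃ k, p^[k] z = x
    swap
    · rw [if_neg hk]
      refine Finset.sum_eq_zero fun y _ => if_neg ?_
      rintro ⟨⟨-, hpy⟩, k, rfl⟩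
      exact hk ⟨k + 1, by rw [Function.iterate_succ_apply', hpy]⟩
    rw [if_pos hk]
    have hspec := Nat.find_spec hk
    set k := Nat.find hk with hkdef
    obtain ⟨j, hj⟩ : ∃ j, k = j + 1 := by
      refine Nat.exists_eq_succ_of_ne_zero fun h0 => hzx ?_
      rw [h0] at hspec
      exact hspec
    rw [hj, Function.iterate_succ_apply'] at hspec
    have hne : x ≠ p^[j] z := fun h => Nat.find_min hk (m := j) (by omega) h.symm
    rw [Finset.sum_eq_single (p^[j] z), if_pos ⟨⟨hne, hspec⟩, j, rfl⟩]
    · intro y _ hy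
      refine if_neg ?_
      rintro ⟨⟨hney, hpy⟩, i, rfl⟩
      -- two different children on the way would make `x` periodic
      have key : ∀ a b : ℕ, a < b → p (p^[a] z) = x → p (p^[b] z) = x → x ≠ p^[b] z → False := by
        intro a b hab ha hb hneb
        obtain ⟨c, rfl⟩ := Nat.exists_eq_add_of_lt hab
        have e1 : p^[c] x = p^[a + c + 1] z := by
          rw [← ha, ← Function.iterate_succ_apply' p, ← Function.iterate_add_apply]
          congr 1
          omega
        have e2 : p^[c + 1] x = x := by rw [Function.iterate_succ_apply', e1, hb]
        exact hneb (e1 ▸ (Function.iterate_fixed (hp.eq_of_periodic hx e2) c).symm)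
      rcases lt_trichotomy i j with hij | rfl | hij
      · exact key i j hij hpy hspec hne
      · exact hy rfl
      · exact key j i hij hspec hpy hney
    · intro hnot
      exact absurd ((hC _).2 (((hC z).1 hz).trans (reachable_iterate hp.eq_or_adj z j))) hnot
  have h1 : ∑ y ∈ C, (if x ≠ y ∧ p y = x then descendantSum p d y else 0) =
      descendantSum p d x - d x := by
    have h2 : ∀ y ∈ C, (if x ≠ y ∧ p y = x then descendantSum p d y else 0) =
        ∑ z ∈ C, d z * if (x ≠ y ∧ p y = x) ∧ ∃ k, p^[k] z = y then 1 else 0 := by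
      intro y hy
      by_cases h : x ≠ y ∧ p y = x
      · rw [if_pos h, hD y hy]
        refine Finset.sum_congr rfl fun z _ => ?_
        by_cases hk : ∃ k, p^[k] z = y
        · rw [if_pos hk, if_pos ⟨h, hk⟩, mul_one]
        · rw [if_neg hk, if_neg fun h' => hk h'.2, mul_zero]
      · rw [if_neg h]
        exact (Finset.sum_eq_zero fun z _ => by rw [if_neg fun h' => h h'.1, mul_zero]).symm
    rw [Finset.sum_congr rfl h2, Finset.sum_comm]
    have h3 : ∀ z ∈ C, ∑ y ∈ C, d z * (if (x ≠ y ∧ p y = x) ∧ ∃ k, p^[k] z = y then (1 : ℝ) else 0) =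
        (if ∃ k, p^[k] z = x then d z else 0) - if z = x then d z else 0 := by
      intro z hz
      rw [← Finset.mul_sum, hchild z hz, mul_sub, mul_ite, mul_ite, mul_one, mul_zero]
    rw [Finset.sum_congr rfl h3, Finset.sum_sub_distrib, hD x hxC, Finset.sum_ite_eq', if_pos hxC]
  have h4 : ∑ y ∈ C, (if x ≠ y ∧ p x = y then descendantSum p d x else 0) =
      if p x = x then 0 else descendantSum p d x := by
    split_ifs with hpx
    · refine Finset.sum_eq_zero fun y _ => if_neg ?_
      rintro ⟨hne, rfl⟩
      exact hne hpx.symm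
    · rw [Finset.sum_eq_single (p x)]
      · exact if_pos ⟨Ne.symm hpx, rfl⟩
      · intro y _ hy
        exact if_neg fun h => hy h.2.symm
      · exact fun h => absurd hpC h
  rw [h1, h4]
  split_ifs <;> ring

variable [StandardBorelSpace X] {G : SimpleGraph X} {e : ℕ → X → X}

open Classical in
/-- Demands with integer total on every finite component are satisfied, up to integers, by a Borel
flow: it carries all demands to a root of the component. -/
theorem IsEnum.exists_treeFlow (he : IsEnum G e) (hA : A ≤ G)
    (hAm : Measurable fun q : X × X => A.Adj q.1 q.2) {d : X → ℝ} (hd : Measurable d) :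
    ∃ g : X → X → ℝ, (Measurable fun q : X × X => g q.1 q.2) ∧ (∀ x y, g x y = -g y x) ∧
      (∀ x y, g x y ≠ 0 → A.Adj x y) ∧ ∀ x, {y | A.Reachable x y}.Finite →
        (∃ k : ℤ, ∑ᶠ z, (if A.Reachable x z then d z else 0) = k) →
        ∃ m : ℤ, ∑ᶠ y, g x y + d x = m := by
  obtain ⟨r, hrm, hr⟩ := he.exists_rank hA hAm
  have hAR := he.measurable_reachable_of_le hA hAm
  -- the root of a finite component is its vertex of least rank
  let Y : Set X := {x | ∀ y, A.Reachable x y → r x ≤ r y}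
  have hY : MeasurableSet Y := by
    refine measurableSet_setOfPred.2 (he.measurable_forall (π := id) measurable_id
      (hAR.imp (measurableSet_setOfPred.1 (measurableSet_le (hrm.comp measurable_fst)
        (hrm.comp measurable_snd)))) fun x y h => ?_)
    rw [Classical.not_imp] at h
    exact h.1.mono hA
  obtain ⟨p, π, h1, h2, h3, h4, h5, h6, h7⟩ := he.exists_parent hA hAm hY
  have hp : IsParent A Y p π := ⟨h1, h2, h3, h4, h5, h6, h7⟩
  have hroot : ∀ x, ∃ y ∈ Y, A.Reachable x y := by
    intro x
    obtain ⟨y, hy, hmin⟩ := WellFounded.has_min (InvImage.wf r wellFounded_lt)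
      {y | A.Reachable x y} ⟨x, SimpleGraph.Reachable.refl _⟩
    exact ⟨y, fun z hz => not_lt.1 (hmin z (SimpleGraph.Reachable.trans hy hz)), hy⟩
  have hDm : Measurable fun x => descendantSum p d x := by
    refine he.measurable_finsum (π := id) measurable_id
      (f := fun x z => if ∃ k, p^[k] z = x then d z else 0) ?_ ?_
    · refine Measurable.ite (measurableSet_setOfPred.2 (Measurable.exists fun k => ?_))
        (hd.comp measurable_snd) measurable_const
      exact measurable_eq_of_measurable ((h1.iterate k).comp measurable_snd) measurable_fst
    · intro x z h
      have : ∃ k, p^[k] z = x := by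
        by_contra hne
        exact h (if_neg hne)
      obtain ⟨k, rfl⟩ := this
      exact ((reachable_iterate h4 z k).mono hA).symm
  refine ⟨treeFlow p d, ?_, treeFlow_antisymm p d, fun x y => hp.adj_of_treeFlow_ne_zero, ?_⟩
  · have hne : Measurable fun q : X × X => q.1 ≠ q.2 :=
      (measurable_eq_of_measurable measurable_fst measurable_snd).not
    refine Measurable.sub (Measurable.ite (measurableSet_setOfPred.2 (hne.and
      (measurable_eq_of_measurable (h1.comp measurable_snd) measurable_fst)))
      (hDm.comp measurable_snd) measurable_const) (Measurable.ite (measurableSet_setOfPred.2 (hne.and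
      (measurable_eq_of_measurable (h1.comp measurable_fst) measurable_snd)))
      (hDm.comp measurable_fst) measurable_const)
  · rintro x hfin ⟨k, hk⟩
    rw [hp.sum_children (hroot x) hfin, sub_add_cancel]
    split_ifs with hpx
    · refine ⟨k, ?_⟩
      rw [← hk, descendantSum]
      refine finsum_congr fun z => ?_
      have hxY : ∀ w, p w = w → π w = w := fun w hw => by
        obtain ⟨j, hj⟩ := h5 w
        rw [← hj, Function.iterate_fixed hw]
      have : (∃ k, p^[k] z = x) ↔ A.Reachable x z := by
        constructor
        · rintro ⟨j, rfl⟩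
          exact (reachable_iterate h4 z j).symm
        · intro hxz
          have hz := hp.proj_mem z (hroot z)
          have hx : x ∈ Y := by
            have := hp.proj_mem x (hroot x)
            rwa [hxY x hpx] at this
          have hxπ : A.Reachable x (π z) := hxz.trans (hp.reachable z)
          have : x = π z := hr x hfin (SimpleGraph.Reachable.refl _) hxπ
            (le_antisymm (hx _ hxπ) (hz _ hxπ.symm))
          obtain ⟨j, hj⟩ := h5 z
          exact ⟨j, hj.trans this.symm⟩
      simp only [this]
    · exact ⟨0, by simp⟩

end TreeFlow

/-! ### Rounding layer by layer -/

section StageFlow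

variable {V : Type*} {G : SimpleGraph V} {lam : V → ℕ} {f : V → ℤ} {C : ℝ}
  {φ gDown gUp : V → V → ℝ} {x y : V} {j : ℕ}

/-- The component of `x` in its layer lies below level `j` and is joined to level `j` by an edge. -/
def IsBelow (G : SimpleGraph V) (lam : V → ℕ) (j : ℕ) (x : V) : Prop :=
  ∃ y, (layerGraph G lam).Reachable x y ∧ ∃ z, G.Adj y z ∧ lam z = j ∧ lam y < j

theorem IsBelow.lt (h : IsBelow G lam j x) : lam x < j := by
  obtain ⟨y, hy, z, -, -, hlt⟩ := h
  rwa [lam_eq_of_reachable hy] at hlt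

theorem isBelow_congr (h : (layerGraph G lam).Reachable x y) :
    IsBelow G lam j x ↔ IsBelow G lam j y :=
  exists_congr fun _ => and_congr_left' ⟨fun h' => h.symm.trans h', fun h' => h.trans h'⟩

/-- A component of a layer is joined to one higher level only. -/
theorem IsLayeringAt.eq_of_isBelow (h : IsLayeringAt G lam x) (hj : IsBelow G lam j x)
    (hxy : G.Adj x y) (hlt : lam x < lam y) : lam y = j := by
  obtain ⟨w, hw, z, hwz, rfl, hwlt⟩ := hj
  exact (lam_eq_of_reachable (h.reachable x (SimpleGraph.Reachable.refl _) (lam x) w y z le_rfl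
    (within_reachable_of_layerGraph le_rfl hw) hxy hwz hlt
    ((lam_eq_of_reachable hw).ge.trans_lt hwlt))).symm

open Classical in
/-- The part of the flow that is rounded at stage `j`: the flow `φ` on the edges that join level `j`
to lower levels, corrected to integer row sums by `gDown` inside level `j` and by `gUp` inside the
components below level `j`. -/
noncomputable def stageFlow (G : SimpleGraph V) (lam : V → ℕ) (φ gDown gUp : V → V → ℝ) (j : ℕ)
    (x y : V) : ℝ :=
  if lam x = lam y then (if lam x = j then gDown x y else if IsBelow G lam j x then gUp x y else 0)
  else if max (lam x) (lam y) = j then φ x y else 0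

/-- The stage `j` takes place below and on level `j`, that is, in finite components. -/
theorem stageFlow_adj (hsupp : ∀ x y, φ x y ≠ 0 → G.Adj x y)
    (hD : ∀ x y, gDown x y ≠ 0 → (layerGraph G lam).Adj x y)
    (hU : ∀ x y, gUp x y ≠ 0 → (layerGraph G lam).Adj x y)
    (h : stageFlow G lam φ gDown gUp j x y ≠ 0) : (within G {z | lam z ≤ j}).Adj x y := by
  unfold stageFlow at h
  split_ifs at h with h1 h2 h3 h4
  · exact ⟨(hD _ _ h).1, h2.le, (h1.symm.trans h2).le⟩
  · exact ⟨(hU _ _ h).1, h3.lt.le, h1.symm.le.trans h3.lt.le⟩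
  · exact absurd rfl h
  · exact ⟨hsupp _ _ h, (le_max_left _ _).trans h4.le, (le_max_right _ _).trans h4.le⟩
  · exact absurd rfl h

theorem stageFlow_antisymm (hD' : ∀ x y, gDown x y = -gDown y x) (hU' : ∀ x y, gUp x y = -gUp y x)
    (hU : ∀ x y, gUp x y ≠ 0 → (layerGraph G lam).Adj x y) (hx : φ x y = -φ y x) :
    stageFlow G lam φ gDown gUp j x y = -stageFlow G lam φ gDown gUp j y x := by
  unfold stageFlow
  by_cases h1 : lam x = lam y
  · rw [if_pos h1, if_pos h1.symm, h1]
    by_cases h2 : lam y = j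
    · rw [if_pos h2, if_pos h2, hD']
    · rw [if_neg h2, if_neg h2]
      by_cases h3 : gUp x y = 0
      · have h4 : gUp y x = 0 := by rw [hU', h3, neg_zero]
        rw [h3, h4, ite_self, ite_self, neg_zero]
      · have := isBelow_congr (j := j) (hU x y h3).reachable
        by_cases h4 : IsBelow G lam j x
        · rw [if_pos h4, if_pos (this.1 h4), hU']
        · rw [if_neg h4, if_neg fun h => h4 (this.2 h), neg_zero]
  · rw [if_neg h1, if_neg (Ne.symm h1), max_comm, hx]
    split_ifs <;> simp

open Classical in
/-- At every stage, the row sums of the flow that is rounded are integers. -/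
theorem IsLayeringAt.exists_sum_stageFlow (h : IsLayeringAt G lam x)
    (hN : ∀ x, {y | G.Adj x y}.Finite) (hsupp : ∀ x y, φ x y ≠ 0 → G.Adj x y)
    (hφ : ∀ y, G.Reachable x y → IsFlowAt f C φ y)
    (hD : ∀ x y, gDown x y ≠ 0 → (layerGraph G lam).Adj x y)
    (hU : ∀ x y, gUp x y ≠ 0 → (layerGraph G lam).Adj x y)
    (hDs : ∀ x, {y | (layerGraph G lam).Reachable x y}.Finite →
      (∃ k : ℤ, ∑ᶠ z, (if (layerGraph G lam).Reachable x z then flowDown lam φ z else 0) = k) →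
      ∃ m : ℤ, ∑ᶠ y, gDown x y + flowDown lam φ x = m)
    (hUs : ∀ x, {y | (layerGraph G lam).Reachable x y}.Finite →
      (∃ k : ℤ, ∑ᶠ z, (if (layerGraph G lam).Reachable x z then flowUp lam φ z else 0) = k) →
      ∃ m : ℤ, ∑ᶠ y, gUp x y + flowUp lam φ x = m) :
    ∃ k : ℤ, ∑ᶠ y, stageFlow G lam φ gDown gUp j x y = k := by
  have hφfin : ∀ (P : V → Prop) [DecidablePred P],
      (Function.support fun y => if P y then φ x y else 0).Finite :=
    fun P _ => (hN x).subset fun y hy => hsupp x y fun h0 => hy (by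
        simp only
        rw [h0, ite_self])
  have hAfin : ∀ g : V → V → ℝ, (∀ x y, g x y ≠ 0 → (layerGraph G lam).Adj x y) →
      (Function.support fun y => g x y).Finite := fun g hg =>
    (hN x).subset fun y hy => (hg x y hy).1
  by_cases hxj : lam x = j
  · obtain ⟨m, hm⟩ := hDs x h.finite_layer (h.exists_flowDown_eq hN hsupp hφ)
    refine ⟨m, ?_⟩
    rw [← hm, flowDown, ← finsum_add_distrib (hAfin _ hD) (hφfin _)]
    refine finsum_congr fun y => ?_
    unfold stageFlow
    by_cases hxy : lam x = lam y
    · rw [if_pos hxy, if_pos hxj, if_neg hxy.not_gt, add_zero]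
    · have h0 : gDown x y = 0 := by
        by_contra h0
        exact hxy (hD x y h0).2
      rw [if_neg hxy, h0, zero_add]
      refine if_congr ?_ rfl rfl
      rw [hxj] at hxy ⊢
      omega
  by_cases hb : IsBelow G lam j x
  · obtain ⟨m, hm⟩ := hUs x h.finite_layer (h.exists_flowUp_eq hN hsupp hφ)
    refine ⟨m, ?_⟩
    rw [← hm, flowUp, ← finsum_add_distrib (hAfin _ hU) (hφfin _)]
    refine finsum_congr fun y => ?_
    unfold stageFlow
    by_cases hxy : lam x = lam y
    · rw [if_pos hxy, if_neg hxj, if_pos hb, if_neg hxy.not_lt, add_zero]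
    · have h0 : gUp x y = 0 := by
        by_contra h0
        exact hxy (hU x y h0).2
      rw [if_neg hxy, h0, zero_add]
      by_cases hxy0 : φ x y = 0
      · rw [hxy0, ite_self, ite_self]
      · have h1 := h.eq_of_isBelow hb (hsupp x y hxy0)
        have h2 := hb.lt
        refine if_congr ⟨fun h' => ?_, fun h' => ?_⟩ rfl rfl
        · omega
        · have := h1 h'
          omega
  · refine ⟨0, ?_⟩
    rw [Int.cast_zero, finsum_eq_zero_of_forall_eq_zero]
    intro y
    unfold stageFlow
    by_cases hxy : lam x = lam y
    · rw [if_pos hxy, if_neg hxj, if_neg hb]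
    · rw [if_neg hxy]
      by_cases hxy0 : φ x y = 0
      · rw [hxy0, ite_self]
      · refine if_neg fun hmax => hb ⟨x, SimpleGraph.Reachable.refl _, y, hsupp x y hxy0, ?_, ?_⟩
        · omega
        · omega

end StageFlow

section Correction

variable {V : Type*} {G : SimpleGraph V} {lam : V → ℕ} {f : V → ℤ} {C : ℝ}
  {φ : V → V → ℝ} {x y : V} {h : ℕ → V → V → ℤ}

/-- What rounding the stage flows achieves at `x`. -/
structure IsStageRounding (θ : ℕ → V → V → ℝ) (h : ℕ → V → V → ℤ) (x : V) : Prop where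
  antisymm : ∀ j y, h j x y = -h j y x
  abs_sub_lt : ∀ j y, |(h j x y : ℝ) - θ j x y| < 1
  sum : ∀ j, ∑ᶠ y, (h j x y : ℝ) = ∑ᶠ y, θ j x y

theorem IsStageRounding.eq_zero {θ : ℕ → V → V → ℝ} (hr : IsStageRounding θ h x) {j : ℕ}
    (h0 : θ j x y = 0) : h j x y = 0 := by
  have h1 := hr.abs_sub_lt j y
  rw [h0, sub_zero] at h1
  exact Int.abs_lt_one_iff.1 (by exact_mod_cast h1)

open Classical in
/-- The flow `φ` corrected at `x` by the two stages that affect `x`: the stage of the level of `x`,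
and the stage of the level to which the component of `x` in its layer is joined from below. -/
noncomputable def correctedFlow (G : SimpleGraph V) (lam : V → ℕ) (φ : V → V → ℝ)
    (θ : ℕ → V → V → ℝ) (h : ℕ → V → V → ℤ) (x y : V) : ℝ :=
  φ x y + (h (lam x) x y - θ (lam x) x y) +
    if IsBelow G lam (sInf {j | IsBelow G lam j x}) x then
      h (sInf {j | IsBelow G lam j x}) x y - θ (sInf {j | IsBelow G lam j x}) x y else 0

theorem abs_correctedFlow_sub_le {θ : ℕ → V → V → ℝ} (hr : IsStageRounding θ h x) (y : V) :
    |correctedFlow G lam φ θ h x y - φ x y| ≤ 2 := by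
  unfold correctedFlow
  set k := sInf {j | IsBelow G lam j x}
  have h1 := hr.abs_sub_lt (lam x) y
  have h2 := hr.abs_sub_lt k y
  split_ifs
  · rw [abs_lt] at h1 h2
    rw [abs_le]
    constructor <;> linarith [h1.1, h1.2, h2.1, h2.2]
  · rw [abs_lt] at h1
    rw [abs_le]
    constructor <;> linarith [h1.1, h1.2]

theorem correctedFlow_eq_zero {θ : ℕ → V → V → ℝ} (hr : IsStageRounding θ h x)
    (hφ : φ x y = 0) (hθ : ∀ j, θ j x y = 0) : correctedFlow G lam φ θ h x y = 0 := by
  unfold correctedFlow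
  simp [hθ, hφ, fun j => hr.eq_zero (hθ j)]

/-- On an edge between different layers the corrected flow is the rounded one: exactly one of the
two corrections at each of its ends concerns it. -/
theorem correctedFlow_eq_of_ne {θ : ℕ → V → V → ℝ} (hr : IsStageRounding θ h x)
    (hx : IsLayeringAt G lam x) (hxy : G.Adj x y) (hne : lam x ≠ lam y)
    (hθ : ∀ j, θ j x y = if max (lam x) (lam y) = j then φ x y else 0) :
    correctedFlow G lam φ θ h x y = h (max (lam x) (lam y)) x y := by
  have h0 : ∀ j, max (lam x) (lam y) ≠ j → θ j x y = 0 := fun j hj => by rw [hθ, if_neg hj]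
  unfold correctedFlow
  set k := sInf {j | IsBelow G lam j x} with hk
  rcases lt_or_gt_of_ne hne with hlt | hlt
  · have hmem : IsBelow G lam (lam y) x := ⟨x, SimpleGraph.Reachable.refl _, y, hxy, rfl, hlt⟩
    have hkx : IsBelow G lam k x := Nat.sInf_mem (s := {j | IsBelow G lam j x}) ⟨_, hmem⟩
    have hky : lam y = k := hx.eq_of_isBelow hkx hxy hlt
    rw [max_eq_right hlt.le] at h0 hθ ⊢
    rw [if_pos hkx, h0 _ hlt.ne', hr.eq_zero (h0 _ hlt.ne'), ← hky, hθ, if_pos rfl]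
    push_cast
    ring
  · rw [max_eq_left hlt.le] at h0 hθ ⊢
    split_ifs with hkx
    · have hkx' := hkx.lt
      rw [h0 _ hkx'.ne, hr.eq_zero (h0 _ hkx'.ne), hθ, if_pos rfl]
      push_cast
      ring
    · rw [hθ, if_pos rfl]
      ring

theorem correctedFlow_antisymm {θ : ℕ → V → V → ℝ} (hr : IsStageRounding θ h x)
    (hr' : IsStageRounding θ h y) (hx : IsLayeringAt G lam x) (hy : IsLayeringAt G lam y)
    (hxy : G.Adj x y) (hφ : φ x y = -φ y x) (hθ' : ∀ j, θ j x y = -θ j y x)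
    (hθ : ∀ x y, lam x ≠ lam y → ∀ j, θ j x y = if max (lam x) (lam y) = j then φ x y else 0) :
    correctedFlow G lam φ θ h x y = -correctedFlow G lam φ θ h y x := by
  by_cases hne : lam x = lam y
  · have hb : ∀ j, IsBelow G lam j x ↔ IsBelow G lam j y := fun j =>
      isBelow_congr (SimpleGraph.Adj.reachable ⟨hxy, hne⟩)
    have hs : {j | IsBelow G lam j x} = {j | IsBelow G lam j y} := Set.ext hb
    unfold correctedFlow
    rw [hs, hφ, hθ', hθ', hr.antisymm, hr.antisymm, hne]
    push_cast
    by_cases hk : IsBelow G lam (sInf {j | IsBelow G lam j y}) y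
    · rw [if_pos hk, if_pos ((hb _).2 hk)]
      ring
    · rw [if_neg hk, if_neg fun h => hk ((hb _).1 h)]
      ring
  · rw [correctedFlow_eq_of_ne hr hx hxy hne (hθ _ _ hne),
      correctedFlow_eq_of_ne hr' hy hxy.symm (Ne.symm hne) (hθ _ _ (Ne.symm hne)),
      hr.antisymm, max_comm]
    push_cast
    ring

/-- The corrections do not change the net flows, as rounding preserves them. -/
theorem sum_correctedFlow {θ : ℕ → V → V → ℝ} (hr : IsStageRounding θ h x)
    (hN : {y | G.Adj x y}.Finite) (hφ : ∀ y, φ x y ≠ 0 → G.Adj x y)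
    (hθ : ∀ j y, θ j x y ≠ 0 → G.Adj x y) :
    ∑ᶠ y, correctedFlow G lam φ θ h x y = ∑ᶠ y, φ x y := by
  have hfin : ∀ g : V → ℝ, (∀ y, ¬G.Adj x y → g y = 0) → (Function.support g).Finite :=
    fun g hg => hN.subset fun y hy => by
      by_contra hxy
      exact hy (hg y hxy)
  have h1 : ∀ j y, ¬G.Adj x y → θ j x y = 0 := fun j y hxy => by
    by_contra hne
    exact hxy (hθ j y hne)
  have h2 : ∀ j y, ¬G.Adj x y → (h j x y : ℝ) = 0 := fun j y hxy => by
    rw [hr.eq_zero (h1 j y hxy), Int.cast_zero]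
  have h3 : ∀ y, ¬G.Adj x y → φ x y = 0 := fun y hxy => by
    by_contra hne
    exact hxy (hφ y hne)
  have h4 : ∀ j, ∑ᶠ y, ((h j x y : ℝ) - θ j x y) = 0 := fun j => by
    rw [finsum_sub_distrib (hfin _ (h2 j)) (hfin _ (h1 j)), hr.sum, sub_self]
  have h5 : ∀ j y, ¬G.Adj x y → (h j x y : ℝ) - θ j x y = 0 := fun j y hxy => by
    rw [h1 j y hxy, h2 j y hxy, sub_zero]
  unfold correctedFlow
  set k := sInf {j | IsBelow G lam j x}
  rw [finsum_add_distrib (hfin _ fun y hy => ?_) (hfin _ fun y hy => ?_),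
    finsum_add_distrib (hfin _ h3) (hfin _ (h5 _)), h4, add_zero]
  · split_ifs
    · rw [h4, add_zero]
    · rw [finsum_zero, add_zero]
  · rw [h3 y hy, h5 _ y hy, add_zero]
  · rw [h5 _ y hy, ite_self]

end Correction

section Rounding

variable {X : Type*} [MeasurableSpace X] {G : SimpleGraph X}
  {μ : Measure X} {e : ℕ → X → X} {lam : X → ℕ}

theorem measurable_layerGraph (hG : Measurable fun q : X × X => G.Adj q.1 q.2)
    (hlam : Measurable lam) : Measurable fun q : X × X => (layerGraph G lam).Adj q.1 q.2 :=
  hG.and (measurableSet_setOfPred.1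
    (measurableSet_eq_fun (hlam.comp measurable_fst) (hlam.comp measurable_snd)))

variable [StandardBorelSpace X]

theorem IsLayering.ae_isLayeringAt (hG : IsTame G μ e) (hlam : IsLayering G μ lam) :
    ∀ᵐ x ∂μ, IsLayeringAt G lam x := by
  filter_upwards [hlam.ae_finite, hG.ae_reachable hlam.ae_reachable] with x h1 h2
  exact ⟨h1, fun z hz n y u v hzn hzy hzu hyv hu hv =>
    layerGraph_reachable_of_within (h2 z hz n y u v hzn hzy hzu hyv hu hv)⟩

theorem IsTame.measurable_isBelow (hG : IsTame G μ e) (hlam : Measurable lam) (j : ℕ) :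
    Measurable fun x => IsBelow G lam j x := by
  have hR := hG.measurable_reachable_of_le layerGraph_le (measurable_layerGraph hG.measurable_adj hlam)
  refine hG.measurable_exists (π := id) measurable_id ?_ fun x y h => h.1.mono layerGraph_le
  refine hR.and ?_
  refine hG.measurable_exists (π := fun q : X × X => q.2) measurable_snd ?_
    fun q z h => h.1.reachable
  refine Measurable.and (hG.measurable_adj.comp (f := fun q : (X × X) × X => (q.1.2, q.2))
    (by fun_prop)) (Measurable.and ?_ ?_)
  · exact measurable_eq_of_measurable (hlam.comp measurable_snd) measurable_const
  · exact measurableSet_setOfPred.1 (measurableSet_lt (hlam.comp (by fun_prop)) measurable_const)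

theorem measurable_apply_nat {α β : Type*} [MeasurableSpace α] [MeasurableSpace β]
    {F : ℕ → α → β} (hF : ∀ n, Measurable (F n)) {k : α → ℕ} (hk : Measurable k) :
    Measurable fun a => F (k a) a :=
  (measurable_from_prod_countable_right (f := fun q : ℕ × α => F q.1 q.2) hF).comp
    (hk.prodMk measurable_id)

/-- A Borel real flow that satisfies the conditions almost everywhere can be made integral, at the
cost of increasing the bound. -/
theorem IsTame.exists_measurable_integer_flow (hG : IsTame G μ e) (hlam : IsLayering G μ lam)
    {f : X → ℤ} {C : ℝ} {φ : X → X → ℝ} (hφm : Measurable fun q : X × X => φ q.1 q.2)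
    (hsupp : ∀ x y, φ x y ≠ 0 → G.Adj x y) (hφ : ∀ᵐ x ∂μ, IsFlowAt f C φ x) :
    ∃ ψ : X → X → ℤ, (Measurable fun q : X × X => ψ q.1 q.2) ∧
      (∀ x y, ψ x y ≠ 0 → G.Adj x y) ∧ ∀ᵐ x ∂μ, IsFlowAt f (C + 3) (fun x y => (ψ x y : ℝ)) x := by
  classical
  have hlm := hlam.measurable
  set A := layerGraph G lam with hA
  have hAm : Measurable fun q : X × X => A.Adj q.1 q.2 := measurable_layerGraph hG.measurable_adj hlm
  have hAle : A ≤ G := layerGraph_le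
  have hlm1 : Measurable fun q : X × X => lam q.1 := hlm.comp measurable_fst
  have hlm2 : Measurable fun q : X × X => lam q.2 := hlm.comp measurable_snd
  have hup : Measurable (flowUp lam φ) := by
    refine hG.measurable_finsum (π := id) measurable_id (Measurable.ite (measurableSet_lt hlm1 hlm2)
      hφm measurable_const) fun x y h => ?_
    refine (hsupp x y fun h0 => h ?_).reachable
    rw [h0, ite_self]
  have hdown : Measurable (flowDown lam φ) := by
    refine hG.measurable_finsum (π := id) measurable_id (Measurable.ite (measurableSet_lt hlm2 hlm1)
      hφm measurable_const) fun x y h => ?_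
    refine (hsupp x y fun h0 => h ?_).reachable
    rw [h0, ite_self]
  obtain ⟨gD, hgDm, hgDa, hgDs, hgD⟩ := hG.exists_treeFlow hAle hAm hdown
  obtain ⟨gU, hgUm, hgUa, hgUs, hgU⟩ := hG.exists_treeFlow hAle hAm hup
  set θ := stageFlow G lam φ gD gU with hθdef
  have hbm := hG.measurable_isBelow hlm
  have heq : MeasurableSet {q : X × X | lam q.1 = lam q.2} := measurableSet_eq_fun hlm1 hlm2
  have hθm : ∀ j, Measurable fun q : X × X => θ j q.1 q.2 := by
    intro j
    refine Measurable.ite heq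
      (Measurable.ite (measurableSet_eq_fun hlm1 measurable_const) hgDm (Measurable.ite
        (measurableSet_setOfPred.2 ((hbm j).comp measurable_fst)) hgUm measurable_const))
      (Measurable.ite (measurableSet_eq_fun (hlm1.max hlm2) measurable_const) hφm measurable_const)
  have hθadj : ∀ j x y, θ j x y ≠ 0 → (within G {z | lam z ≤ j}).Adj x y := fun j x y =>
    stageFlow_adj hsupp hgDs hgUs
  have hθG : ∀ j x y, θ j x y ≠ 0 → G.Adj x y := fun j x y h => (hθadj j x y h).1
  have hθne : ∀ x y, lam x ≠ lam y → ∀ j, θ j x y = if max (lam x) (lam y) = j then φ x y else 0 :=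
    fun x y hne j => if_neg hne
  have hex := fun j => hG.exists_measurable_rounding (within_le G {z | lam z ≤ j})
    (measurable_within_const hG.measurable_adj (measurableSet_le hlm measurable_const)) (hθm j)
    fun x y h => (hθadj j x y h).reachable
  choose h hhm hh using hex
  set Φ := correctedFlow G lam φ θ h with hΦ
  have hkm : Measurable fun x => sInf {j | IsBelow G lam j x} := measurable_sInf_nat hbm
  have hαm : ∀ j, Measurable fun q : X × X => (h j q.1 q.2 : ℝ) - θ j q.1 q.2 := fun j =>
    ((measurable_from_top (f := fun n : ℤ => (n : ℝ))).comp (hhm j)).sub (hθm j)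
  have hΦm : Measurable fun q : X × X => Φ q.1 q.2 := by
    refine (hφm.add (measurable_apply_nat hαm hlm1)).add (Measurable.ite (measurableSet_setOfPred.2 ?_)
      (measurable_apply_nat hαm (hkm.comp measurable_fst)) measurable_const)
    exact (measurable_apply_nat hbm hkm).comp measurable_fst
  -- the corrected flow is integral between layers; inside the finite layer components it is rounded
  have hexψ := hG.exists_measurable_rounding hAle hAm
    (θ := fun x y => if A.Adj x y then Φ x y else 0)
    (Measurable.ite (measurableSet_setOfPred.2 hAm) hΦm measurable_const) fun x y hne => by
      by_contra hxy
      exact hne (if_neg fun h => hxy h.reachable)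
  obtain ⟨r, hrm, hr⟩ := hexψ
  refine ⟨fun x y => if G.Adj x y then (if lam x = lam y then r x y else ⌊Φ x y⌋) else 0,
    Measurable.ite (measurableSet_setOfPred.2 hG.measurable_adj)
      (Measurable.ite heq hrm (Int.measurable_floor.comp hΦm)) measurable_const, fun x y hne => ?_, ?_⟩
  · by_contra hxy
    exact hne (if_neg hxy)
  have hlay := hlam.ae_isLayeringAt hG
  filter_upwards [hG.ae_reachable (hlay.and hφ)] with x₀ hx₀
  have hlayAt : ∀ x, G.Reachable x₀ x → IsLayeringAt G lam x := fun x hx => (hx₀ x hx).1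
  have hround : ∀ x, G.Reachable x₀ x → IsStageRounding θ h x := by
    intro x hx
    have hw : ∀ j y, (within G {z | lam z ≤ j}).Reachable x y → G.Reachable x₀ y := fun j y hy =>
      hx.trans (hy.mono (within_le _ _))
    have key := fun j => hh j x ((hlayAt x hx).finite j)
      (fun y hy z => stageFlow_antisymm hgDa hgUa hgUs ((hx₀ y (hw j y hy)).2.antisymm z))
      (fun y hy => (hlayAt y (hw j y hy)).exists_sum_stageFlow hG.finite_neighborSet hsupp
        (fun z hz => (hx₀ z ((hw j y hy).trans hz)).2) hgDs hgUs hgD hgU)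
    exact ⟨fun j => (key j).1, fun j => (key j).2.1, fun j => (key j).2.2⟩
  have hΦadj : ∀ x, G.Reachable x₀ x → ∀ y, ¬G.Adj x y → Φ x y = 0 := by
    intro x hx y hxy
    refine correctedFlow_eq_zero (hround x hx) ?_ fun j => ?_
    · by_contra hne
      exact hxy (hsupp x y hne)
    · by_contra hne
      exact hxy (hθG j x y hne)
  have hΦanti : ∀ x, G.Reachable x₀ x → ∀ y, G.Adj x y → Φ x y = -Φ y x := by
    intro x hx y hxy
    have hy := hx.trans hxy.reachable
    exact correctedFlow_antisymm (hround x hx) (hround y hy) (hlayAt x hx) (hlayAt y hy) hxy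
      ((hx₀ x hx).2.antisymm y) (fun j => stageFlow_antisymm hgDa hgUa hgUs
        ((hx₀ x hx).2.antisymm y)) hθne
  have hΦsum : ∀ x, G.Reachable x₀ x → ∑ᶠ y, Φ x y = f x := by
    intro x hx
    rw [← (hx₀ x hx).2.sum]
    exact sum_correctedFlow (hround x hx) (hG.finite_neighborSet x) (hsupp x) fun j => hθG j x
  have hΦint : ∀ x, G.Reachable x₀ x → ∀ y, lam x ≠ lam y → Φ x y = ⌊Φ x y⌋ := by
    intro x hx y hne
    by_cases hxy : G.Adj x y
    · rw [hΦ, correctedFlow_eq_of_ne (hround x hx) (hlayAt x hx) hxy hne (hθne x y hne),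
        Int.floor_intCast]
    · rw [hΦadj x hx y hxy, Int.floor_zero, Int.cast_zero]
  have hfin : ∀ x, G.Reachable x₀ x → ∀ g : X → ℝ, (∀ y, Φ x y = 0 → g y = 0) →
      (Function.support g).Finite := fun x hx g hg =>
    (hG.finite_neighborSet x).subset fun y hy => by
      by_contra hxy
      exact hy (hg y (hΦadj x hx y hxy))
  have hsplit : ∀ x, G.Reachable x₀ x → ∑ᶠ y, (if A.Adj x y then Φ x y else 0) +
      ∑ᶠ y, (if lam x = lam y then 0 else Φ x y) = f x := by
    intro x hx
    rw [← finsum_add_distrib (hfin x hx _ fun y h0 => by rw [h0, ite_self])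
      (hfin x hx _ fun y h0 => by rw [h0, ite_self]), ← hΦsum x hx]
    refine finsum_congr fun y => ?_
    by_cases hxy : G.Adj x y
    · by_cases hl : lam x = lam y
      · rw [if_pos (show A.Adj x y from ⟨hxy, hl⟩), if_pos hl, add_zero]
      · rw [if_neg (fun h : A.Adj x y => hl h.2), if_neg hl, zero_add]
    · rw [hΦadj x hx y hxy, ite_self, ite_self, add_zero]
  obtain ⟨hr1, hr2, hr3⟩ := hr x₀ (hlayAt x₀ (SimpleGraph.Reachable.refl _)).finite_layer
    (fun y hy z => by
      by_cases hyz : A.Adj y z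
      · rw [if_pos hyz, if_pos hyz.symm]
        exact hΦanti y (hy.mono hAle) z hyz.1
      · rw [if_neg hyz, if_neg fun h => hyz h.symm, neg_zero])
    (fun y hy => by
      have hy' := hy.mono hAle
      refine ⟨f y - ∑ᶠ z, (if lam y = lam z then 0 else ⌊Φ y z⌋), ?_⟩
      have h1 := hsplit y hy'
      have h2 : ((∑ᶠ z, (if lam y = lam z then 0 else ⌊Φ y z⌋) : ℤ) : ℝ) =
          ∑ᶠ z, (if lam y = lam z then 0 else Φ y z) := by
        have h3 : (Function.support fun z => if lam y = lam z then 0 else ⌊Φ y z⌋).Finite :=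
          (hG.finite_neighborSet y).subset fun z hz => by
            by_contra hyz
            refine hz ?_
            simp only
            rw [hΦadj y hy' z hyz, Int.floor_zero, ite_self]
        have h4 := (Int.castAddHom ℝ).map_finsum h3
        simp only [Int.coe_castAddHom] at h4
        rw [h4]
        refine finsum_congr fun z => ?_
        split_ifs with hyz
        · simp
        · exact (hΦint y hy' z hyz).symm
      push_cast
      rw [h2]
      linarith)
  have hx := SimpleGraph.Reachable.refl (G := G) x₀
  have hr0 : ∀ y, ¬A.Adj x₀ y → r x₀ y = 0 := fun y hy => by
    have := hr2 y
    rw [if_neg hy, sub_zero] at this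
    exact Int.abs_lt_one_iff.1 (by exact_mod_cast this)
  have hbound : ∀ y, |Φ x₀ y| ≤ C + 2 := fun y => by
    have h1 := abs_correctedFlow_sub_le (G := G) (lam := lam) (φ := φ) (hround x₀ hx) y
    have h2 := (hx₀ x₀ hx).2.bound y
    have h3 := abs_sub_abs_le_abs_sub (Φ x₀ y) (φ x₀ y)
    linarith
  have hif : ∀ y, (if G.Adj x₀ y then (if lam x₀ = lam y then r x₀ y else ⌊Φ x₀ y⌋) else 0) =
      if lam x₀ = lam y then r x₀ y else ⌊Φ x₀ y⌋ := fun y => by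
    by_cases hxy : G.Adj x₀ y
    · rw [if_pos hxy]
    · rw [if_neg hxy, hr0 y fun h => hxy h.1, hΦadj x₀ hx y hxy, Int.floor_zero, ite_self]
  refine ⟨fun y => ?_, fun y => ?_, ?_⟩
  · by_cases hxy : G.Adj x₀ y
    · by_cases hl : lam x₀ = lam y
      · simp only [if_pos hxy, if_pos hxy.symm, if_pos hl, if_pos hl.symm, hr1 y]
        push_cast
        ring
      · simp only [if_pos hxy, if_pos hxy.symm, if_neg hl, if_neg (Ne.symm hl)]
        rw [← hΦint x₀ hx y hl, ← hΦint y hxy.reachable x₀ (Ne.symm hl)]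
        exact hΦanti x₀ hx y hxy
    · simp only [if_neg hxy, if_neg fun h : G.Adj y x₀ => hxy h.symm]
      simp
  · simp only [hif]
    by_cases hl : lam x₀ = lam y
    · rw [if_pos hl]
      have h1 := hr2 y
      have h2 := abs_sub_abs_le_abs_sub (r x₀ y : ℝ) (if A.Adj x₀ y then Φ x₀ y else 0)
      have h3 : |if A.Adj x₀ y then Φ x₀ y else 0| ≤ C + 2 := by
        split_ifs
        · exact hbound y
        · rw [abs_zero]
          exact (abs_nonneg _).trans (hbound y)
      linarith
    · rw [if_neg hl, ← hΦint x₀ hx y hl]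
      linarith [hbound y]
  · simp only [hif]
    rw [← hsplit x₀ hx, ← hr3, ← finsum_add_distrib]
    · refine finsum_congr fun y => ?_
      by_cases hl : lam x₀ = lam y
      · rw [if_pos hl, if_pos hl, add_zero]
      · rw [if_neg hl, if_neg hl, hr0 y fun h => hl h.2, Int.cast_zero, zero_add,
          ← hΦint x₀ hx y hl]
    · refine (hG.finite_neighborSet x₀).subset fun y hy => ?_
      by_contra hxy
      exact hy (by simp only; rw [hr0 y fun h => hxy h.1, Int.cast_zero])
    · exact hfin x₀ hx _ fun y h0 => by rw [h0, ite_self]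

end Rounding

/-! ### Measurable real flows -/

section NestedConvex

/-- Almost shortest elements of nested bounded convex sets in a Hilbert space form a Cauchy
sequence. -/
theorem exists_cauchySeq_of_antitone_convex {E : Type*} [NormedAddCommGroup E]
    [InnerProductSpace ℝ E] {S : ℕ → Set E} (hanti : Antitone S)
    (hconv : ∀ n, ∀ x ∈ S n, ∀ y ∈ S n, (2⁻¹ : ℝ) • (x + y) ∈ S n) (hne : ∀ n, (S n).Nonempty)
    {R : ℝ} (hR : ∀ x ∈ S 0, ‖x‖ ≤ R) : ∃ w : ℕ → E, (∀ n, w n ∈ S n) ∧ CauchySeq w := by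
  let d : ℕ → ℝ := fun n => sInf ((fun x => ‖x‖ ^ 2) '' S n)
  have hbdd : ∀ n, BddBelow ((fun x => ‖x‖ ^ 2) '' S n) := fun n =>
    ⟨0, by rintro _ ⟨x, -, rfl⟩; positivity⟩
  have hd : ∀ n, ∀ x ∈ S n, d n ≤ ‖x‖ ^ 2 := fun n x hx => csInf_le (hbdd n) ⟨x, hx, rfl⟩
  have hmono : Monotone d := fun n m hnm =>
    csInf_le_csInf (hbdd n) ((hne m).image _) (Set.image_mono (hanti hnm))
  have hdR : BddAbove (Set.range d) := by
    refine ⟨R ^ 2, ?_⟩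
    rintro _ ⟨n, rfl⟩
    obtain ⟨x, hx⟩ := hne n
    exact (hd n x hx).trans (pow_le_pow_left₀ (norm_nonneg x) (hR x (hanti n.zero_le hx)) 2)
  have hw : ∀ n : ℕ, ∃ x ∈ S n, ‖x‖ ^ 2 < d n + 1 / ((n : ℝ) + 1) := fun n => by
    obtain ⟨_, ⟨x, hx, rfl⟩, hlt⟩ := exists_lt_of_csInf_lt ((hne n).image _)
      (show d n < d n + 1 / ((n : ℝ) + 1) from lt_add_of_pos_right _ (by positivity))
    exact ⟨x, hx, hlt⟩
  choose w hwS hwd using hw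
  refine ⟨w, hwS, cauchySeq_of_le_tendsto_0'
    (fun n => √(2 * ((⨆ m, d m) - d n) + 4 * (1 / ((n : ℝ) + 1)))) (fun n m hnm => ?_) ?_⟩
  · refine Real.le_sqrt_of_sq_le ?_
    have h1 := hd n _ (hconv n _ (hwS n) _ (hanti hnm (hwS m)))
    have h2 := parallelogram_law_with_norm ℝ (w n) (w m)
    have h3 := hwd n
    have h4 := hwd m
    have h5 := le_ciSup hdR m
    have h6 : 1 / ((m : ℝ) + 1) ≤ 1 / ((n : ℝ) + 1) := by
      have : (n : ℝ) ≤ m := by exact_mod_cast hnm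
      gcongr
    rw [norm_smul, mul_pow, Real.norm_of_nonneg (by norm_num)] at h1
    rw [dist_eq_norm]
    nlinarith
  · have h1 := (tendsto_atTop_ciSup hmono hdR).const_sub (⨆ m, d m)
    have h2 := (h1.const_mul 2).add (tendsto_one_div_add_atTop_nhds_zero_nat.const_mul (4 : ℝ))
    have h3 := h2.sqrt
    simpa using h3

end NestedConvex

section PartialFlow

variable {V : Type*} {G K K' : SimpleGraph V} {f : V → ℤ} {C : ℝ} {φ φ' : V → V → ℝ}

/-- A flow whose row sums are prescribed only at the vertices all of whose neighbours lie in their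
`K`-component. -/
structure IsPartialFlow (G K : SimpleGraph V) (f : V → ℤ) (C : ℝ) (φ : V → V → ℝ) : Prop where
  antisymm : ∀ x y, φ x y = -φ y x
  bound : ∀ x y, |φ x y| ≤ C
  adj : ∀ x y, φ x y ≠ 0 → G.Adj x y
  sum : ∀ x, (∀ y, G.Adj x y → K.Reachable x y) → ∑ᶠ y, φ x y = f x

theorem IsPartialFlow.anti (h : IsPartialFlow G K' f C φ) (hK : K ≤ K') :
    IsPartialFlow G K f C φ :=
  ⟨h.antisymm, h.bound, h.adj, fun x hx => h.sum x fun y hy => (hx y hy).mono hK⟩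

/-- Partial flows form a convex set; its midpoints suffice for the parallelogram law. -/
theorem IsPartialFlow.midpoint (hN : ∀ x, {y | G.Adj x y}.Finite) (h : IsPartialFlow G K f C φ)
    (h' : IsPartialFlow G K f C φ') :
    IsPartialFlow G K f C fun x y => 2⁻¹ * (φ x y + φ' x y) := by
  refine ⟨fun x y => ?_, fun x y => ?_, fun x y hne => ?_, fun x hx => ?_⟩
  · rw [h.antisymm, h'.antisymm]
    ring
  · have h1 := h.bound x y
    have h2 := h'.bound x y
    rw [abs_le] at *
    constructor <;> linarith [h1.1, h1.2, h2.1, h2.2]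
  · by_contra hxy
    refine hne ?_
    have h1 : φ x y = 0 := not_not.1 fun h0 => hxy (h.adj x y h0)
    have h2 : φ' x y = 0 := not_not.1 fun h0 => hxy (h'.adj x y h0)
    rw [h1, h2, add_zero, mul_zero]
  · have hf : (Function.support fun y => φ x y).Finite := (hN x).subset fun y hy => h.adj x y hy
    have hf' : (Function.support fun y => φ' x y).Finite := (hN x).subset fun y hy => h'.adj x y hy
    rw [← mul_finsum, finsum_add_distrib hf hf', h.sum x hx, h'.sum x hx]
    ring

end PartialFlow

section Limit

variable {X : Type*} [MeasurableSpace X] {G : SimpleGraph X}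
  {μ : Measure X} {e : ℕ → X → X}

/-- A measure on pairs that sees almost every pair of vertices in a common component. -/
theorem IsEnum.exists_pair_measure (he : IsEnum G e) [IsFiniteMeasure μ] :
    ∃ M : Measure (X × X), IsFiniteMeasure M ∧ ∀ P : X × X → Prop, (∀ᵐ q ∂M, P q) →
      ∀ᵐ x ∂μ, ∀ y, G.Reachable x y → P (x, y) := by
  have hm : ∀ i, Measurable fun x => (x, e i x) := fun i => measurable_id.prodMk (he.measurable_enum i)
  refine ⟨(Measure.sum fun i => μ.map fun x => (x, e i x)).toFinite, inferInstance, fun P hP => ?_⟩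
  rw [ae_toFinite, Measure.ae_sum_eq, Filter.eventually_iSup] at hP
  have h1 := ae_all_iff.2 fun i => ae_of_ae_map (hm i).aemeasurable (hP i)
  filter_upwards [h1] with x hx y hy
  obtain ⟨i, rfl⟩ := (he.reachable_iff x y).1 hy
  exact hx i

variable [StandardBorelSpace X]

open Classical in
/-- On the finite components of `K`, a flow can be chosen in a Borel way among the integer
valued ones. -/
theorem IsTame.exists_measurable_isPartialFlow (hG : IsTame G μ e) {K : SimpleGraph X} (hK : K ≤ G)
    (hKm : Measurable fun q : X × X => K.Adj q.1 q.2) (hKfin : ∀ x, {y | K.Reachable x y}.Finite)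
    {f : X → ℤ} (hf : Measurable f) {C : ℝ} {ψ : X → X → ℤ} (hanti : ∀ x y, ψ x y = -ψ y x)
    (hC : ∀ x y, |(ψ x y : ℝ)| ≤ C) (hadj : ∀ x y, ψ x y ≠ 0 → G.Adj x y)
    (hsum : ∀ x, ∑ᶠ y, (ψ x y : ℝ) = f x) :
    ∃ φ : X → X → ℝ, (Measurable fun q : X × X => φ q.1 q.2) ∧ IsPartialFlow G K f C φ := by
  have hR := hG.measurable_reachable_of_le hK hKm
  let Q : X → (X → X → ℤ) → Prop := fun x θ => ∀ y, K.Reachable x y →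
    (∀ z, K.Reachable x z → θ y z = -θ z y ∧ |(θ y z : ℝ)| ≤ C ∧ (θ y z ≠ 0 → G.Adj y z)) ∧
    ((∀ z, G.Adj y z → K.Reachable y z) →
      ∑ᶠ z, (if K.Reachable y z then (θ y z : ℝ) else 0) = f y)
  have hex := hG.exists_measurable_selection hK hKm Q ?_ ?_ ?_
  · obtain ⟨θ, hθm, hθ0, hθ⟩ := hex
    have hQ : ∀ x, Q x θ := by
      refine fun x => hθ x (hKfin x) ⟨ψ, fun y hy => ⟨fun z hz => ⟨hanti y z, hC y z, hadj y z⟩,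
        fun hyz => ?_⟩⟩
      rw [← hsum y]
      refine finsum_congr fun z => ?_
      by_cases hz : K.Reachable y z
      · rw [if_pos hz]
      · have : ψ y z = 0 := not_not.1 fun h0 => hz (hyz z (hadj y z h0))
        rw [if_neg hz, this, Int.cast_zero]
    refine ⟨fun x y => θ x y, (measurable_from_top (f := fun n : ℤ => (n : ℝ))).comp hθm,
      fun x y => ?_, fun x y => ?_, fun x y hne => ?_, fun x hx => ?_⟩
    · by_cases hxy : K.Reachable x y
      · rw [((hQ x x (SimpleGraph.Reachable.refl _)).1 y hxy).1]
        push_cast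
        rfl
      · rw [hθ0 x y hxy, hθ0 y x fun h => hxy h.symm]
        simp
    · by_cases hxy : K.Reachable x y
      · exact ((hQ x x (SimpleGraph.Reachable.refl _)).1 y hxy).2.1
      · rw [hθ0 x y hxy, Int.cast_zero, abs_zero]
        exact (abs_nonneg _).trans (hC x y)
    · by_cases hxy : K.Reachable x y
      · exact ((hQ x x (SimpleGraph.Reachable.refl _)).1 y hxy).2.2 (by exact_mod_cast hne)
      · exact absurd (by rw [hθ0 x y hxy, Int.cast_zero]) hne
    · rw [← (hQ x x (SimpleGraph.Reachable.refl _)).2 hx]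
      refine finsum_congr fun y => ?_
      split_ifs with hxy
      · rfl
      · rw [hθ0 x y hxy, Int.cast_zero]
  · intro θ hθ
    have hθ' : Measurable fun q : X × X => (θ q.1 q.2 : ℝ) :=
      (measurable_from_top (f := fun n : ℤ => (n : ℝ))).comp hθ
    have hs : Measurable fun y => ∑ᶠ z, (if K.Reachable y z then (θ y z : ℝ) else 0) := by
      refine hG.measurable_finsum (π := id) measurable_id
        (Measurable.ite (measurableSet_setOfPred.2 hR) hθ' measurable_const) fun y z h => ?_
      by_contra hyz
      exact h (if_neg fun h' => hyz (h'.mono hK))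
    refine hG.measurable_forall (π := id) measurable_id (Measurable.imp hR (Measurable.and ?_ ?_)) ?_
    · refine hG.measurable_forall (π := fun q : X × X => q.1) measurable_fst
        (Measurable.imp (hR.comp (f := fun q : (X × X) × X => (q.1.1, q.2)) (by fun_prop))
          (Measurable.and ?_ (Measurable.and ?_ ?_))) ?_
      · exact measurableSet_setOfPred.1 (measurableSet_eq_fun
          (hθ.comp (f := fun q : (X × X) × X => (q.1.2, q.2)) (by fun_prop))
          (hθ.comp (f := fun q : (X × X) × X => (q.2, q.1.2)) (by fun_prop)).neg)
      · exact measurableSet_setOfPred.1 (measurableSet_le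
          (hθ'.comp (f := fun q : (X × X) × X => (q.1.2, q.2)) (by fun_prop)).norm measurable_const)
      · refine Measurable.imp (Measurable.not (measurableSet_setOfPred.1 (measurableSet_eq_fun
          (hθ.comp (f := fun q : (X × X) × X => (q.1.2, q.2)) (by fun_prop)) measurable_const)))
          (hG.measurable_adj.comp (f := fun q : (X × X) × X => (q.1.2, q.2)) (by fun_prop))
      · intro q z h
        rw [Classical.not_imp] at h
        exact h.1.mono hK
    · refine Measurable.imp (Measurable.comp (g := fun y => ∀ z, G.Adj y z → K.Reachable y z) ?_
        measurable_snd) (measurableSet_setOfPred.1 (measurableSet_eq_fun (hs.comp measurable_snd)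
        ((measurable_from_top (f := fun n : ℤ => (n : ℝ))).comp (hf.comp measurable_snd))))
      refine hG.measurable_forall (π := id) measurable_id (hG.measurable_adj.imp hR) fun y z h => ?_
      rw [Classical.not_imp] at h
      exact h.1.reachable
    · intro x y h
      rw [Classical.not_imp] at h
      exact h.1.mono hK
  · intro x θ θ' heq hQ y hy
    refine ⟨fun z hz => ?_, fun h => ?_⟩
    · rw [← heq y z hy hz, ← heq z y hz hy]
      exact (hQ y hy).1 z hz
    · rw [← (hQ y hy).2 h]
      refine finsum_congr fun z => ?_
      split_ifs with hyz
      · rw [heq y z hy (hy.trans hyz)]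
      · rfl
  · intro x y θ hxy hQ z hz
    exact ⟨fun w hw => (hQ z (hxy.trans hz)).1 w (hxy.trans hw), (hQ z (hxy.trans hz)).2⟩

/-- A bounded flow yields a measurable one. Partial flows for larger and larger finite pieces form
nested convex sets in a Hilbert space, and almost shortest elements of these sets converge. -/
theorem IsTame.exists_measurable_flow (hG : IsTame G μ e) [IsFiniteMeasure μ]
    {H : ℕ → SimpleGraph X} (hH : IsExhaustion G H)
    {f : X → ℤ} (hf : Measurable f) {C : ℝ} {ψ : X → X → ℤ} (hanti : ∀ x y, ψ x y = -ψ y x)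
    (hC : ∀ x y, |(ψ x y : ℝ)| ≤ C) (hadj : ∀ x y, ψ x y ≠ 0 → G.Adj x y)
    (hsum : ∀ x, ∑ᶠ y, (ψ x y : ℝ) = f x) :
    ∃ φ : X → X → ℝ, (Measurable fun q : X × X => φ q.1 q.2) ∧ (∀ x y, φ x y ≠ 0 → G.Adj x y) ∧
      ∀ᵐ x ∂μ, IsFlowAt f C φ x := by
  classical
  obtain ⟨M, hM, hMμ⟩ := hG.exists_pair_measure (μ := μ)
  -- the partial flows for the pieces of stage `n`, as elements of a Hilbert space
  let S : ℕ → Set (Lp ℝ 2 M) := fun n => {w | ∃ φ : X → X → ℝ,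
    (Measurable fun q : X × X => φ q.1 q.2) ∧ IsPartialFlow G (H n) f C φ ∧
      w =ᵐ[M] fun q => φ q.1 q.2}
  have hex := exists_cauchySeq_of_antitone_convex (S := S) ?_ ?_ ?_
    (R := measureUnivNNReal M ^ (2 : ℝ≥0∞).toReal⁻¹ * |C|) ?_
  · obtain ⟨w, hwS, hwc⟩ := hex
    obtain ⟨v, hv⟩ := cauchySeq_tendsto_of_complete hwc
    obtain ⟨ns, hns, hlim⟩ := (tendstoInMeasure_of_tendsto_Lp hv).exists_seq_tendsto_ae
    choose Φ hΦm hΦ hwΦ using hwS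
    have h1 : ∀ᵐ q ∂M, Tendsto (fun i => Φ (ns i) q.1 q.2) atTop (𝓝 (v q)) := by
      filter_upwards [hlim, ae_all_iff.2 hwΦ] with q h2 h3
      simpa only [h3] using h2
    refine ⟨fun x y => if G.Adj x y then v (x, y) else 0, Measurable.ite
      (measurableSet_setOfPred.2 hG.measurable_adj) (Lp.stronglyMeasurable v).measurable
      measurable_const, fun x y h => ?_, ?_⟩
    · by_contra hxy
      exact h (if_neg hxy)
    filter_upwards [hG.ae_reachable (hMμ _ h1)] with x hx
    have h2 : ∀ y, G.Reachable x y → ∀ z, Tendsto (fun i => Φ (ns i) y z) atTop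
        (𝓝 (if G.Adj y z then v (y, z) else 0)) := by
      intro y hy z
      split_ifs with hyz
      · exact hx y hy z hyz.reachable
      · have : ∀ i, Φ (ns i) y z = 0 := fun i => not_not.1 fun h0 => hyz ((hΦ _).adj y z h0)
        simp only [this]
        exact tendsto_const_nhds
    have h3 := h2 x (SimpleGraph.Reachable.refl _)
    refine ⟨fun y => ?_, fun y => ?_, ?_⟩
    · by_cases hxy : G.Adj x y
      · refine tendsto_nhds_unique (h3 y) ?_
        simp only [fun i => (hΦ (ns i)).antisymm x y]
        exact (h2 y hxy.reachable x).neg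
      · simp only [if_neg hxy, if_neg fun h : G.Adj y x => hxy h.symm, neg_zero]
    · exact le_of_tendsto' (h3 y).abs fun i => (hΦ (ns i)).bound x y
    · have hF := hG.finite_neighborSet x
      have hsum' : ∀ g : X → ℝ, (∀ y, g y ≠ 0 → G.Adj x y) → ∑ᶠ y, g y = ∑ y ∈ hF.toFinset, g y :=
        fun g hg => finsum_eq_sum_of_support_subset _ fun y hy => by simpa using hg y hy
      rw [hsum' _ fun y hy => not_not.1 fun hxy => hy (if_neg hxy)]
      refine tendsto_nhds_unique (tendsto_finsetSum _ fun y _ => h3 y)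
        (tendsto_const_nhds.congr' ?_)
      -- from some stage on, the neighbours of `x` lie in one piece with `x`
      have h4 : ∀ᶠ n in atTop, ∀ y ∈ {y | G.Adj x y}, (H n).Reachable x y := by
        refine (hF.eventually_all (l := atTop) (p := fun y n => (H n).Reachable x y)).2
          fun y hy => ?_
        obtain ⟨n, hn⟩ := hH.exists_adj x y hy
        filter_upwards [eventually_ge_atTop n] with m hm
        exact (hH.mono hm hn).reachable
      filter_upwards [hns.tendsto_atTop.eventually h4] with i hi
      rw [← (hΦ (ns i)).sum x hi, hsum' _ fun y hy => (hΦ (ns i)).adj x y hy]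
  · rintro n m hnm w ⟨φ, h1, h2, h3⟩
    exact ⟨φ, h1, h2.anti (hH.mono hnm), h3⟩
  · rintro n w ⟨φ, h1, h2, h3⟩ w' ⟨φ', h1', h2', h3'⟩
    refine ⟨_, (h1.add h1').const_mul 2⁻¹, h2.midpoint hG.finite_neighborSet h2', ?_⟩
    filter_upwards [Lp.coeFn_smul (2⁻¹ : ℝ) (w + w'), Lp.coeFn_add w w', h3, h3'] with q e1 e2 e3 e4
    rw [e1, Pi.smul_apply, e2, Pi.add_apply, e3, e4, smul_eq_mul]
  · intro n
    obtain ⟨φ, h1, h2⟩ := hG.exists_measurable_isPartialFlow (hH.le n) (hH.measurable_adj n)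
      (hH.finite n) hf hanti hC hadj hsum
    have h3 : MemLp (fun q : X × X => φ q.1 q.2) 2 M :=
      MemLp.of_bound h1.aestronglyMeasurable C (Eventually.of_forall fun q => h2.bound q.1 q.2)
    exact ⟨h3.toLp _, φ, h1, h2, h3.coeFn_toLp⟩
  · rintro w ⟨φ, -, h2, h3⟩
    refine Lp.norm_le_of_ae_bound (abs_nonneg C) ?_
    filter_upwards [h3] with q hq
    rw [hq]
    exact (h2.bound q.1 q.2).trans (le_abs_self C)

end Limit

/-! ### Null sets, edge measures and one-endedness -/

section EdgeTransport

variable {X : Type*} [MeasurableSpace X] [StandardBorelSpace X] {G : SimpleGraph X}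
  {μ : Measure X} {e : ℕ → X → X}

/-- Summing over the neighbours of a random vertex is integration with respect to the edge
measure. -/
theorem IsEnum.exists_edge_measure (he : IsEnum G e)
    (hA : Measurable fun p : X × X => G.Adj p.1 p.2) (μ : Measure X) :
    ∃ M : Measure (X × X), ∀ h : X × X → ℝ≥0∞, Measurable h →
      ∫⁻ q, h q ∂M = ∫⁻ x, ∑' y, ind (G.Adj x y) * h (x, y) ∂μ := by
  have hm : ∀ i, Measurable fun x => (x, e i x) := fun i =>
    measurable_id.prodMk (he.measurable_enum i)
  let g : ℕ → X → ℝ≥0∞ := fun i x => ind (∀ j < i, e j x ≠ e i x) * ind (G.Adj x (e i x))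
  have hg : ∀ i, Measurable (g i) := fun i =>
    (measurable_ind (he.measurable_isFirst i)).mul (measurable_ind (hA.comp (hm i)))
  refine ⟨Measure.sum fun i => (μ.withDensity (g i)).map fun x => (x, e i x), fun h hh => ?_⟩
  have h1 : ∀ i, ∫⁻ q, h q ∂((μ.withDensity (g i)).map fun x => (x, e i x)) =
      ∫⁻ x, g i x * h (x, e i x) ∂μ := fun i => by
    rw [lintegral_map hh (hm i)]
    exact lintegral_withDensity_eq_lintegral_mul _ (hg i) (hh.comp (hm i))
  rw [lintegral_sum_measure]
  simp only [h1]
  have h2 : ∀ i, Measurable fun x => g i x * h (x, e i x) := fun i => (hg i).mul (hh.comp (hm i))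
  rw [← lintegral_tsum fun i => (h2 i).aemeasurable]
  refine lintegral_congr fun x => ?_
  rw [he.tsum_eq x fun y hy => (ind_ne_zero.1 (left_ne_zero_of_mul hy)).reachable]
  simp only [g, mul_assoc]

/-- Mass transport along edges follows from the symmetry of the number of edges between two Borel
sets, since the measures of rectangles determine the edge measure. -/
theorem IsEnum.edge_transport (he : IsEnum G e)
    (hA : Measurable fun p : X × X => G.Adj p.1 p.2) (hfin : ∀ x, {y | G.Adj x y}.Finite)
    [IsFiniteMeasure μ]
    (hdeg : ∀ A B : Set X, MeasurableSet A → MeasurableSet B →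
      ∫⁻ x in A, ∑' y, ind (G.Adj x y ∧ y ∈ B) ∂μ = ∫⁻ x in B, ∑' y, ind (G.Adj x y ∧ y ∈ A) ∂μ)
    (h : X → X → ℝ≥0∞) (hh : Measurable fun p : X × X => h p.1 p.2) :
    ∫⁻ x, ∑' y, ind (G.Adj x y) * h x y ∂μ = ∫⁻ x, ∑' y, ind (G.Adj x y) * h y x ∂μ := by
  obtain ⟨M, hM⟩ := he.exists_edge_measure hA μ
  have hrect : ∀ A B : Set X, MeasurableSet A → MeasurableSet B →
      M (A ×ˢ B) = ∫⁻ x in A, ∑' y, ind (G.Adj x y ∧ y ∈ B) ∂μ := by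
    intro A B hA hB
    rw [← lintegral_indicator_one (hA.prod hB), hM _ (measurable_one.indicator (hA.prod hB)),
      ← lintegral_indicator hA]
    refine lintegral_congr fun x => ?_
    by_cases hx : x ∈ A
    · rw [Set.indicator_of_mem hx]
      refine tsum_congr fun y => ?_
      rw [ind_and]
      congr 1
      by_cases hy : y ∈ B <;> simp [ind, hx, hy]
    · rw [Set.indicator_of_notMem hx]
      simp [hx]
  have hsymm : M = M.map Prod.swap := by
    let deg : X → ℝ≥0∞ := fun x => ∑' y, ind (G.Adj x y)
    have hdegm : Measurable deg := he.measurable_tsum (π := id) measurable_id (measurable_ind hA)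
      fun x y h => (ind_ne_zero.1 h).reachable
    have hDm : ∀ n : ℕ, MeasurableSet {x | deg x ≤ n} := fun n =>
      measurableSet_le hdegm measurable_const
    refine Measure.ext_of_generateFrom_of_iUnion
      (Set.image2 (· ×ˢ ·) {s : Set X | MeasurableSet s} {t : Set X | MeasurableSet t})
      (fun n : ℕ => {x | deg x ≤ n} ×ˢ Set.univ) generateFrom_prod.symm isPiSystem_prod ?_ ?_ ?_ ?_
    · refine Set.eq_univ_of_forall fun q => Set.mem_iUnion.2 ?_
      obtain ⟨n, hn⟩ := ENNReal.exists_nat_gt ((tsum_ind_ne_top _).2 (hfin q.1))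
      exact ⟨n, hn.le, Set.mem_univ _⟩
    · exact fun n => ⟨_, hDm n, _, MeasurableSet.univ, rfl⟩
    · intro n
      rw [hrect _ _ (hDm n) MeasurableSet.univ]
      refine ne_top_of_le_ne_top (b := ∫⁻ _ in {x | deg x ≤ n}, (n : ℝ≥0∞) ∂μ) ?_ ?_
      · rw [lintegral_const]
        exact ENNReal.mul_ne_top (ENNReal.natCast_ne_top n) (measure_ne_top _ _)
      · refine setLIntegral_mono measurable_const fun x hx => ?_
        simp only [Set.mem_univ, and_true]
        exact hx
    · rintro _ ⟨A, hA, B, hB, rfl⟩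
      have hA : MeasurableSet A := hA
      have hB : MeasurableSet B := hB
      rw [Measure.map_apply measurable_swap (hA.prod hB), Set.preimage_swap_prod, hrect _ _ hA hB,
        hrect _ _ hB hA, hdeg A B hA hB]
  have h1 := hM (fun q => h q.1 q.2) hh
  have h2 := hM (fun q => h q.2 q.1) (hh.comp measurable_swap)
  rw [← h1, ← h2]
  conv_lhs => rw [hsymm]
  rw [lintegral_map hh measurable_swap]
  rfl

end EdgeTransport

section NullSets

variable {X : Type*} [TopologicalSpace X] [PolishSpace X] [MeasurableSpace X] [BorelSpace X]
  {G : SimpleGraph X} {μ : Measure X}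

/-- The vertices with a neighbour in a null set form a null set. -/
theorem IsGraphing.measure_neighbor_null [IsFiniteMeasure μ] (hG : IsGraphing G μ) {N : Set X}
    (hN : MeasurableSet N) (h0 : μ N = 0) : μ {x | ∃ y, G.Adj x y ∧ y ∈ N} = 0 := by
  have hP : NullMeasurableSet {x | ∃ y, G.Adj x y ∧ y ∈ N} μ :=
    nullMeasurableSet_exists μ (S := {p : X × X | G.Adj p.1 p.2 ∧ p.2 ∈ N})
      (hG.measurableSet_adj.inter (measurable_snd hN))
  have h1 := hG.lintegral_deg_comm Set.univ N MeasurableSet.univ hN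
  rw [Measure.restrict_univ, setLIntegral_measure_zero _ _ h0] at h1
  rw [← lintegral_indicator_one₀ hP, ← nonpos_iff_eq_zero, ← h1]
  refine lintegral_mono fun x => ?_
  by_cases hx : ∃ y, G.Adj x y ∧ y ∈ N
  · rw [Set.indicator_of_mem (by exact hx)]
    obtain ⟨y, hxy, hy⟩ := hx
    have : (1 : ℕ∞) ≤ (G.neighborSet x ∩ N).encard :=
      Set.one_le_encard_iff_nonempty.2 ⟨y, hxy, hy⟩
    change (1 : ℝ≥0∞) ≤ _
    exact_mod_cast this
  · rw [Set.indicator_of_notMem (by exact hx)]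
    exact zero_le

/-- A property of almost every vertex holds throughout a conull Borel union of components. -/
theorem IsGraphing.exists_invariant_subset [IsFiniteMeasure μ] (hG : IsGraphing G μ) {p : X → Prop}
    (hp : ∀ᵐ x ∂μ, p x) : ∃ S : Set X, MeasurableSet S ∧ μ Sᶜ = 0 ∧ (∀ x ∈ S, p x) ∧
      ∀ x y, G.Adj x y → x ∈ S → y ∈ S := by
  have hstep : ∀ N : {N : Set X // MeasurableSet N ∧ μ N = 0},
      ∃ N' : {N : Set X // MeasurableSet N ∧ μ N = 0}, {x | ∃ y, G.Adj x y ∧ y ∈ N.1} ⊆ N'.1 :=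
    fun N => by
      obtain ⟨N', h1, h2, h3⟩ := exists_measurable_superset_of_null
        (hG.measure_neighbor_null N.2.1 N.2.2)
      exact ⟨⟨N', h2, h3⟩, h1⟩
  choose F hF using hstep
  obtain ⟨N₀, h1, h2, h3⟩ := exists_measurable_superset_of_null (ae_iff.1 hp)
  let N : ℕ → {N : Set X // MeasurableSet N ∧ μ N = 0} := fun n => F^[n] ⟨N₀, h2, h3⟩
  refine ⟨(⋃ n, (N n).1)ᶜ, (MeasurableSet.iUnion fun n => (N n).2.1).compl, ?_, fun x hx => ?_,
    fun x y hxy hx hy => hx ?_⟩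
  · rw [compl_compl]
    exact measure_iUnion_null fun n => (N n).2.2
  · by_contra hpx
    exact hx (Set.mem_iUnion.2 ⟨0, h1 hpx⟩)
  · obtain ⟨n, hn⟩ := Set.mem_iUnion.1 hy
    refine Set.mem_iUnion.2 ⟨n + 1, ?_⟩
    have h4 : N (n + 1) = F (N n) := Function.iterate_succ_apply' F n _
    rw [h4]
    exact hF _ ⟨y, hxy, hn⟩

/-- The points of the finite classes of a Borel equivalence relation can be enumerated measurably:
a point `y` of the class of `x` is the first one after some rational number, in a Borel
linear order. -/
theorem exists_aemeasurable_enum (μ : Measure X) [IsFiniteMeasure μ] (F : Setoid X)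
    (hF : MeasurableSet {p : X × X | F p.1 p.2}) (hfin : ∀ x, {y | F x y}.Finite) :
    ∃ g : ℚ → X → X, (∀ q, AEMeasurable (g q) μ) ∧ ∀ x y, F x y ↔ ∃ q, g q x = y := by
  classical
  have hι := measurableEmbedding_embeddingReal X
  set ι := embeddingReal X
  have hmin : ∀ (q : ℚ) x, ∃ y, F x y ∧ ((∃ z, F x z ∧ (q : ℝ) ≤ ι z) →
      (q : ℝ) ≤ ι y ∧ ∀ z, F x z → (q : ℝ) ≤ ι z → ι y ≤ ι z) ∧
      ((¬∃ z, F x z ∧ (q : ℝ) ≤ ι z) → y = x) := by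
    intro q x
    by_cases h : ∃ z, F x z ∧ (q : ℝ) ≤ ι z
    · obtain ⟨y, hy, hmin⟩ := Set.exists_min_image {z | F x z ∧ (q : ℝ) ≤ ι z} ι
        ((hfin x).subset fun z hz => hz.1) h
      exact ⟨y, hy.1, fun _ => ⟨hy.2, fun z hz hq => hmin z ⟨hz, hq⟩⟩, fun h' => absurd h h'⟩
    · exact ⟨x, F.refl x, fun h' => absurd h' h, fun _ => rfl⟩
  choose g hgF hg1 hg2 using hmin
  have hιm : Measurable fun p : X × X => ι p.2 := hι.measurable.comp measurable_snd
  refine ⟨g, fun q => ?_, fun x y => ⟨fun hxy => ?_, ?_⟩⟩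
  · rw [← hι.aemeasurable_comp_iff]
    refine NullMeasurable.aemeasurable ?_
    refine measurable_of_Iio (α := ℝ) (δ := NullMeasurableSpace X μ) fun r => ?_
    have hP : NullMeasurableSet {x | ∃ z, F x z ∧ (q : ℝ) ≤ ι z} μ :=
      nullMeasurableSet_exists μ (S := {p : X × X | F p.1 p.2 ∧ (q : ℝ) ≤ ι p.2})
        (hF.inter (measurableSet_le measurable_const hιm))
    have hQ : NullMeasurableSet {x | ∃ z, F x z ∧ (q : ℝ) ≤ ι z ∧ ι z < r} μ :=
      nullMeasurableSet_exists μ (S := {p : X × X | F p.1 p.2 ∧ (q : ℝ) ≤ ι p.2 ∧ ι p.2 < r})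
        (hF.inter ((measurableSet_le measurable_const hιm).inter
          (measurableSet_lt hιm measurable_const)))
    have hR : NullMeasurableSet {x | ι x < r} μ :=
      (measurableSet_lt hι.measurable measurable_const).nullMeasurableSet
    have heq : (ι ∘ g q) ⁻¹' Set.Iio r = {x | ∃ z, F x z ∧ (q : ℝ) ≤ ι z ∧ ι z < r} ∪
        ({x | ∃ z, F x z ∧ (q : ℝ) ≤ ι z}ᶜ ∩ {x | ι x < r}) := by
      ext x
      by_cases h : ∃ z, F x z ∧ (q : ℝ) ≤ ι z
      · have h1 := hg1 q x h
        constructor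
        · exact fun hx => Or.inl ⟨g q x, hgF q x, h1.1, hx⟩
        · rintro (⟨z, hz, hqz, hzr⟩ | ⟨h', -⟩)
          · exact (h1.2 z hz hqz).trans_lt hzr
          · exact absurd h h'
      · have h1 := hg2 q x h
        constructor
        · intro hx
          refine Or.inr ⟨h, ?_⟩
          rw [Set.mem_preimage, Function.comp_apply, h1] at hx
          exact hx
        · rintro (⟨z, hz, hqz, hzr⟩ | ⟨-, hx⟩)
          · exact absurd ⟨z, hz, hqz⟩ h
          · rw [Set.mem_preimage, Function.comp_apply, h1]
            exact hx
    have h := hQ.union (hP.compl.inter hR)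
    rw [← heq] at h
    exact h
  · have h1 : ∀ᶠ t in 𝓝[<] (ι y), ∀ z ∈ {z | F x z}, ι z < ι y → ι z < t := by
      refine ((hfin x).eventually_all (l := 𝓝[<] (ι y))
        (p := fun z t => ι z < ι y → ι z < t)).2 fun z _ => ?_
      by_cases hz : ι z < ι y
      · filter_upwards [Ioo_mem_nhdsLT hz] with t ht _ using ht.1
      · exact Eventually.of_forall fun t h => absurd h hz
    obtain ⟨t, ht, hty⟩ := (h1.and self_mem_nhdsWithin).exists
    obtain ⟨q, htq, hqy⟩ := exists_rat_btwn (show t < ι y from hty)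
    have h2 := hg1 q x ⟨y, hxy, hqy.le⟩
    refine ⟨q, hι.injective (le_antisymm (h2.2 y hxy hqy.le) ?_)⟩
    by_contra! hlt
    have := ht _ (hgF q x) hlt
    linarith [h2.1]
  · rintro ⟨q, rfl⟩
    exact hgF q x

end NullSets

section OneEnded

variable {V : Type*} {G G' : SimpleGraph V} {x : V}

/-- Being one-ended at `x` depends only on the component of `x`. -/
theorem OneEndedAt.congr (h : OneEndedAt G x) (hle : G' ≤ G)
    (heq : ∀ y z, G.Reachable x y → G.Adj y z → G'.Adj y z) : OneEndedAt G' x := by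
  have h1 : ∀ K : Set V, ∀ u, G.Reachable x u → ∀ w, (within G K).Reachable u w →
      (within G' K).Reachable u w := fun K u hu w hw =>
    reachable_of_adj_imp (fun a b ha (hab : (within G K).Adj a b) =>
      ⟨heq a b (hu.trans (ha.mono (within_le _ _))) hab.1, hab.2⟩) hw
  have h2 : ∀ K : Set V, ∀ u w, (within G' K).Reachable u w → (within G K).Reachable u w :=
    fun K u w hw => hw.mono (within_mono hle subset_rfl)
  refine ⟨h.infinite.mono fun y hy => reachable_of_adj_imp (fun a b ha hab => heq a b ha hab) hy,
    fun K hK u v hu hv hui hvi => ?_⟩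
  refine h1 _ u (hu.mono hle) v (h.reachable K hK u v (hu.mono hle) (hv.mono hle) ?_ ?_)
  · exact hui.mono fun w hw => h2 _ u w hw
  · exact hvi.mono fun w hw => h2 _ v w hw

/-- One-endedness of a component in terms of reachability in the whole graph. -/
theorem IsOneEnded.oneEndedAt (h : IsOneEnded (G.connectedComponentMk x).toSimpleGraph) :
    OneEndedAt G x := by
  obtain ⟨-, h⟩ := h
  set C := G.connectedComponentMk x
  have hmem : ∀ y, y ∈ C ↔ G.Reachable x y := fun y => by
    change G.connectedComponentMk y = G.connectedComponentMk x ↔ _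
    rw [SimpleGraph.ConnectedComponent.eq]
    exact ⟨fun h => h.symm, fun h => h.symm⟩
  refine ⟨?_, fun K hK u v hu hv hui hvi => ?_⟩
  · obtain ⟨D, hD, -⟩ := h ∅ Set.finite_empty
    refine (hD.image Subtype.val_injective.injOn).mono ?_
    rintro _ ⟨y, -, rfl⟩
    exact (hmem _).1 y.2
  let K' : Set C := Subtype.val ⁻¹' K
  have hK' : K'.Finite := hK.preimage Subtype.val_injective.injOn
  have hout : ∀ w, {z | (within G Kᶜ).Reachable w z}.Infinite → w ∉ K := by
    intro w hw hwK
    refine hw ((Set.finite_singleton w).subset fun z hz => ?_)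
    by_contra hne
    obtain ⟨a, b, ha, hab, rfl, -⟩ := exists_adj_of_reachable (P := fun a => a = w) rfl hne hz
    exact hab.2.1 hwK
  -- reachability in the complement of `K` is reachability in the complement of `K'`
  have key : ∀ (w : V) (hw : w ∈ C) (hwK : w ∉ K) (z : V), (within G Kᶜ).Reachable w z →
      ∃ (hz : z ∈ C) (hzK : z ∉ K), (C.toSimpleGraph.induce K'ᶜ).Reachable ⟨⟨w, hw⟩, hwK⟩
        ⟨⟨z, hz⟩, hzK⟩ := by
    intro w hw hwK z hz
    refine reachable_induction (P := fun z => ∃ (hz : z ∈ C) (hzK : z ∉ K),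
      (C.toSimpleGraph.induce K'ᶜ).Reachable ⟨⟨w, hw⟩, hwK⟩ ⟨⟨z, hz⟩, hzK⟩)
      ⟨hw, hwK, SimpleGraph.Reachable.refl _⟩ ?_ hz
    rintro a b - ⟨ha, haK, har⟩ hab
    refine ⟨(hmem b).2 (((hmem a).1 ha).trans hab.1.reachable), hab.2.2,
      har.trans (SimpleGraph.Adj.reachable ?_)⟩
    exact hab.1
  have hinf : ∀ (w : V) (hw : w ∈ C) (hwK : w ∉ K), {z | (within G Kᶜ).Reachable w z}.Infinite →
      (C.toSimpleGraph.componentComplMk (K := K') (v := ⟨w, hw⟩) hwK).supp.Infinite := by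
    intro w hw hwK hwi hfin
    refine hwi ((hfin.image Subtype.val).subset fun z hz => ?_)
    obtain ⟨hzC, hzK, hr⟩ := key w hw hwK z hz
    exact ⟨⟨z, hzC⟩, ⟨hzK, (SimpleGraph.ConnectedComponent.eq.2 hr).symm⟩, rfl⟩
  obtain ⟨D, -, hD⟩ := h K' hK'
  have h1 := hD _ (hinf u ((hmem u).2 hu) (hout u hui) hui)
  have h2 := hD _ (hinf v ((hmem v).2 hv) (hout v hvi) hvi)
  have h3 := SimpleGraph.ConnectedComponent.eq.1 (h1.trans h2.symm)
  let φ : C.toSimpleGraph.induce K'ᶜ →g within G Kᶜ :=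
    ⟨fun a => a.1.1, fun {a b} hab => ⟨hab, a.2, b.2⟩⟩
  exact h3.map φ

end OneEnded

/-! ### Reduction to Borel enumerations -/

section Reduction

/-- The edges of `G` inside the classes of `F`. -/
def classGraph {V : Type*} (G : SimpleGraph V) (F : Setoid V) : SimpleGraph V where
  Adj x y := G.Adj x y ∧ F x y
  symm := ⟨fun _ _ h => ⟨h.1.symm, F.symm h.2⟩⟩
  loopless := ⟨fun _ h => h.1.ne rfl⟩

variable {X : Type*} [TopologicalSpace X] [PolishSpace X] [MeasurableSpace X] [BorelSpace X]
  {G : SimpleGraph X} {μ : Measure X}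

/-- Up to a null union of components, a one-ended hyperfinite graphing has a Borel enumeration of
its components and an exhaustion by finite Borel subgraphs. -/
theorem IsGraphing.exists_isTame [IsFiniteMeasure μ] (hG : IsGraphing G μ)
    (hlf : IsLocallyFinite G) (hend : IsOneEndedAE G μ) (hhyp : IsHyperfinite G μ)
    {p : X → Prop} (hp : ∀ᵐ x ∂μ, p x) :
    ∃ (S : Set X) (e : ℕ → X → X) (H : ℕ → SimpleGraph X), MeasurableSet S ∧ μ Sᶜ = 0 ∧
      (∀ x ∈ S, p x) ∧ (∀ x y, G.Adj x y → x ∈ S → y ∈ S) ∧ IsTame (within G S) μ e ∧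
      (∀ᵐ x ∂μ, OneEndedAt (within G S) x) ∧ IsExhaustion (within G S) H := by
  classical
  obtain ⟨F, hFmono, hFm, hFfin, hF⟩ := hhyp
  choose g hgm hg using fun n => exists_aemeasurable_enum μ (F n) (hFm n) (hFfin n)
  have hae : ∀ᵐ x ∂μ, p x ∧ OneEndedAt G x ∧ (∀ y, G.Reachable x y ↔ ∃ n, F n x y) ∧
      ∀ n q, g n q x = (hgm n q).mk _ x := by
    have h1 : ∀ᵐ x ∂μ, ∀ n q, g n q x = (hgm n q).mk _ x :=
      ae_all_iff.2 fun n => ae_all_iff.2 fun q => (hgm n q).ae_eq_mk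
    filter_upwards [hp, hend, hF, h1] with x a1 a2 a3 a4
    exact ⟨a1, IsOneEnded.oneEndedAt a2, a3, a4⟩
  obtain ⟨S, hSm, hS0, hS, hSinv⟩ := hG.exists_invariant_subset hae
  have hadj : ∀ x y, x ∈ S → G.Adj x y → (within G S).Adj x y := fun x y hx hxy =>
    ⟨hxy, hx, hSinv x y hxy hx⟩
  have hreach : ∀ x ∈ S, ∀ y, (within G S).Reachable x y ↔ G.Reachable x y := fun x hx y =>
    ⟨fun h => h.mono (within_le _ _), fun h => (reachable_induction
      (P := fun y => y ∈ S ∧ (within G S).Reachable x y) ⟨hx, SimpleGraph.Reachable.refl _⟩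
      (fun u v _ hu huv => ⟨hSinv u v huv hu.1, hu.2.trans (hadj u v hu.1 huv).reachable⟩) h).2⟩
  have hout : ∀ x ∉ S, ∀ y, (within G S).Reachable x y → x = y := by
    intro x hx y hy
    by_contra hne
    obtain ⟨a, b, -, hab, rfl, -⟩ := exists_adj_of_reachable (P := fun a => x = a) rfl hne hy
    exact hx hab.2.1
  obtain ⟨c, hc⟩ := exists_surjective_nat (ℕ × ℚ)
  let e : ℕ → X → X := fun i x => if x ∈ S then (hgm (c i).1 (c i).2).mk _ x else x
  have he : IsEnum (within G S) e := by
    refine ⟨fun i => Measurable.ite hSm (hgm _ _).measurable_mk measurable_id, fun x y => ?_⟩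
    by_cases hx : x ∈ S
    · rw [hreach x hx, (hS x hx).2.2.1]
      simp only [e, if_pos hx, ← (hS x hx).2.2.2]
      constructor
      · rintro ⟨n, hn⟩
        obtain ⟨q, hq⟩ := (hg n x y).1 hn
        obtain ⟨i, hi⟩ := hc (n, q)
        exact ⟨i, by rw [hi]; exact hq⟩
      · rintro ⟨i, hi⟩
        exact ⟨_, (hg _ x y).2 ⟨_, hi⟩⟩
    · simp only [e, if_neg hx]
      exact ⟨fun h => ⟨0, hout x hx y h⟩, fun ⟨_, h⟩ => h ▸ SimpleGraph.Reachable.refl _⟩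
  have hA : Measurable fun q : X × X => (within G S).Adj q.1 q.2 :=
    measurable_within_const (measurableSet_setOfPred.1 hG.measurableSet_adj) hSm
  have hfin : ∀ x, {y | (within G S).Adj x y}.Finite := fun x =>
    (hlf x).subset fun y hy => (within_le _ _ hy : G.Adj x y)
  have hSae : ∀ᵐ x ∂μ, x ∈ S := mem_ae_iff.2 hS0
  have hdeg : ∀ A B : Set X, ∫⁻ x in A, ∑' y, ind ((within G S).Adj x y ∧ y ∈ B) ∂μ =
      ∫⁻ x in A, ((G.neighborSet x ∩ B).encard : ℝ≥0∞) ∂μ := by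
    intro A B
    refine lintegral_congr_ae (ae_restrict_of_ae ?_)
    filter_upwards [hSae] with x hx
    rw [tsum_ind_eq_encard]
    congr 2
    ext y
    exact ⟨fun h => ⟨h.1.1, h.2⟩, fun h => ⟨hadj x y hx h.1, h.2⟩⟩
  refine ⟨S, e, fun n => classGraph (within G S) (F n), hSm, hS0,
    fun x hx => (hS x hx).1, hSinv,
    ⟨he, hA, hfin, he.edge_transport hA hfin fun A B hA hB => ?_⟩, ?_, ?_⟩
  · rw [hdeg, hdeg, hG.lintegral_deg_comm A B hA hB]
  · filter_upwards [hSae] with x hx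
    exact (hS x hx).2.1.congr (within_le _ _) fun y z hy hyz =>
      hadj y z (mem_of_within_reachable ((hreach x hx y).2 hy) hx) hyz
  · refine ⟨fun n m hnm x y h => ⟨h.1, hFmono hnm h.2⟩, fun n x y h => h.1,
      fun n => hA.and (measurableSet_setOfPred.1 (hFm n)), fun n x => ?_, fun x y hxy => ?_⟩
    · exact (hFfin n x).subset fun y hy => reachable_induction (P := fun y => F n x y)
        ((F n).refl x) (fun u v _ hu (huv : (classGraph _ (F n)).Adj u v) =>
          (F n).trans hu huv.2) hy
    · obtain ⟨n, hn⟩ := ((hS x hxy.2.1).2.2.1 y).1 hxy.1.reachable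
      exact ⟨n, hxy, hn⟩

end Reduction

end GraphingFlow

theorem mainTheorem3 {X : Type*} [TopologicalSpace X] [PolishSpace X] [MeasurableSpace X]
    [BorelSpace X] (μ : MeasureTheory.Measure X) [MeasureTheory.IsProbabilityMeasure μ]
    (G : SimpleGraph X)
    (hG : GraphingFlow.IsGraphing G μ)
    (hlf : GraphingFlow.IsLocallyFinite G)
    (hend : GraphingFlow.IsOneEndedAE G μ)
    (hhyp : GraphingFlow.IsHyperfinite G μ)
    (f : X → ℤ) (hf : MeasureTheory.NullMeasurable f μ) (hfb : ∃ M : ℤ, ∀ x, |f x| ≤ M)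
    (hflow : ∃ φ : X → X → ℝ, GraphingFlow.IsFlow G f φ ∧ GraphingFlow.IsBoundedOnEdges G φ) :
    ∃ ψ : X → X → ℤ,
      GraphingFlow.IsFlow G f (fun x y => (ψ x y : ℝ)) ∧
      GraphingFlow.IsBoundedOnEdges G (fun x y => (ψ x y : ℝ)) ∧
      GraphingFlow.IsMeasurableOnEdges G μ ψ := by
  classical
  obtain ⟨φ, ⟨hφa, hφs⟩, C, hC⟩ := hflow
  obtain ⟨ψ₀, hψa, hψb, hψs⟩ := GraphingFlow.exists_integer_flow hlf hφa hφs
  have hfm := hf.aemeasurable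
  obtain ⟨S, e, H, hSm, hS0, hSf, hSinv, hT, hone, hH⟩ :=
    hG.exists_isTame hlf hend hhyp hfm.ae_eq_mk
  obtain ⟨lam, hlam⟩ := GraphingFlow.exists_isLayering hT hone hH
  have hadj : ∀ x y, x ∈ S → G.Adj x y → (GraphingFlow.within G S).Adj x y := fun x y hx hxy =>
    ⟨hxy, hx, hSinv x y hxy hx⟩
  have hsum : ∀ x, ∀ F : X → ℝ, (∀ y, F y ≠ 0 → G.Adj x y) →
      ∑ᶠ y ∈ G.neighborSet x, F y = ∑ᶠ y, F y := fun x F hF =>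
    by rw [finsum_mem_def, Set.indicator_eq_self.2
      (show Function.support F ⊆ G.neighborSet x from fun y hy => hF y hy)]
  -- on `S` the flow is replaced by a measurable one
  obtain ⟨φ₁, hφ₁m, hφ₁s, hφ₁⟩ := hT.exists_measurable_flow hH
    (f := fun x => if x ∈ S then hfm.mk f x else 0) (Measurable.ite hSm hfm.measurable_mk
      measurable_const) (C := |C| + 1)
    (ψ := fun x y => if (GraphingFlow.within G S).Adj x y then ψ₀ x y else 0)
    (fun x y => by
      by_cases hxy : (GraphingFlow.within G S).Adj x y
      · rw [if_pos hxy, if_pos hxy.symm, hψa x y hxy.1]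
      · rw [if_neg hxy, if_neg fun h => hxy h.symm, neg_zero])
    (fun x y => by
      split_ifs with hxy
      · have h1 := abs_sub_abs_le_abs_sub (ψ₀ x y : ℝ) (φ x y)
        linarith [hψb x y hxy.1, hC x y hxy.1, le_abs_self C]
      · rw [Int.cast_zero, abs_zero]
        positivity)
    (fun x y hne => by
      by_contra hxy
      exact hne (if_neg hxy))
    (fun x => by
      by_cases hx : x ∈ S
      · rw [if_pos hx, ← hSf x hx, ← hψs x]
        refine finsum_congr fun y => ?_
        by_cases hxy : G.Adj x y
        · rw [if_pos (hadj x y hx hxy), finsum_eq_if]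
          exact (if_pos hxy).symm
        · rw [if_neg fun h => hxy h.1, finsum_eq_if, Int.cast_zero]
          exact (if_neg hxy).symm
      · rw [if_neg hx, Int.cast_zero, finsum_eq_zero_of_forall_eq_zero]
        intro y
        rw [if_neg fun h => hx h.2.1, Int.cast_zero])
  obtain ⟨ψ₁, hψ₁m, hψ₁s, hψ₁⟩ := hT.exists_measurable_integer_flow hlam hφ₁m hφ₁s hφ₁
  have hgood := hT.ae_reachable (hψ₁.and (MeasureTheory.mem_ae_iff.2 hS0))
  set P : X → Prop := fun x => ∀ y, (GraphingFlow.within G S).Reachable x y → _ with hP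
  have hPS : ∀ x, P x → x ∈ S := fun x hx => (hx x (SimpleGraph.Reachable.refl _)).2
  have hPadj : ∀ x y, G.Adj x y → P x → P y := fun x y hxy hx z hz =>
    hx z ((hadj x y (hPS x hx) hxy).reachable.trans hz)
  have hPiff : ∀ x y, G.Adj x y → (P x ↔ P y) := fun x y hxy =>
    ⟨hPadj x y hxy, hPadj y x hxy.symm⟩
  have hPflow := fun x (hx : P x) => (hx x (SimpleGraph.Reachable.refl _)).1
  -- on the remaining null union of components any integer flow will do
  refine ⟨fun x y => if P x then ψ₁ x y else ψ₀ x y, ⟨fun x y hxy => ?_, fun x => ?_⟩,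
    ⟨|C| + 1 + 3, fun x y hxy => ?_⟩, fun q => ψ₁ q.1 q.2, hψ₁m, ?_⟩
  · by_cases hx : P x
    · simp only [if_pos hx, if_pos ((hPiff x y hxy).1 hx)]
      exact (hPflow x hx).antisymm y
    · simp only [if_neg hx, if_neg fun h => hx ((hPiff x y hxy).2 h)]
      rw [hψa x y hxy, Int.cast_neg]
  · by_cases hx : P x
    · simp only [if_pos hx]
      rw [hsum x _ fun y hy => (hψ₁s x y (by exact_mod_cast hy)).1, (hPflow x hx).sum,
        if_pos (hPS x hx), ← hSf x (hPS x hx)]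
    · simp only [if_neg hx]
      exact hψs x
  · by_cases hx : P x
    · simp only [if_pos hx]
      exact (hPflow x hx).bound y
    · simp only [if_neg hx]
      have h1 := abs_sub_abs_le_abs_sub (ψ₀ x y : ℝ) (φ x y)
      linarith [hψb x y hxy, hC x y hxy, le_abs_self C]
  · filter_upwards [hgood] with x hx y _
    exact if_pos hx
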